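/- Let $\mu$ be a positive Borel measure on $\mathbb{R}$ with $$\|\mu\|_{\ell^2(M)}^2 := \sum_{n\in\mathbb{Z}} \bigl[\mu([n,n+1])\bigr]^2 < \infty .$$ Let $$(H\mu)(k) = \lim_{\varepsilon\downarrow 0} \frac1\pi \int_{|k-y|>\varepsilon} \frac{d\mu(y)}{k-y}$$ be the Hilbert transform of $\mu$, and let $$(M_s\mu)(k) = \sup_{0<L\le 1} \frac{\mu([k-L,k+L])}{2L} \in [0,\infty]$$ be its short-range maximal function. Then $H\mu$ is well defined for Lebesgue-almost every $k\in\mathbb{R}$ (the truncated integrals converge absolutely and the limit exists), and $$\int_{\mathbb{R}} \log\Bigl[1+\frac{|(H\mu)(k)|^2}{k^2}\Bigr]\,(1+k^2)\,dk<\infty$$ if and only if $$\int_{\mathbb{R}} \log\Bigl[1+\frac{|(M_s\mu)(k)|^2}{k^2}\Bigr]\,(1+k^2)\,dk<\infty .$$ -/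

import Mathlib

open MeasureTheory Filter Topology Set
open scoped ENNReal

noncomputable section

/-- The square `∑ₙ μ([n, n+1])²` of the `ℓ²(M)` norm of a positive measure, the sum running over
all integers, with values in `[0, ∞]`. -/
def ell2MNormSq (μ : Measure ℝ) : ℝ≥0∞ :=
  ∑' n : ℤ, (μ (Icc (n : ℝ) ((n : ℝ) + 1))) ^ 2

/-- The short-range maximal function
`(M_s μ)(x) = sup_{0 < L ≤ 1} μ([x - L, x + L]) / (2 L)`, with values in `[0, ∞]`. -/
def shortMaximal (μ : Measure ℝ) (x : ℝ) : ℝ≥0∞ :=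
  ⨆ L ∈ Ioc (0 : ℝ) 1, μ (Icc (x - L) (x + L)) / ENNReal.ofReal (2 * L)

/-- The truncated Hilbert transform `(1/π) ∫_{|k - y| > ε} dμ(y) / (k - y)`. -/
def truncHilbert (μ : Measure ℝ) (ε k : ℝ) : ℝ :=
  Real.pi⁻¹ * ∫ y in {y : ℝ | ε < |k - y|}, (k - y)⁻¹ ∂μ

/-- The number `a` is the principal value `(1/π) p.v. ∫ dμ(y) / (k - y)`: all the truncated
integrals converge absolutely and they tend to `a` as `ε ↓ 0`. -/
def HasHilbertTransformAt (μ : Measure ℝ) (k a : ℝ) : Prop :=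
  (∀ ε : ℝ, 0 < ε → IntegrableOn (fun y : ℝ => (k - y)⁻¹) {y : ℝ | ε < |k - y|} μ) ∧
    Tendsto (fun ε : ℝ => truncHilbert μ ε k) (𝓝[>] 0) (𝓝 a)

/-- The Hilbert transform `(H μ)(k) = (1/π) p.v. ∫ dμ(y) / (k - y)`, with an unspecified value at
the points `k` where the principal value does not exist. -/
def hilbertTransform (μ : Measure ℝ) (k : ℝ) : ℝ :=
  limUnder (𝓝[>] (0 : ℝ)) (fun ε : ℝ => truncHilbert μ ε k)

/-- `log (1 + t)` for `t` in `[0, ∞]`, with values in `[0, ∞]`; its value at `∞` is `∞`. -/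
def logOneAdd (t : ℝ≥0∞) : ℝ≥0∞ := (ENNReal.log (1 + t)).toENNReal

end

/-! The core is an identity for a finite measure ν of compact support. Let F = P + iQ be its
`cauchyTransform`, where on the line of height ε the functions P and Q are the Poisson and conjugate
Poisson integrals. Since Re F ≥ 0 and F = O(1/|z|), the function log(1 + F) - F is holomorphic and
O(1/|z|²), so its integral over the line vanishes. With U = log(1 + Q²/(1 + P)²) and ψ(p) = p -
log(1 + p), the real part reads ∫ U = 2 ∫ ψ(P) (`integral_logRatio`). As log(1 + Q²) ≤ 4U + 12ψ(P)
and U ≤ log(1 + Q²), the integrals of log(1 + Q²) and of ψ(P) control each other.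

As ε ↓ 0, Q tends to Hν almost everywhere. Fatou's lemma bounds ∫ log(1 + (Hν)²) from above. For the
opposite bound no part of ∫ U may be lost at large values of U: integrating log(1 + F)² as well
gives an L² bound for log |1 + F| by ∫ U, so that U may be truncated at the constant 20
(`integral_psi_poissonInt_le`) and dominated convergence applies.

The function ψ(p) is comparable to min(p, p²), so ∫ ψ(P) can be compared with ∫ log(1 + N²), where N
is the dyadic maximal function of ν. One direction is a weak type bound for N by the part of P above
a multiple of the level, integrated over levels (`lintegral_log_dyadicMaximalTrunc_le`). The other
splits ν along {N > 1}: the part there enters linearly through its mass, the rest quadratically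
(`lintegral_psi_poissonInt_le_dyadicMaximal`).

For general μ the integrals are cut into unit intervals. With T = 1 + |n| and a cutoff χ around [n,
n + 1], the comparison is applied to ν = χμ/T; the weight is about T², which turns the integrals
into sums of T² ∫ log(1 + (v/T)²). The commutator T·Hν - χ·Hμ is bounded near the interval by a
sequence built from the discrete Hilbert transform of the unit masses of μ and a convolution, hence
lies in ℓ² (`abs_integral_commKernel_le`, `summable_commBound_sq`). An error e/T costs T²(e/T)² =
e², which is summable. Existence of Hμ comes from the same localization, Fatou's theorem for 1/(1 +
F), and the comparison of truncated with conjugate Poisson kernels at Lebesgue points. -/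

/-! ### Subadditivity and scaling of the extended logarithm -/

lemma logOneAdd_ofReal {x : ℝ} (hx : 0 ≤ x) :
    logOneAdd (ENNReal.ofReal x) = ENNReal.ofReal (Real.log (1 + x)) := by
  unfold logOneAdd
  rw [← ENNReal.ofReal_one, ← ENNReal.ofReal_add zero_le_one hx,
    ENNReal.log_ofReal_of_pos (by linarith)]
  simp

@[simp] lemma logOneAdd_top : logOneAdd ∞ = ∞ := by
  simp [logOneAdd]

lemma logOneAdd_mono : Monotone logOneAdd := fun a b h => by
  unfold logOneAdd
  exact EReal.toENNReal_le_toENNReal (ENNReal.log_monotone (add_le_add_right h 1))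

lemma measurable_logOneAdd : Measurable logOneAdd := logOneAdd_mono.measurable

lemma logOneAdd_le_self (t : ℝ≥0∞) : logOneAdd t ≤ t := by
  induction t with
  | top => simp
  | coe t =>
    have ht : (0:ℝ) ≤ t := t.2
    rw [← ENNReal.ofReal_coe_nnreal, logOneAdd_ofReal ht]
    apply ENNReal.ofReal_le_ofReal
    have := Real.log_le_sub_one_of_pos (show (0:ℝ) < 1 + t by positivity)
    linarith

lemma logOneAdd_add_le (s t : ℝ≥0∞) : logOneAdd (s + t) ≤ logOneAdd s + logOneAdd t := by
  induction s with
  | top => simp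
  | coe s =>
    induction t with
    | top => simp
    | coe t =>
      have hs : (0:ℝ) ≤ s := s.2
      have ht : (0:ℝ) ≤ t := t.2
      rw [← ENNReal.ofReal_coe_nnreal, ← ENNReal.ofReal_coe_nnreal, ← ENNReal.ofReal_add hs ht,
        logOneAdd_ofReal hs, logOneAdd_ofReal ht, logOneAdd_ofReal (by positivity),
        ← ENNReal.ofReal_add (Real.log_nonneg (by linarith)) (Real.log_nonneg (by linarith))]
      apply ENNReal.ofReal_le_ofReal
      rw [← Real.log_mul (by positivity) (by positivity)]
      apply Real.log_le_log (by positivity)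
      nlinarith [mul_nonneg hs ht]

/-- Bernoulli's inequality 1 + ct ≤ (1 + t)^c. It lets multiplicative constants leave the logarithm,
so comparable functions have comparable logarithmic integrals. -/
lemma logOneAdd_mul_le {c : ℝ} (hc : 1 ≤ c) (t : ℝ≥0∞) :
    logOneAdd (ENNReal.ofReal c * t) ≤ ENNReal.ofReal c * logOneAdd t := by
  induction t with
  | top => simp [ENNReal.mul_top, show ENNReal.ofReal c ≠ 0 by simp; linarith]
  | coe t =>
    have ht : (0:ℝ) ≤ t := t.2
    have hc0 : 0 ≤ c := by linarith
    rw [← ENNReal.ofReal_coe_nnreal, ← ENNReal.ofReal_mul hc0,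
        logOneAdd_ofReal ht, logOneAdd_ofReal (by positivity), ← ENNReal.ofReal_mul hc0]
    apply ENNReal.ofReal_le_ofReal
    rw [← Real.log_rpow (by positivity)]
    apply Real.log_le_log (by positivity)
    exact one_add_mul_self_le_rpow_one_add (by linarith) hc

lemma ENNReal.add_sq_le_two_mul (s t : ℝ≥0∞) : (s + t) ^ 2 ≤ 2 * (s ^ 2 + t ^ 2) := by
  induction s with
  | top => simp
  | coe s =>
    induction t with
    | top => simp
    | coe t =>
      have h : (s + t) ^ 2 ≤ 2 * (s ^ 2 + t ^ 2) := add_sq_le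
      have h' := ENNReal.coe_le_coe.2 h
      push_cast at h'
      exact h'

lemma logOneAdd_sq_add_le (s t : ℝ≥0∞) :
    logOneAdd ((s + t) ^ 2) ≤ 2 * (logOneAdd (s ^ 2) + logOneAdd (t ^ 2)) := by
  have h := ENNReal.add_sq_le_two_mul s t
  rw [show (2 : ℝ≥0∞) = ENNReal.ofReal 2 by simp] at h ⊢
  exact (logOneAdd_mono h).trans ((logOneAdd_mul_le one_le_two _).trans
    (by gcongr; exact logOneAdd_add_le _ _))

/-! ### Elementary inequalities for p - log(1 + p) -/

/-- The function `p ↦ p - log (1 + p)`. -/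
noncomputable def psi (p : ℝ) : ℝ := p - Real.log (1 + p)

lemma psi_nonneg {p : ℝ} (hp : 0 ≤ p) : 0 ≤ psi p := by
  have := Real.log_le_sub_one_of_pos (show (0:ℝ) < 1 + p by positivity)
  unfold psi; linarith

lemma psi_le_self {p : ℝ} (hp : 0 ≤ p) : psi p ≤ p := by
  have := Real.log_nonneg (show (1:ℝ) ≤ 1 + p by linarith)
  unfold psi; linarith

lemma psi_le_sq {p : ℝ} (hp : 0 ≤ p) : psi p ≤ p ^ 2 := by
  have h := Real.one_sub_inv_le_log_of_pos (show (0:ℝ) < 1 + p by positivity)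
  have : p - p ^ 2 ≤ 1 - (1 + p)⁻¹ := by
    rw [← sub_nonneg]
    have : 1 - (1 + p)⁻¹ - (p - p ^ 2) = p ^ 3 / (1 + p) := by field_simp; ring
    rw [this]; positivity
  unfold psi; linarith

lemma monotoneOn_psi : MonotoneOn psi (Ici 0) := by
  intro x hx y hy hxy
  simp only [mem_Ici] at hx hy
  have h : Real.log ((1 + y) / (1 + x)) ≤ (1 + y) / (1 + x) - 1 :=
    Real.log_le_sub_one_of_pos (by positivity)
  rw [Real.log_div (by positivity) (by positivity)] at h
  have : (1 + y) / (1 + x) - 1 ≤ y - x := by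
    rw [div_sub_one (by positivity), div_le_iff₀ (by positivity)]
    nlinarith
  unfold psi; linarith

/-- The larger summand decides: ψ(2y) ≤ 4y² if x ≤ y, and ψ(x + y) ≤ x + y ≤ 2x otherwise. The
asymmetry allows an integrable x to be paired with a square integrable y. -/
lemma psi_add_le {x y : ℝ} (hx : 0 ≤ x) (hy : 0 ≤ y) : psi (x + y) ≤ 2 * x + 4 * y ^ 2 := by
  rcases le_total x y with h | h
  · have h1 := monotoneOn_psi (show x + y ∈ Ici 0 by simp; linarith)
      (show 2 * y ∈ Ici 0 by simp; linarith) (by linarith)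
    have h2 := psi_le_sq (show 0 ≤ 2 * y by linarith)
    nlinarith
  · have h1 := psi_le_self (show 0 ≤ x + y by linarith)
    nlinarith

/-- With s = √(1 + p), the bound log s ≤ s - 1 gives ψ(p) ≥ (s - 1)², while p = (s - 1)(s + 1). For
p ≤ 1 one has (s + 1)² ≤ (√2 + 1)² < 6; for p ≥ 1, s ≥ √2 > 1.4, and 6(s - 1) ≥ s + 1 holds from s =
1.4 on. -/
lemma min_le_psi {p : ℝ} (hp : 0 ≤ p) : min p (p ^ 2) ≤ 6 * psi p := by
  set s := √(1 + p) with hs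
  have hs2 : s ^ 2 = 1 + p := Real.sq_sqrt (by linarith)
  have hs1 : 1 ≤ s := by rw [hs]; exact Real.one_le_sqrt.2 (by linarith)
  have hlog : Real.log (1 + p) ≤ 2 * (s - 1) := by
    rw [← hs2, Real.log_pow]
    have := Real.log_le_sub_one_of_pos (show 0 < s by linarith)
    push_cast; linarith
  have hψ : (s - 1) ^ 2 ≤ psi p := by unfold psi; nlinarith
  have hps : p = (s - 1) * (s + 1) := by nlinarith
  have hp2 : p ^ 2 = (s - 1) ^ 2 * (s + 1) ^ 2 := by rw [hps]; ring
  rcases le_total p 1 with h | h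
  · refine (min_le_right _ _).trans ?_
    rw [hp2]
    have : (s + 1) ^ 2 ≤ 6 := by nlinarith
    nlinarith [sq_nonneg (s - 1)]
  · refine (min_le_left _ _).trans ?_
    have : p ≤ 6 * (s - 1) ^ 2 := by
      by_contra! hc
      have h3 : s - 1 > 0.4 := by nlinarith
      nlinarith
    linarith

/-- For p ≤ 1 the denominator is at most 4 and Bernoulli's inequality gives the factor 4. For p ≥ 1
the factor (1 + p)² is split off, and 2 log(1 + p) ≤ 2p ≤ 12ψ(p). -/
lemma log_one_add_sq_le {p q : ℝ} (hp : 0 ≤ p) :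
    Real.log (1 + q ^ 2) ≤ 4 * Real.log (1 + q ^ 2 / (1 + p) ^ 2) + 12 * psi p := by
  have hu : 0 ≤ Real.log (1 + q ^ 2 / (1 + p) ^ 2) :=
    Real.log_nonneg (by have : 0 ≤ q ^ 2 / (1 + p) ^ 2 := by positivity
                        linarith)
  have hψ := psi_nonneg hp
  rcases le_total p 1 with h | h
  · have : 1 + q ^ 2 ≤ (1 + q ^ 2 / (1 + p) ^ 2) ^ 4 := by
      have h1 : q ^ 2 / 4 ≤ q ^ 2 / (1 + p) ^ 2 := by gcongr; nlinarith
      set t := q ^ 2 / (1 + p) ^ 2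
      have ht : 0 ≤ t := by positivity
      have := one_add_mul_le_pow (show -2 ≤ t by linarith) 4
      push_cast at this; linarith
    have := Real.log_le_log (by positivity) this
    rw [Real.log_pow] at this
    push_cast at this; linarith
  · have h1 : Real.log (1 + q ^ 2) ≤
        Real.log (1 + q ^ 2 / (1 + p) ^ 2) + 2 * Real.log (1 + p) := by
      have : 2 * Real.log (1 + p) = Real.log ((1 + p) ^ 2) := by rw [Real.log_pow]; norm_num
      rw [this, ← Real.log_mul (by positivity) (by positivity)]
      apply Real.log_le_log (by positivity)
      have : (1 + q ^ 2 / (1 + p) ^ 2) * (1 + p) ^ 2 = (1 + p) ^ 2 + q ^ 2 := by field_simp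
      rw [this]; nlinarith
    have h2 : Real.log (1 + p) ≤ p := by unfold psi at hψ; linarith
    have h3 := min_le_psi hp
    rw [min_eq_left (by nlinarith)] at h3
    linarith

/-! ### The Poisson kernel and contour integrals over horizontal lines -/

/-- The Poisson kernel `π⁻¹ ε / (t² + ε²)` of the upper half-plane. -/
noncomputable def halfPlanePoisson (ε t : ℝ) : ℝ := Real.pi⁻¹ * (ε / (t ^ 2 + ε ^ 2))

lemma halfPlanePoisson_nonneg {ε : ℝ} (hε : 0 ≤ ε) (t : ℝ) : 0 ≤ halfPlanePoisson ε t := by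
  unfold halfPlanePoisson; positivity

lemma continuous_halfPlanePoisson {ε : ℝ} (hε : 0 < ε) : Continuous (halfPlanePoisson ε) := by
  unfold halfPlanePoisson
  exact continuous_const.mul (continuous_const.div (by fun_prop) fun t => by positivity)

lemma halfPlanePoisson_eq {ε : ℝ} (hε : 0 < ε) (t : ℝ) :
    halfPlanePoisson ε t = Real.pi⁻¹ * (ε⁻¹ * (1 + (t * ε⁻¹) ^ 2)⁻¹) := by
  unfold halfPlanePoisson
  field_simp
  ring

lemma integrable_halfPlanePoisson {ε : ℝ} (hε : 0 < ε) : Integrable (halfPlanePoisson ε) := by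
  rw [show halfPlanePoisson ε = fun t => _ from funext (halfPlanePoisson_eq hε)]
  exact ((integrable_inv_one_add_sq.comp_mul_right' (inv_ne_zero hε.ne')).const_mul _).const_mul _

lemma integral_halfPlanePoisson {ε : ℝ} (hε : 0 < ε) : ∫ t, halfPlanePoisson ε t = 1 := by
  rw [show halfPlanePoisson ε = fun t => _ from funext (halfPlanePoisson_eq hε)]
  rw [integral_const_mul, integral_const_mul,
    Measure.integral_comp_mul_right (fun t => (1 + t ^ 2)⁻¹) ε⁻¹, integral_univ_inv_one_add_sq]
  simp [abs_of_pos hε]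
  field_simp

lemma integrable_of_norm_le_div {f : ℝ → ℂ} (hf : Continuous f) {C : ℝ}
    (h : ∀ x, ‖f x‖ ≤ C / (1 + x ^ 2)) : Integrable f := by
  refine (integrable_inv_one_add_sq.const_mul C).mono' hf.aestronglyMeasurable
    (Eventually.of_forall fun x => ?_)
  simpa [div_eq_mul_inv] using h x

lemma continuous_comp_horizontal {f : ℂ → ℂ} {ε : ℝ}
    (hf : ∀ z : ℂ, ε ≤ z.im → DifferentiableAt ℂ f z) :
    Continuous fun x : ℝ => f (x + ε * Complex.I) := by
  rw [continuous_iff_continuousAt]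
  intro x
  have h1 : ContinuousAt f (x + ε * Complex.I) := (hf _ (by simp)).continuousAt
  exact ContinuousAt.comp (f := fun x : ℝ => (x : ℂ) + ε * Complex.I) h1 (by fun_prop)

/-- The part of the closed half-plane in a large disc is compact and f is continuous on it, so decay
at infinity alone yields a bound everywhere. -/
lemma exists_norm_le_div_of_large {f : ℂ → ℂ} {ε C R : ℝ}
    (hf : ∀ z : ℂ, ε ≤ z.im → DifferentiableAt ℂ f z)
    (hb : ∀ z : ℂ, ε ≤ z.im → R ≤ ‖z‖ → ‖f z‖ ≤ C / ‖z‖ ^ 2) :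
    ∃ C' : ℝ, 0 ≤ C' ∧ ∀ z : ℂ, ε ≤ z.im → ‖f z‖ ≤ C' / (1 + ‖z‖ ^ 2) := by
  set K : Set ℂ := Metric.closedBall 0 (max R 1) ∩ {z | ε ≤ z.im}
  have hK : IsCompact K := (isCompact_closedBall _ _).inter_right
    (isClosed_le continuous_const Complex.continuous_im)
  have hc : ContinuousOn (fun z => ‖f z‖ * (1 + ‖z‖ ^ 2)) K := by
    have : ContinuousOn f K := fun z hz => (hf z hz.2).continuousAt.continuousWithinAt
    fun_prop
  obtain ⟨C1, hC1⟩ := hK.bddAbove_image hc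
  refine ⟨max (max C1 (2 * C)) 0, le_max_right _ _, fun z hz => ?_⟩
  rw [le_div_iff₀ (by positivity)]
  refine le_trans ?_ (le_max_left _ _)
  by_cases h : ‖z‖ ≤ max R 1
  · exact (hC1 ⟨z, ⟨by simpa using h, hz⟩, rfl⟩).trans (le_max_left _ _)
  · push Not at h
    have h1 : R ≤ ‖z‖ := (le_max_left _ _).trans h.le
    have h2 : 1 ≤ ‖z‖ := (le_max_right _ _).trans h.le
    refine le_trans ?_ (le_max_right _ _)
    have h3 := hb z hz h1
    rw [le_div_iff₀ (by positivity)] at h3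
    have h4 : 1 ≤ ‖z‖ ^ 2 := one_le_pow₀ h2
    nlinarith [mul_nonneg (norm_nonneg (f z)) (sub_nonneg.2 h4)]

/-- The integral over a horizontal line of a holomorphic function which decays quadratically
above this line vanishes. -/
lemma integral_horizontal_eq_zero {f : ℂ → ℂ} {ε C R : ℝ} (hε : 0 ≤ ε)
    (hf : ∀ z : ℂ, ε ≤ z.im → DifferentiableAt ℂ f z)
    (hb : ∀ z : ℂ, ε ≤ z.im → R ≤ ‖z‖ → ‖f z‖ ≤ C / ‖z‖ ^ 2) :
    Integrable (fun x : ℝ => f (x + ε * Complex.I)) ∧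
      ∫ x : ℝ, f (x + ε * Complex.I) = 0 := by
  obtain ⟨D, hD, hb'⟩ := exists_norm_le_div_of_large hf hb
  have hint : Integrable (fun x : ℝ => f (x + ε * Complex.I)) := by
    refine integrable_of_norm_le_div (continuous_comp_horizontal hf) (C := D) fun x => ?_
    refine (hb' _ (by simp)).trans
      (div_le_div_of_nonneg_left hD (by positivity) (add_le_add le_rfl ?_))
    rw [← Complex.normSq_eq_norm_sq, Complex.normSq_apply]
    simp
    nlinarith [mul_self_nonneg ε]
  refine ⟨hint, ?_⟩
  have hlim := intervalIntegral_tendsto_integral hint tendsto_neg_atTop_atBot tendsto_id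
  refine tendsto_nhds_unique hlim ?_
  have hDR : Tendsto (fun r : ℝ => 4 * D / r) atTop (𝓝 0) :=
    tendsto_const_nhds.div_atTop tendsto_id
  refine squeeze_zero_norm' ?_ hDR
  filter_upwards [eventually_ge_atTop (max ε 1)] with r hr
  have hr1 : 1 ≤ r := (le_max_right _ _).trans hr
  have hrε : ε ≤ r := (le_max_left _ _).trans hr
  have hr0 : 0 < r := by linarith
  -- Cauchy's theorem on [-r, r] × [ε, r]. The top side has length 2r, the vertical ones at most r,
  -- and |f| ≤ D/r² on all three, so they contribute at most 4D/r.
  have hrect := Complex.integral_boundary_rect_eq_zero_of_differentiableOn f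
    (-r + ε * Complex.I) (r + r * Complex.I) (fun z hz => by
      have hz2 := hz.2
      simp [uIcc_of_le hrε] at hz2
      exact (hf z hz2.1).differentiableWithinAt)
  simp only [Complex.add_re, Complex.neg_re, Complex.ofReal_re, Complex.mul_re, Complex.I_re,
    mul_zero, Complex.ofReal_im, Complex.I_im, mul_one, sub_self, add_zero, Complex.add_im,
    Complex.neg_im, Complex.mul_im, zero_add, neg_zero, Complex.ofReal_neg] at hrect
  have bnd : ∀ z : ℂ, ε ≤ z.im → r ≤ ‖z‖ → ‖f z‖ ≤ D / r ^ 2 := fun z hz hzr =>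
    (hb' z hz).trans (by gcongr; nlinarith)
  have htop : ‖∫ x : ℝ in (-r)..r, f (x + r * Complex.I)‖ ≤ 2 * D / r := by
    have := intervalIntegral.norm_integral_le_of_norm_le_const (a := -r) (b := r)
      (f := fun x : ℝ => f (x + r * Complex.I)) (C := D / r ^ 2) (fun x _ => by
        refine bnd _ (by simpa using hrε) ?_
        have := Complex.abs_im_le_norm ((x : ℂ) + r * Complex.I)
        simp at this
        exact (le_abs_self r).trans this)
    refine this.trans (le_of_eq ?_)
    rw [abs_of_nonneg (by linarith)]; field_simp; ring
  have hside : ∀ s : ℝ, |s| = r →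
      ‖∫ y : ℝ in ε..r, f (s + y * Complex.I)‖ ≤ D / r := fun s hs => by
    have := intervalIntegral.norm_integral_le_of_norm_le_const (a := ε) (b := r)
      (f := fun y : ℝ => f (s + y * Complex.I)) (C := D / r ^ 2) (fun y hy => by
        rw [uIoc_of_le hrε] at hy
        refine bnd _ (by simpa using hy.1.le) ?_
        have := Complex.abs_re_le_norm ((s : ℂ) + y * Complex.I)
        simp at this
        exact hs ▸ this)
    refine this.trans ?_
    rw [abs_of_nonneg (by linarith), div_mul_eq_mul_div, div_le_div_iff₀ (by positivity) hr0]
    nlinarith [mul_nonneg hD hr0.le, mul_nonneg (mul_nonneg hD hr0.le) hε]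
  have h1 := hside r (abs_of_pos hr0)
  have h2 := hside (-r) (by rw [abs_neg, abs_of_pos hr0])
  simp only [Complex.ofReal_neg] at h2
  set A := ∫ x : ℝ in (-r)..r, f (x + ε * Complex.I)
  set B := ∫ x : ℝ in (-r)..r, f (x + r * Complex.I)
  set E := ∫ y : ℝ in ε..r, f (r + y * Complex.I)
  set G := ∫ y : ℝ in ε..r, f (-r + y * Complex.I)
  have hA : A = B - Complex.I • E + Complex.I • G := by linear_combination hrect
  have : ‖A‖ ≤ ‖B‖ + ‖E‖ + ‖G‖ := by
    rw [hA]
    refine (norm_add_le _ _).trans (add_le_add ((norm_sub_le _ _).trans (add_le_add le_rfl ?_)) ?_)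
    all_goals simp
  calc ‖A‖ ≤ 2 * D / r + D / r + D / r := by linarith
    _ = 4 * D / r := by ring

/-- The Poisson formula for a bounded holomorphic function on a half-plane. -/
lemma poisson_formula {g : ℂ → ℂ} {ε δ C : ℝ} (hε : 0 ≤ ε) (hδ : 0 < δ)
    (hg : ∀ z : ℂ, ε ≤ z.im → DifferentiableAt ℂ g z)
    (hb : ∀ z : ℂ, ε ≤ z.im → ‖g z‖ ≤ C) (x : ℝ) :
    g (x + (ε + δ : ℝ) * Complex.I) =
      ∫ t : ℝ, (halfPlanePoisson δ (x - t) : ℂ) * g (t + ε * Complex.I) := by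
  set z : ℂ := x + (ε + δ : ℝ) * Complex.I with hz
  -- The reflection of z in the line Im = ε; it lies below the line, so 1/(w - z') is holomorphic on
  -- and above it.
  set z' : ℂ := x + (ε - δ : ℝ) * Complex.I with hz'
  have hzim : z.im = ε + δ := by simp [hz]
  have hz'im : z'.im = ε - δ := by simp [hz']
  have hC : 0 ≤ C := (norm_nonneg _).trans (hb z (by rw [hzim]; linarith))
  have hne : ∀ w : ℂ, ε ≤ w.im → w - z' ≠ 0 := fun w hw h => by
    have := congrArg Complex.im h
    simp [hz'im] at this; linarith
  have hds : ∀ w : ℂ, ε ≤ w.im → DifferentiableAt ℂ (dslope g z) w := fun w hw => by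
    by_cases hwz : w = z
    · rw [hwz]
      have hV : {v : ℂ | ε < v.im} ∈ 𝓝 z :=
        (isOpen_lt continuous_const Complex.continuous_im).mem_nhds (by simp [hzim, hδ])
      have hd : DifferentiableOn ℂ g {v : ℂ | ε < v.im} := fun v hv =>
        (hg v (le_of_lt hv)).differentiableWithinAt
      exact ((Complex.differentiableOn_dslope hV).2 hd).differentiableAt hV
    · exact (differentiableAt_dslope_of_ne hwz).2 (hg w hw)
  -- The divided difference removes the singularity at z, and boundedness of g gives quadratic
  -- decay. On the line (w - z)(w - z') = (x - t)² + δ², so the integrand is π/δ times the Poisson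
  -- kernel times g(w) - g(z).
  have key := integral_horizontal_eq_zero (f := fun w => dslope g z w / (w - z')) (ε := ε)
    (C := 8 * C) (R := 2 * (‖z‖ + ‖z'‖ + 1)) hε
    (fun w hw => (hds w hw).div (by fun_prop) (hne w hw)) (fun w hw hwR => by
      have h1 : ‖w‖ / 2 ≤ ‖w - z‖ := by
        have := norm_sub_norm_le w z
        have := norm_nonneg z'
        linarith
      have h2 : ‖w‖ / 2 ≤ ‖w - z'‖ := by
        have := norm_sub_norm_le w z'
        have := norm_nonneg z
        linarith
      have h0 : 0 < ‖w‖ := by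
        have := norm_nonneg z
        have := norm_nonneg z'
        linarith
      have hwz : w ≠ z := fun h => by simp [h] at h1; rw [h] at h0; linarith
      rw [dslope_of_ne _ hwz, slope_def_field, norm_div, norm_div]
      have h3 : ‖g w - g z‖ ≤ 2 * C := (norm_sub_le _ _).trans (by
        have := hb w hw
        have := hb z (by rw [hzim]; linarith)
        linarith)
      calc _ ≤ 2 * C / (‖w‖ / 2) / (‖w‖ / 2) := by gcongr
        _ = _ := by field_simp; ring)
  have hfun : ∀ t : ℝ, dslope g z (t + ε * Complex.I) / (t + ε * Complex.I - z') =
      (Real.pi / δ : ℝ) * ((halfPlanePoisson δ (x - t) : ℂ) * g (t + ε * Complex.I) -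
        (halfPlanePoisson δ (x - t) : ℂ) * g z) := fun t => by
    have hwz : (t : ℂ) + ε * Complex.I ≠ z := fun h => by
      have := congrArg Complex.im h
      simp [hzim] at this; linarith
    rw [dslope_of_ne _ hwz, slope_def_field]
    have e1 : (t : ℂ) + ε * Complex.I - z = (t - x : ℝ) - δ * Complex.I := by
      rw [hz]; push_cast; ring
    have e2 : (t : ℂ) + ε * Complex.I - z' = (t - x : ℝ) + δ * Complex.I := by
      rw [hz']; push_cast; ring
    have e3 : ((t - x : ℝ) - δ * Complex.I : ℂ) * ((t - x : ℝ) + δ * Complex.I) =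
        (((x - t) ^ 2 + δ ^ 2 : ℝ) : ℂ) := by
      push_cast
      linear_combination (-(δ : ℂ) ^ 2) * Complex.I_sq
    rw [div_div, e1, e2, e3]
    have hpos : ((x - t) ^ 2 + δ ^ 2 : ℝ) ≠ 0 := by positivity
    have hpos' : (((x - t) ^ 2 + δ ^ 2 : ℝ) : ℂ) ≠ 0 := by exact_mod_cast hpos
    have hπ : (Real.pi : ℂ) ≠ 0 := by exact_mod_cast Real.pi_ne_zero
    have hδ' : (δ : ℂ) ≠ 0 := by exact_mod_cast hδ.ne'
    unfold halfPlanePoisson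
    push_cast at hpos' ⊢
    field_simp
  simp only [hfun] at key
  obtain ⟨-, key⟩ := key
  have hPi : Integrable fun t => halfPlanePoisson δ (x - t) :=
    (integrable_halfPlanePoisson hδ).comp_sub_left x
  have hP1 : ∫ t, halfPlanePoisson δ (x - t) = 1 := by
    rw [integral_sub_left_eq_self, integral_halfPlanePoisson hδ]
  have hint1 : Integrable fun t : ℝ =>
      (halfPlanePoisson δ (x - t) : ℂ) * g (t + ε * Complex.I) :=
    hPi.ofReal.mul_bdd (c := C) (continuous_comp_horizontal hg).aestronglyMeasurable
      (Eventually.of_forall fun t => hb _ (by simp))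
  have hPc : Integrable fun t => (halfPlanePoisson δ (x - t) : ℂ) := hPi.ofReal
  rw [integral_const_mul, integral_sub hint1 (hPc.mul_const _), integral_mul_const,
    integral_complex_ofReal, hP1] at key
  have hne0 : ((Real.pi / δ : ℝ) : ℂ) ≠ 0 := by
    exact_mod_cast (div_pos Real.pi_pos hδ).ne'
  have := (mul_eq_zero.1 key).resolve_left hne0
  rw [sub_eq_zero] at this
  rw [this]; simp

/-! ### Poisson integrals at Lebesgue points -/

lemma halfPlanePoisson_le_inv {ε : ℝ} (hε : 0 < ε) (t : ℝ) : halfPlanePoisson ε t ≤ 1 / ε := by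
  unfold halfPlanePoisson
  have h1 : Real.pi⁻¹ ≤ 1 := inv_le_one_of_one_le₀ (by linarith [Real.pi_gt_three])
  have h2 : ε / (t ^ 2 + ε ^ 2) ≤ 1 / ε := by
    rw [div_le_div_iff₀ (by positivity) hε]; nlinarith [sq_nonneg t]
  calc _ ≤ 1 * (ε / (t ^ 2 + ε ^ 2)) := by gcongr
    _ ≤ _ := by rwa [one_mul]

lemma halfPlanePoisson_le_div_sq {ε t s : ℝ} (hε : 0 < ε) (hs : 0 < s) (h : s ≤ |t|) :
    halfPlanePoisson ε t ≤ ε / s ^ 2 := by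
  unfold halfPlanePoisson
  have h1 : Real.pi⁻¹ ≤ 1 := inv_le_one_of_one_le₀ (by linarith [Real.pi_gt_three])
  have h2 : ε / (t ^ 2 + ε ^ 2) ≤ ε / s ^ 2 := by
    gcongr
    have : s ^ 2 ≤ t ^ 2 := by rw [← sq_abs t]; gcongr
    nlinarith [sq_nonneg ε]
  calc _ ≤ 1 * (ε / (t ^ 2 + ε ^ 2)) := by gcongr
    _ ≤ _ := by rwa [one_mul]

/-- A Poisson integral is dominated by a maximal function. -/
lemma lintegral_halfPlanePoisson_le {σ : Measure ℝ} {k ε : ℝ} {b : ℝ≥0∞} (hε : 0 < ε)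
    (h : ∀ r : ℝ, 0 < r → σ (Metric.closedBall k r) ≤ b * ENNReal.ofReal r) :
    ∫⁻ y, ENNReal.ofReal (halfPlanePoisson ε (k - y)) ∂σ ≤ 8 * b := by
  -- For the least j with |k - y| ≤ 2^j ε and j ≥ 1, the distance exceeds 2^(j-1) ε, so the kernel
  -- is at most 4/(4^j ε). A ball of radius 2^j ε has mass at most b 2^j ε, and the series of
  -- 4·2^(-j) sums to 8.
  have hpt : ∀ y, ENNReal.ofReal (halfPlanePoisson ε (k - y)) ≤
      ∑' j : ℕ, ENNReal.ofReal (4 / (4 ^ j * ε)) *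
        (Metric.closedBall k (2 ^ j * ε)).indicator 1 y := by
    intro y
    have hex : ∃ j : ℕ, |k - y| ≤ 2 ^ j * ε := by
      obtain ⟨j, hj⟩ := pow_unbounded_of_one_lt (|k - y| / ε) (one_lt_two)
      exact ⟨j, by rw [← div_le_iff₀ hε]; exact hj.le⟩
    classical
    set j := Nat.find hex with hjdef
    have hj : |k - y| ≤ 2 ^ j * ε := Nat.find_spec hex
    refine le_trans ?_ (ENNReal.le_tsum j)
    have hmem : y ∈ Metric.closedBall k (2 ^ j * ε) := by
      rw [Metric.mem_closedBall, Real.dist_eq, abs_sub_comm]; exact hj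
    rw [indicator_of_mem hmem]
    simp only [Pi.one_apply, mul_one]
    apply ENNReal.ofReal_le_ofReal
    rcases Nat.eq_zero_or_pos j with h0 | h0
    · rw [h0]
      refine (halfPlanePoisson_le_inv hε _).trans ?_
      rw [pow_zero, one_mul]; gcongr; norm_num
    · have hlt : ¬ |k - y| ≤ 2 ^ (j - 1) * ε := Nat.find_min hex (by omega)
      push Not at hlt
      refine (halfPlanePoisson_le_div_sq hε (by positivity) hlt.le).trans (le_of_eq ?_)
      obtain ⟨i, hi⟩ : ∃ i, j = i + 1 := ⟨j - 1, by omega⟩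
      rw [hi, Nat.add_sub_cancel, mul_pow, ← pow_mul, mul_comm i 2, pow_mul, pow_succ]
      norm_num
      field_simp
      exact pow_succ _ _
  have hsum : ∑' j : ℕ, ENNReal.ofReal (4 * (1 / 2) ^ j) = 8 := by
    rw [← ENNReal.ofReal_tsum_of_nonneg (fun j => by positivity)
      (summable_geometric_two.mul_left 4), tsum_mul_left, tsum_geometric_two]
    norm_num
  calc _ ≤ ∫⁻ y, ∑' j : ℕ, ENNReal.ofReal (4 / (4 ^ j * ε)) *
        (Metric.closedBall k (2 ^ j * ε)).indicator 1 y ∂σ := lintegral_mono hpt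
    _ = ∑' j : ℕ, ENNReal.ofReal (4 / (4 ^ j * ε)) * σ (Metric.closedBall k (2 ^ j * ε)) := by
      rw [lintegral_tsum fun j => ((measurable_one.indicator
        Metric.isClosed_closedBall.measurableSet).const_mul _).aemeasurable]
      congr 1; ext j
      rw [lintegral_const_mul' _ _ ENNReal.ofReal_ne_top,
        lintegral_indicator_one Metric.isClosed_closedBall.measurableSet]
    _ ≤ ∑' j : ℕ, ENNReal.ofReal (4 * (1 / 2) ^ j) * b := by
      refine ENNReal.tsum_le_tsum fun j => ?_
      calc _ ≤ ENNReal.ofReal (4 / (4 ^ j * ε)) * (b * ENNReal.ofReal (2 ^ j * ε)) := by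
            gcongr; exact h _ (by positivity)
        _ = ENNReal.ofReal (4 / (4 ^ j * ε)) * ENNReal.ofReal (2 ^ j * ε) * b := by ring
        _ = _ := by
          rw [← ENNReal.ofReal_mul (by positivity)]
          congr 2
          have : (4:ℝ) ^ j = 2 ^ j * 2 ^ j := by rw [← mul_pow]; norm_num
          rw [this, one_div, inv_pow]
          field_simp
    _ = _ := by rw [ENNReal.tsum_mul_right, hsum]

/-- Near k the ball masses are at most (η/16) r, which the domination by a maximal function turns
into η/2. On the remaining annulus the kernel is O(ε). -/
lemma tendsto_lintegral_halfPlanePoisson_zero {σ : Measure ℝ} {k : ℝ}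
    (hfin : σ (Metric.closedBall k 1) ≠ ∞)
    (h : Tendsto (fun r : ℝ => σ (Metric.closedBall k r) / ENNReal.ofReal r) (𝓝[>] 0) (𝓝 0)) :
    Tendsto (fun ε : ℝ => ∫⁻ y in Metric.closedBall k 1,
      ENNReal.ofReal (halfPlanePoisson ε (k - y)) ∂σ) (𝓝[>] 0) (𝓝 0) := by
  rw [ENNReal.tendsto_nhds_zero]
  intro η hη
  by_cases hηtop : η = ∞
  · simp [hηtop]
  have hη16 : 0 < η / 16 := ENNReal.div_pos hη.ne' (by norm_num)
  have h1 := (ENNReal.tendsto_nhds_zero.1 h) (η / 16) hη16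
  rw [eventually_nhdsWithin_iff, Metric.eventually_nhds_iff] at h1
  obtain ⟨d, hd, hdr⟩ := h1
  set r0 := min (d / 2) 1
  have hr0 : 0 < r0 := by positivity
  have hsmall : ∀ r, 0 < r → r ≤ r0 →
      σ (Metric.closedBall k r) ≤ η / 16 * ENNReal.ofReal r := fun r hr hrr => by
    have : r ≤ d / 2 := hrr.trans (min_le_left _ _)
    have := hdr (y := r) (by simp [abs_of_pos hr]; linarith) hr
    rwa [ENNReal.div_le_iff (by simpa using hr) ENNReal.ofReal_ne_top] at this
  have hA : ∀ ε : ℝ, 0 < ε → ∫⁻ y in Metric.closedBall k r0,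
      ENNReal.ofReal (halfPlanePoisson ε (k - y)) ∂σ ≤ 8 * (η / 16) := fun ε hε => by
    refine lintegral_halfPlanePoisson_le hε fun r hr => ?_
    rw [Measure.restrict_apply Metric.isClosed_closedBall.measurableSet]
    rcases le_total r r0 with hrr | hrr
    · exact (measure_mono inter_subset_left).trans (hsmall r hr hrr)
    -- The restricted measure has no mass beyond radius r0, so the bound at r0 serves all larger
    -- radii.
    · refine (measure_mono inter_subset_right).trans ((hsmall r0 hr0 le_rfl).trans ?_)
      gcongr
  have hB : ∀ ε : ℝ, 0 < ε → ∫⁻ y in Metric.closedBall k 1 \ Metric.closedBall k r0,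
      ENNReal.ofReal (halfPlanePoisson ε (k - y)) ∂σ ≤
        ENNReal.ofReal (ε / r0 ^ 2) * σ (Metric.closedBall k 1) := fun ε hε => by
    calc _ ≤ ∫⁻ y in Metric.closedBall k 1 \ Metric.closedBall k r0,
          ENNReal.ofReal (ε / r0 ^ 2) ∂σ := by
          refine setLIntegral_mono' (Metric.isClosed_closedBall.measurableSet.diff
            Metric.isClosed_closedBall.measurableSet) fun y hy => ?_
          apply ENNReal.ofReal_le_ofReal
          refine halfPlanePoisson_le_div_sq hε hr0 ?_
          have := hy.2
          rw [Metric.mem_closedBall, Real.dist_eq, abs_sub_comm] at this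
          linarith
      _ ≤ _ := by
        rw [setLIntegral_const]
        gcongr
        exact sdiff_subset
  have hlim : Tendsto (fun ε : ℝ => ENNReal.ofReal (ε / r0 ^ 2) * σ (Metric.closedBall k 1))
      (𝓝[>] 0) (𝓝 0) := by
    have : Tendsto (fun ε : ℝ => ENNReal.ofReal (ε / r0 ^ 2)) (𝓝[>] 0) (𝓝 0) := by
      have h2 : Continuous fun ε : ℝ => ENNReal.ofReal (ε / r0 ^ 2) :=
        ENNReal.continuous_ofReal.comp (by fun_prop)
      have := h2.tendsto 0
      simp only [zero_div, ENNReal.ofReal_zero] at this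
      exact this.mono_left nhdsWithin_le_nhds
    simpa using ENNReal.Tendsto.mul_const this (Or.inr hfin)
  have hη2 : 0 < η / 2 := ENNReal.div_pos hη.ne' (by norm_num)
  filter_upwards [self_mem_nhdsWithin, (ENNReal.tendsto_nhds_zero.1 hlim) (η / 2) hη2]
    with ε hε hε2
  have hunion : Metric.closedBall k 1 = Metric.closedBall k r0 ∪
      (Metric.closedBall k 1 \ Metric.closedBall k r0) :=
    (union_sdiff_cancel (Metric.closedBall_subset_closedBall (min_le_right _ _))).symm
  rw [hunion]
  refine (lintegral_union_le _ _ _).trans ?_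
  calc _ ≤ 8 * (η / 16) + η / 2 := add_le_add (hA ε hε) ((hB ε hε).trans hε2)
    _ = η / 2 + η / 2 := by
      congr 1
      rw [← mul_div_assoc, show (16 : ℝ≥0∞) = 8 * 2 by norm_num]
      exact ENNReal.mul_div_mul_left _ _ (by norm_num) (by norm_num)
    _ = η := ENNReal.add_halves η

lemma ae_tendsto_lintegral_enorm_sub_div {E : Type*} [NormedAddCommGroup E] {φ : ℝ → E}
    (hφ : LocallyIntegrable φ) :
    ∀ᵐ x, Tendsto (fun r : ℝ =>
      (∫⁻ y in Metric.closedBall x r, ‖φ y - φ x‖ₑ) / ENNReal.ofReal r) (𝓝[>] 0) (𝓝 0) := by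
  filter_upwards [(Besicovitch.vitaliFamily (volume : Measure ℝ)).ae_tendsto_lintegral_enorm_sub_div
    hφ] with x hx
  have h1 := hx.comp (Besicovitch.tendsto_filterAt volume x)
  have h2 := ENNReal.Tendsto.const_mul (a := 2) h1 (Or.inr (by norm_num))
  rw [mul_zero] at h2
  refine h2.congr' ?_
  filter_upwards [self_mem_nhdsWithin] with r hr
  simp only [Function.comp, Real.volume_closedBall]
  rw [ENNReal.ofReal_mul (by norm_num), ENNReal.ofReal_ofNat, ← mul_div_assoc]
  exact ENNReal.mul_div_mul_left _ _ (by norm_num) (by norm_num)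

lemma integrable_norm_div_of_memLp_two {φ : ℝ → ℂ} (hφ : MemLp φ 2) (x : ℝ) :
    Integrable fun t => ‖φ t‖ * (1 + (x - t) ^ 2)⁻¹ := by
  have h1 : Integrable fun t => ‖φ t‖ ^ 2 := (memLp_two_iff_integrable_sq_norm hφ.1).1 hφ
  have h2 : Integrable fun t : ℝ => (1 + (x - t) ^ 2)⁻¹ :=
    integrable_inv_one_add_sq.comp_sub_left x
  refine (h1.add h2).mono' (hφ.1.norm.mul h2.1) (Eventually.of_forall fun t => ?_)
  have h3 : (1 + (x - t) ^ 2)⁻¹ ≤ 1 := inv_le_one_of_one_le₀ (by nlinarith [sq_nonneg (x - t)])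
  have h4 : 0 ≤ (1 + (x - t) ^ 2)⁻¹ := by positivity
  rw [Real.norm_of_nonneg (by positivity)]
  simp only [Pi.add_apply]
  nlinarith [sq_nonneg (‖φ t‖ - (1 + (x - t) ^ 2)⁻¹), norm_nonneg (φ t), mul_nonneg (norm_nonneg (φ t)) h4]

lemma halfPlanePoisson_le_one_add {δ t : ℝ} (hδ : 0 < δ) (ht : 1 ≤ |t|) :
    halfPlanePoisson δ t ≤ 2 * δ * (1 + t ^ 2)⁻¹ := by
  refine (halfPlanePoisson_le_div_sq hδ (by linarith) le_rfl).trans ?_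
  rw [sq_abs, ← div_eq_mul_inv]
  have : 1 ≤ t ^ 2 := by rw [← sq_abs]; exact one_le_pow₀ ht
  rw [div_le_div_iff₀ (by positivity) (by positivity)]
  nlinarith

/-- The Poisson integrals of a square integrable function converge to it almost everywhere. -/
lemma ae_tendsto_poisson_integral {φ : ℝ → ℂ} (hφ : MemLp φ 2) :
    ∀ᵐ x, Tendsto (fun δ : ℝ => ∫ t, (halfPlanePoisson δ (x - t) : ℂ) * φ t) (𝓝[>] 0)
      (𝓝 (φ x)) := by
  have hloc : LocallyIntegrable φ := hφ.locallyIntegrable (by norm_num)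
  filter_upwards [ae_tendsto_lintegral_enorm_sub_div hloc] with x hx
  set B := Metric.closedBall x 1
  have hBm : MeasurableSet B := Metric.isClosed_closedBall.measurableSet
  set ψ : ℝ → ℂ := fun t => φ t - φ x
  have hψm : AEStronglyMeasurable ψ := hφ.1.sub aestronglyMeasurable_const
  -- The zero density lemma is applied to the measure with density |φ - φ(x)|, whose density at x
  -- vanishes because x is a Lebesgue point.
  have hnear : Tendsto (fun δ : ℝ => ∫⁻ t in B,
      ENNReal.ofReal (halfPlanePoisson δ (x - t)) * ‖ψ t‖ₑ) (𝓝[>] 0) (𝓝 0) := by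
    have hσ : ∀ r, (volume.withDensity fun t => ‖ψ t‖ₑ) (Metric.closedBall x r) =
        ∫⁻ t in Metric.closedBall x r, ‖ψ t‖ₑ := fun r =>
      withDensity_apply _ Metric.isClosed_closedBall.measurableSet
    have := tendsto_lintegral_halfPlanePoisson_zero (k := x)
      (σ := volume.withDensity fun t => ‖ψ t‖ₑ) (by
        rw [hσ]
        have : IntegrableOn ψ (Metric.closedBall x 1) :=
          (hloc.integrableOn_isCompact (isCompact_closedBall _ _)).sub
            (integrableOn_const (by simp))
        exact this.2.ne) (by simpa only [hσ] using hx)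
    refine this.congr' ?_
    filter_upwards [self_mem_nhdsWithin] with δ hδ
    rw [restrict_withDensity hBm, lintegral_withDensity_eq_lintegral_mul₀ hψm.enorm.restrict]
    · simp [mul_comm, B]
    · exact ((continuous_halfPlanePoisson hδ).measurable.comp
        (measurable_const.sub measurable_id)).ennreal_ofReal.aemeasurable
  have hfarint : Integrable fun t => ‖ψ t‖ * (1 + (x - t) ^ 2)⁻¹ := by
    have h2 : Integrable fun t : ℝ => (1 + (x - t) ^ 2)⁻¹ :=
      integrable_inv_one_add_sq.comp_sub_left x
    refine ((integrable_norm_div_of_memLp_two hφ x).add (h2.const_mul ‖φ x‖)).mono'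
      (hψm.norm.mul h2.1) (Eventually.of_forall fun t => ?_)
    rw [Real.norm_of_nonneg (by positivity)]
    simp only [Pi.add_apply]
    rw [← add_mul]
    gcongr
    exact norm_sub_le _ _
  set K := ∫⁻ t, ENNReal.ofReal (‖ψ t‖ * (1 + (x - t) ^ 2)⁻¹)
  have hK : K ≠ ∞ := hfarint.lintegral_lt_top.ne
  have hfar : ∀ δ : ℝ, 0 < δ → ∫⁻ t in Bᶜ, ENNReal.ofReal (halfPlanePoisson δ (x - t)) * ‖ψ t‖ₑ ≤
      ENNReal.ofReal (2 * δ) * K := fun δ hδ => by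
    rw [← lintegral_const_mul' _ _ ENNReal.ofReal_ne_top]
    refine (setLIntegral_mono' hBm.compl fun t ht => ?_).trans (setLIntegral_le_lintegral _ _)
    have ht1 : 1 ≤ |x - t| := by
      simp only [B, mem_compl_iff, Metric.mem_closedBall, Real.dist_eq, not_le] at ht
      rw [abs_sub_comm]; exact ht.le
    rw [← ofReal_norm, ← ENNReal.ofReal_mul (halfPlanePoisson_nonneg hδ.le _),
      ← ENNReal.ofReal_mul (by positivity)]
    apply ENNReal.ofReal_le_ofReal
    have := halfPlanePoisson_le_one_add hδ ht1
    nlinarith [norm_nonneg (ψ t), mul_le_mul_of_nonneg_right this (norm_nonneg (ψ t))]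
  have hlim : Tendsto (fun δ : ℝ => (∫⁻ t in B,
      ENNReal.ofReal (halfPlanePoisson δ (x - t)) * ‖ψ t‖ₑ) + ENNReal.ofReal (2 * δ) * K)
      (𝓝[>] 0) (𝓝 0) := by
    have h2 : Tendsto (fun δ : ℝ => ENNReal.ofReal (2 * δ) * K) (𝓝[>] 0) (𝓝 0) := by
      have h3 : Continuous fun ε : ℝ => ENNReal.ofReal (2 * ε) :=
        ENNReal.continuous_ofReal.comp (by fun_prop)
      have := (h3.tendsto 0).mono_left (nhdsWithin_le_nhds (s := Ioi 0))
      simp only [mul_zero, ENNReal.ofReal_zero] at this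
      simpa using ENNReal.Tendsto.mul_const this (Or.inr hK)
    simpa using hnear.add h2
  rw [tendsto_iff_edist_tendsto_0]
  refine tendsto_of_tendsto_of_tendsto_of_le_of_le' tendsto_const_nhds hlim
    (Eventually.of_forall fun _ => zero_le) ?_
  filter_upwards [self_mem_nhdsWithin] with δ hδ
  simp only [mem_Ioi] at hδ
  have hPi : Integrable fun t => (halfPlanePoisson δ (x - t) : ℂ) :=
    ((integrable_halfPlanePoisson hδ).comp_sub_left x).ofReal
  have hPm := hPi.1
  have hint : Integrable fun t => (halfPlanePoisson δ (x - t) : ℂ) * φ t := by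
    refine ((integrable_norm_div_of_memLp_two hφ x).const_mul (2 * δ + 2 / δ)).mono'
      (hPm.mul hφ.1) (Eventually.of_forall fun t => ?_)
    rw [norm_mul, Complex.norm_real, Real.norm_of_nonneg (halfPlanePoisson_nonneg hδ.le _)]
    have h0 : 0 ≤ (1 + (x - t) ^ 2)⁻¹ := by positivity
    have : halfPlanePoisson δ (x - t) ≤ (2 * δ + 2 / δ) * (1 + (x - t) ^ 2)⁻¹ := by
      rcases le_total 1 |x - t| with h | h
      · refine (halfPlanePoisson_le_one_add hδ h).trans ?_
        gcongr
        linarith [show 0 ≤ 2 / δ by positivity]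
      · refine (halfPlanePoisson_le_inv hδ _).trans ?_
        have : (x - t) ^ 2 ≤ 1 := by rw [← sq_abs]; exact pow_le_one₀ (abs_nonneg _) h
        have h5 : 1 / 2 ≤ (1 + (x - t) ^ 2)⁻¹ := by
          rw [one_div]
          exact inv_anti₀ (by positivity) (by linarith)
        calc 1 / δ = (2 / δ) * (1 / 2) := by ring
          _ ≤ (2 * δ + 2 / δ) * (1 + (x - t) ^ 2)⁻¹ := by
            gcongr
            linarith
    calc _ ≤ (2 * δ + 2 / δ) * (1 + (x - t) ^ 2)⁻¹ * ‖φ t‖ := by gcongr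
      _ = _ := by ring
  have hP1 : ∫ t, (halfPlanePoisson δ (x - t) : ℂ) = 1 := by
    rw [integral_complex_ofReal, integral_sub_left_eq_self, integral_halfPlanePoisson hδ]
    simp
  have hsub : (∫ t, (halfPlanePoisson δ (x - t) : ℂ) * φ t) - φ x =
      ∫ t, (halfPlanePoisson δ (x - t) : ℂ) * ψ t := by
    simp only [ψ, mul_sub]
    rw [integral_sub hint (hPi.mul_const _), integral_mul_const, hP1, one_mul]
  rw [edist_eq_enorm_sub, hsub]
  refine (enorm_integral_le_lintegral_enorm _).trans ?_
  have hen : ∀ t, ‖(halfPlanePoisson δ (x - t) : ℂ) * ψ t‖ₑ =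
      ENNReal.ofReal (halfPlanePoisson δ (x - t)) * ‖ψ t‖ₑ := fun t => by
    rw [enorm_mul, ← ofReal_norm, Complex.norm_real,
      Real.norm_of_nonneg (halfPlanePoisson_nonneg hδ.le _)]
  simp only [hen]
  rw [← lintegral_add_compl _ hBm]
  gcongr
  exact hfar δ hδ

/-! ### Fatou's theorem through weak compactness in L² -/

lemma memLp_two_halfPlanePoisson {δ : ℝ} (hδ : 0 < δ) (x : ℝ) :
    MemLp (fun t => (halfPlanePoisson δ (x - t) : ℂ)) 2 := by
  have hPi : Integrable fun t => halfPlanePoisson δ (x - t) :=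
    (integrable_halfPlanePoisson hδ).comp_sub_left x
  have hm : AEStronglyMeasurable (fun t => (halfPlanePoisson δ (x - t) : ℂ)) volume :=
    hPi.ofReal.1
  rw [memLp_two_iff_integrable_sq_norm hm]
  refine (hPi.const_mul (1 / δ)).mono' (hm.norm.pow 2) (Eventually.of_forall fun t => ?_)
  have h0 := halfPlanePoisson_nonneg hδ.le (x - t)
  rw [Complex.norm_real, Real.norm_of_nonneg h0, Real.norm_of_nonneg (by positivity), sq]
  exact mul_le_mul_of_nonneg_right (halfPlanePoisson_le_inv hδ _) h0

/-- A bounded sequence in a Hilbert space has a weak limit along some ultrafilter. -/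
lemma exists_weak_limit {E : Type*} [NormedAddCommGroup E] [InnerProductSpace ℂ E]
    [CompleteSpace E] (G : ℕ → E) {D : ℝ} (hD : ∀ n, ‖G n‖ ≤ D) :
    ∃ (U : Ultrafilter ℕ) (φ : E), (U : Filter ℕ) ≤ atTop ∧
      ∀ f : E, Tendsto (fun n => inner ℂ (G n) f) U (𝓝 (inner ℂ φ f)) := by
  set ψ : ℕ → WeakDual ℂ E := fun n =>
    StrongDual.toWeakDual (InnerProductSpace.toDual ℂ E (G n))
  have hK := WeakDual.isCompact_closedBall (𝕜 := ℂ) (E := E) 0 D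
  -- Banach–Alaoglu gives a limit along an ultrafilter; extracting a subsequence would require
  -- separability.
  set U := Ultrafilter.of (atTop : Filter ℕ)
  obtain ⟨Λ, -, hΛ⟩ := hK.ultrafilter_le_nhds (U.map ψ) (by
    rw [le_principal_iff]
    refine mem_map.2 (univ_mem' fun n => ?_)
    have : ‖InnerProductSpace.toDual ℂ E (G n)‖ ≤ D := by
      rw [LinearIsometryEquiv.norm_map]; exact hD n
    simpa [ψ] using this)
  refine ⟨U, (InnerProductSpace.toDual ℂ E).symm (WeakDual.toStrongDual Λ),
    Ultrafilter.of_le _, fun f => ?_⟩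
  have h1 : Tendsto ψ U (𝓝 Λ) := hΛ
  have h2 := ((WeakDual.eval_continuous f).tendsto Λ).comp h1
  have h3 : inner ℂ ((InnerProductSpace.toDual ℂ E).symm (WeakDual.toStrongDual Λ)) f = Λ f := by
    rw [InnerProductSpace.toDual_symm_apply]; rfl
  rw [h3]
  exact h2

/-- **Fatou's theorem**: a holomorphic function on the upper half-plane which is
`O(1 / |z + i|)` has vertical limits at almost every boundary point. -/
lemma ae_exists_boundary_limit {g : ℂ → ℂ} {C : ℝ}
    (hg : ∀ z : ℂ, 0 < z.im → DifferentiableAt ℂ g z)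
    (hb : ∀ z : ℂ, 0 < z.im → ‖g z‖ ≤ C / ‖z + Complex.I‖) :
    ∀ᵐ x : ℝ, ∃ l : ℂ, Tendsto (fun ε : ℝ => g (x + ε * Complex.I)) (𝓝[>] 0) (𝓝 l) := by
  have hC : 0 ≤ C := by
    have := (norm_nonneg _).trans (hb Complex.I (by simp))
    by_contra! h
    have h2 : C / ‖Complex.I + Complex.I‖ < 0 := by
      apply div_neg_of_neg_of_pos h
      rw [norm_pos_iff]; simp [← two_mul]
    linarith
  -- The decay of g bounds its restrictions to all horizontal lines in L² uniformly, by C²π for the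
  -- squared norm.
  have hbsq : ∀ ε : ℝ, 0 < ε → ∀ t : ℝ, ‖g (t + ε * Complex.I)‖ ^ 2 ≤ C ^ 2 * (1 + t ^ 2)⁻¹ :=
    fun ε hε t => by
      have h1 := hb (t + ε * Complex.I) (by simpa using hε)
      have h2 : 1 + t ^ 2 ≤ ‖(t + ε * Complex.I : ℂ) + Complex.I‖ ^ 2 := by
        rw [← Complex.normSq_eq_norm_sq, Complex.normSq_apply]
        simp
        nlinarith
      calc _ ≤ (C / ‖(t + ε * Complex.I : ℂ) + Complex.I‖) ^ 2 := by gcongr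
        _ = C ^ 2 / ‖(t + ε * Complex.I : ℂ) + Complex.I‖ ^ 2 := by rw [div_pow]
        _ ≤ C ^ 2 / (1 + t ^ 2) := by gcongr
        _ = _ := div_eq_mul_inv _ _
  have hbdd : ∀ z : ℂ, 0 < z.im → ‖g z‖ ≤ C := fun z hz => by
    refine (hb z hz).trans (div_le_self hC ?_)
    have := Complex.abs_im_le_norm (z + Complex.I)
    simp only [Complex.add_im, Complex.I_im] at this
    linarith [le_abs_self (z.im + 1)]
  set e : ℕ → ℝ := fun n => 1 / ((n : ℝ) + 1)
  have he : ∀ n, 0 < e n := fun n => by positivity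
  have helim : Tendsto e atTop (𝓝 0) := tendsto_one_div_add_atTop_nhds_zero_nat
  have hcont : ∀ n, Continuous fun t : ℝ => g (t + e n * Complex.I) := fun n =>
    continuous_comp_horizontal fun z hz => hg z ((he n).trans_le hz)
  have hmem : ∀ n, MemLp (fun t : ℝ => g (t + e n * Complex.I)) 2 := fun n => by
    rw [memLp_two_iff_integrable_sq_norm (hcont n).aestronglyMeasurable]
    refine (integrable_inv_one_add_sq.const_mul (C ^ 2)).mono'
      ((hcont n).norm.pow 2).aestronglyMeasurable (Eventually.of_forall fun t => ?_)
    rw [Real.norm_of_nonneg (by positivity)]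
    exact hbsq _ (he n) t
  set G : ℕ → Lp ℂ 2 (volume : Measure ℝ) := fun n => (hmem n).toLp
  have hGn : ∀ n, ‖G n‖ ≤ √(C ^ 2 * Real.pi) := fun n => by
    apply Real.le_sqrt_of_sq_le
    have h1 : ‖G n‖ ^ 2 = ∫ t : ℝ, ‖g (t + e n * Complex.I)‖ ^ 2 := by
      have h2 : ((‖G n‖ ^ 2 : ℝ) : ℂ) = ((∫ t : ℝ, ‖g (t + e n * Complex.I)‖ ^ 2 : ℝ) : ℂ) := by
        have := inner_self_eq_norm_sq_to_K (𝕜 := ℂ) (G n)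
        rw [L2.inner_def] at this
        push_cast
        rw [← integral_complex_ofReal]
        refine Eq.trans this.symm (integral_congr_ae ?_)
        filter_upwards [(hmem n).coeFn_toLp] with t ht
        simp only [G]
        rw [ht, inner_self_eq_norm_sq_to_K]
        simp
      exact_mod_cast h2
    rw [h1, ← integral_univ_inv_one_add_sq, ← integral_const_mul]
    refine integral_mono_of_nonneg (Eventually.of_forall fun t => by positivity)
      (integrable_inv_one_add_sq.const_mul _) (Eventually.of_forall fun t => hbsq _ (he n) t)
  obtain ⟨U, φ, hU, hφ⟩ := exists_weak_limit G hGn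
  filter_upwards [ae_tendsto_poisson_integral (Lp.memLp φ)] with x hx
  refine ⟨φ x, hx.congr' ?_⟩
  filter_upwards [self_mem_nhdsWithin] with δ hδ
  simp only [mem_Ioi] at hδ
  set f : Lp ℂ 2 (volume : Measure ℝ) := (memLp_two_halfPlanePoisson hδ x).toLp
  have hinner : ∀ ψ : Lp ℂ 2 (volume : Measure ℝ),
      inner ℂ ψ f = starRingEnd ℂ (∫ t, (halfPlanePoisson δ (x - t) : ℂ) * ψ t) := fun ψ => by
    rw [L2.inner_def, ← integral_conj]
    refine integral_congr_ae ?_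
    filter_upwards [(memLp_two_halfPlanePoisson hδ x).coeFn_toLp] with t ht
    simp only [f]
    rw [ht]
    simp
  -- Testing against the Poisson kernel evaluates g at height e n + δ. In the weak limit g(x + iδ)
  -- is exactly the Poisson integral of φ, and its convergence at Lebesgue points of φ finishes the
  -- proof.
  have hGP : ∀ n, inner ℂ (G n) f = starRingEnd ℂ (g (x + (e n + δ : ℝ) * Complex.I)) := fun n => by
    rw [hinner, poisson_formula (he n).le hδ (fun z hz => hg z ((he n).trans_le hz))
      (fun z hz => hbdd z ((he n).trans_le hz)) x]
    congr 1
    refine integral_congr_ae ?_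
    filter_upwards [(hmem n).coeFn_toLp] with t ht
    simp only [G]
    rw [ht]
  have hlim1 := hφ f
  simp only [hGP, hinner φ] at hlim1
  have hlim2 : Tendsto (fun n => starRingEnd ℂ (g (x + (e n + δ : ℝ) * Complex.I))) U
      (𝓝 (starRingEnd ℂ (g (x + δ * Complex.I)))) := by
    have hc : ContinuousAt g (x + δ * Complex.I) := (hg _ (by simpa using hδ)).continuousAt
    have h1 : Tendsto (fun n => (x : ℂ) + (e n + δ : ℝ) * Complex.I) U
        (𝓝 (x + δ * Complex.I)) := by
      have h2 : Continuous fun s : ℝ => (x : ℂ) + (s + δ : ℝ) * Complex.I := by fun_prop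
      have := (h2.tendsto 0).comp (helim.mono_left hU)
      simpa [Function.comp_def] using this
    exact (Complex.continuous_conj.tendsto _).comp (hc.tendsto.comp h1)
  exact (starRingEnd ℂ).injective (tendsto_nhds_unique hlim1 hlim2)

/-! ### The logarithm on the right half-plane and the Cauchy transform -/

lemma norm_log_one_add_le {w : ℂ} (hw : 0 ≤ w.re) : ‖Complex.log (1 + w)‖ ≤ ‖w‖ := by
  have hs : Convex ℝ {z : ℂ | 0 ≤ z.re} := convex_halfSpace_re_ge 0
  have := hs.norm_image_sub_le_of_norm_hasDerivWithin_le (f := fun z => Complex.log (1 + z))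
    (f' := fun z => 1 / (1 + z)) (C := 1) (x := 0) (y := w) (fun z hz => by
      have hz' : (1 + z) ∈ Complex.slitPlane := Or.inl (by simp at hz ⊢; linarith)
      exact (((hasDerivAt_id z).const_add 1).clog hz').hasDerivWithinAt) (fun z hz => by
      rw [norm_div, norm_one]
      apply div_le_one_of_le₀ _ (norm_nonneg _)
      have := Complex.abs_re_le_norm (1 + z)
      simp at this hz
      linarith [le_abs_self (1 + z.re)]) (by simp) hw
  simpa using this

/-- Mean value inequality on the convex half-disc of radius |w|, where the derivative -z/(1 + z) is
at most |w| since |1 + z| ≥ 1. -/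
lemma norm_log_one_add_sub_le {w : ℂ} (hw : 0 ≤ w.re) : ‖Complex.log (1 + w) - w‖ ≤ ‖w‖ ^ 2 := by
  have hs : Convex ℝ ({z : ℂ | 0 ≤ z.re} ∩ Metric.closedBall 0 ‖w‖) :=
    (convex_halfSpace_re_ge 0).inter (convex_closedBall 0 _)
  have := hs.norm_image_sub_le_of_norm_hasDerivWithin_le (f := fun z => Complex.log (1 + z) - z)
    (f' := fun z => 1 / (1 + z) - 1) (C := ‖w‖) (x := 0) (y := w) (fun z hz => by
      have hz' : (1 + z) ∈ Complex.slitPlane := Or.inl (by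
        have := hz.1
        simp at this ⊢; linarith)
      exact ((((hasDerivAt_id z).const_add 1).clog hz').sub (hasDerivAt_id z)).hasDerivWithinAt)
      (fun z hz => by
      have h1 : 0 ≤ z.re := hz.1
      have h2 := Complex.abs_re_le_norm (1 + z)
      simp only [Complex.add_re, Complex.one_re] at h2
      have h3 : 1 ≤ ‖1 + z‖ := by linarith [le_abs_self (1 + z.re)]
      have h4 : 1 + z ≠ 0 := by
        intro h; rw [h, norm_zero] at h3; linarith
      have h5 : 1 / (1 + z) - 1 = -z / (1 + z) := by field_simp; ring
      rw [h5, norm_div, norm_neg]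
      have h6 : ‖z‖ ≤ ‖w‖ := by simpa using hz.2
      exact (div_le_self (norm_nonneg _) h3).trans h6) (by simp) ⟨hw, by simp⟩
  simpa [sq] using this

/-- The Poisson integral of a measure on `ℝ`. -/
noncomputable def poissonInt (ν : Measure ℝ) (ε k : ℝ) : ℝ := ∫ y, halfPlanePoisson ε (k - y) ∂ν

/-- The conjugate Poisson integral of a measure on `ℝ`. -/
noncomputable def conjPoissonInt (ν : Measure ℝ) (ε k : ℝ) : ℝ :=
  Real.pi⁻¹ * ∫ y, (k - y) / ((k - y) ^ 2 + ε ^ 2) ∂ν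

/-- The holomorphic function on the upper half-plane whose real and imaginary parts are the Poisson
and the conjugate Poisson integrals of `ν`. -/
noncomputable def cauchyTransform (ν : Measure ℝ) (z : ℂ) : ℂ :=
  Complex.I / Real.pi * ∫ y, (z - y)⁻¹ ∂ν

lemma poissonInt_nonneg {ν : Measure ℝ} {ε : ℝ} (hε : 0 ≤ ε) (k : ℝ) : 0 ≤ poissonInt ν ε k :=
  integral_nonneg fun _ => halfPlanePoisson_nonneg hε _

lemma sub_ofReal_ne_zero {z : ℂ} (hz : 0 < z.im) (y : ℝ) : z - y ≠ 0 := fun h => by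
  have := congrArg Complex.im h
  simp at this; linarith

lemma im_le_norm_sub_ofReal {z : ℂ} (y : ℝ) : z.im ≤ ‖z - y‖ := by
  have := Complex.abs_im_le_norm (z - y)
  simp at this
  exact (le_abs_self _).trans this

lemma measurable_inv_sub_ofReal (z : ℂ) : Measurable fun y : ℝ => (z - y)⁻¹ :=
  (measurable_const.sub Complex.measurable_ofReal).inv

lemma integrable_inv_sub_ofReal {ν : Measure ℝ} [IsFiniteMeasure ν] {z : ℂ} (hz : 0 < z.im) :
    Integrable (fun y : ℝ => (z - y)⁻¹) ν := by
  refine Integrable.of_bound (measurable_inv_sub_ofReal z).aestronglyMeasurable (z.im)⁻¹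
    (Eventually.of_forall fun y => ?_)
  rw [norm_inv]
  exact inv_anti₀ hz (im_le_norm_sub_ofReal y)

lemma cauchyTransform_eq {ν : Measure ℝ} [IsFiniteMeasure ν] {ε : ℝ} (hε : 0 < ε) (k : ℝ) :
    cauchyTransform ν (k + ε * Complex.I) =
      (poissonInt ν ε k : ℂ) + conjPoissonInt ν ε k * Complex.I := by
  have hz : 0 < (k + ε * Complex.I : ℂ).im := by simpa using hε
  have hpt : ∀ y : ℝ, Complex.I / Real.pi * ((k + ε * Complex.I : ℂ) - y)⁻¹ =
      (halfPlanePoisson ε (k - y) : ℂ) +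
        (Real.pi⁻¹ * ((k - y) / ((k - y) ^ 2 + ε ^ 2)) : ℝ) * Complex.I := fun y => by
    have h0 := sub_ofReal_ne_zero hz y
    have h1 : ((k - y) ^ 2 + ε ^ 2 : ℝ) ≠ 0 := by positivity
    have h1' : (((k - y) ^ 2 + ε ^ 2 : ℝ) : ℂ) ≠ 0 := by exact_mod_cast h1
    have h2 : ((k + ε * Complex.I : ℂ) - y) * ((k - y : ℝ) - ε * Complex.I) =
        (((k - y) ^ 2 + ε ^ 2 : ℝ) : ℂ) := by
      push_cast; linear_combination (-(ε : ℂ) ^ 2) * Complex.I_sq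
    have h3 : ((k + ε * Complex.I : ℂ) - y)⁻¹ =
        ((k - y : ℝ) - ε * Complex.I) / (((k - y) ^ 2 + ε ^ 2 : ℝ) : ℂ) := by
      rw [eq_div_iff h1', ← h2, ← mul_assoc, inv_mul_cancel₀ h0, one_mul]
    rw [h3]
    unfold halfPlanePoisson
    have hπ : (Real.pi : ℂ) ≠ 0 := by exact_mod_cast Real.pi_ne_zero
    push_cast at h1' ⊢
    field_simp
    linear_combination (-(ε : ℂ)) * Complex.I_sq
  have hint := (integrable_inv_sub_ofReal (ν := ν) hz).const_mul (Complex.I / Real.pi)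
  simp only [hpt] at hint
  have hre : Integrable (fun y => halfPlanePoisson ε (k - y)) ν := by
    simpa only [RCLike.re_eq_complex_re, Complex.add_re, Complex.ofReal_re, Complex.re_ofReal_mul,
      Complex.I_re, mul_zero, add_zero] using hint.re
  have him : Integrable (fun y => Real.pi⁻¹ * ((k - y) / ((k - y) ^ 2 + ε ^ 2))) ν := by
    simpa only [RCLike.im_eq_complex_im, Complex.add_im, Complex.ofReal_im, Complex.im_ofReal_mul,
      Complex.I_im, mul_one, zero_add] using hint.im
  unfold cauchyTransform
  rw [← integral_const_mul]
  simp only [hpt]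
  have hre' : Integrable (fun y => (halfPlanePoisson ε (k - y) : ℂ)) ν := hre.ofReal
  have him' : Integrable (fun y => ((Real.pi⁻¹ * ((k - y) / ((k - y) ^ 2 + ε ^ 2)) : ℝ) : ℂ)) ν :=
    him.ofReal
  rw [integral_add hre' (him'.mul_const _), integral_mul_const,
    integral_complex_ofReal, integral_complex_ofReal]
  rw [integral_const_mul]
  rfl

lemma re_cauchyTransform_nonneg {ν : Measure ℝ} [IsFiniteMeasure ν] {z : ℂ} (hz : 0 < z.im) : 0 ≤ (cauchyTransform ν z).re := by
  have h : z = (z.re : ℂ) + z.im * Complex.I := (Complex.re_add_im z).symm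
  rw [h, cauchyTransform_eq hz]
  simpa using poissonInt_nonneg hz.le _

lemma differentiableAt_cauchyTransform {ν : Measure ℝ} [IsFiniteMeasure ν] {z : ℂ} (hz : 0 < z.im) :
    DifferentiableAt ℂ (cauchyTransform ν) z := by
  have hs : {w : ℂ | z.im / 2 < w.im} ∈ 𝓝 z :=
    (isOpen_lt continuous_const Complex.continuous_im).mem_nhds (by simp; linarith)
  have h2 : 0 < z.im / 2 := by linarith
  have := (hasDerivAt_integral_of_dominated_loc_of_deriv_le (μ := ν)
    (F := fun (w : ℂ) (y : ℝ) => (w - y)⁻¹) (F' := fun (w : ℂ) (y : ℝ) => -1 / (w - y) ^ 2)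
    (x₀ := z) (bound := fun _ => ((z.im / 2) ^ 2)⁻¹) hs
    (Eventually.of_forall fun w => (measurable_inv_sub_ofReal w).aestronglyMeasurable)
    (integrable_inv_sub_ofReal hz)
    (((measurable_const.sub Complex.measurable_ofReal).pow_const 2).const_div
      (-1)).aestronglyMeasurable
    (Eventually.of_forall fun y w hw => by
      simp only [mem_ofPred_eq] at hw
      rw [norm_div, norm_neg, norm_one, norm_pow, one_div]
      have := im_le_norm_sub_ofReal (z := w) y
      gcongr
      linarith)
    (integrable_const _)
    (Eventually.of_forall fun y w hw => by
      simp only [mem_ofPred_eq] at hw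
      exact ((hasDerivAt_id w).sub_const (y : ℂ)).inv (sub_ofReal_ne_zero (z := w) (by linarith) y))).2
  exact this.differentiableAt.const_mul _

lemma norm_cauchyTransform_le {ν : Measure ℝ} [IsFiniteMeasure ν] {R : ℝ} (hR : ∀ᵐ y ∂ν, |y| ≤ R) {z : ℂ} (hz : 2 * R + 1 ≤ ‖z‖) :
    ‖cauchyTransform ν z‖ ≤ 2 * ν.real univ / ‖z‖ := by
  rcases eq_or_ne ν 0 with h0 | h0
  · simp [cauchyTransform, h0]
  have hR0 : 0 ≤ R := by
    have : (ae ν).NeBot := ae_neBot.2 h0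
    obtain ⟨y, hy⟩ := hR.exists
    exact (abs_nonneg y).trans hy
  have hz0 : 0 < ‖z‖ := by linarith
  have h1 : ‖∫ y, (z - y)⁻¹ ∂ν‖ ≤ 2 / ‖z‖ * ν.real univ := by
    refine norm_integral_le_of_norm_le_const ?_
    filter_upwards [hR] with y hy
    rw [norm_inv, inv_eq_one_div, div_le_div_iff₀ (by
      have := norm_sub_norm_le z y
      rw [Complex.norm_real, Real.norm_eq_abs] at this
      linarith) hz0]
    have := norm_sub_norm_le z y
    rw [Complex.norm_real, Real.norm_eq_abs] at this
    linarith
  have h2 : ‖Complex.I / Real.pi‖ ≤ 1 := by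
    rw [norm_div, Complex.norm_I, Complex.norm_real, Real.norm_of_nonneg Real.pi_pos.le]
    exact div_le_one_of_le₀ (by linarith [Real.pi_gt_three]) Real.pi_pos.le
  unfold cauchyTransform
  rw [norm_mul]
  calc _ ≤ 1 * (2 / ‖z‖ * ν.real univ) := by gcongr
    _ = _ := by ring

/-! ### Integral identities for log(1 + F) and its square -/

/-- The function `log (1 + Q² / (1 + P)²)`, where `P` and `Q` are the Poisson integral and the
conjugate Poisson integral of `ν`. -/
noncomputable def logRatio (ν : Measure ℝ) (ε k : ℝ) : ℝ :=
  Real.log (1 + conjPoissonInt ν ε k ^ 2 / (1 + poissonInt ν ε k) ^ 2)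

lemma logRatio_nonneg {ν : Measure ℝ} (ε k : ℝ) : 0 ≤ logRatio ν ε k :=
  Real.log_nonneg (by
    have : 0 ≤ conjPoissonInt ν ε k ^ 2 / (1 + poissonInt ν ε k) ^ 2 := by positivity
    linarith)

lemma logRatio_le {ν : Measure ℝ} {ε : ℝ} (hε : 0 < ε) (k : ℝ) :
    logRatio ν ε k ≤ Real.log (1 + conjPoissonInt ν ε k ^ 2) := by
  have hP := poissonInt_nonneg (ν := ν) hε.le k
  apply Real.log_le_log (by positivity)
  gcongr
  exact div_le_self (by positivity) (one_le_pow₀ (by linarith))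

lemma log_norm_one_add_cauchyTransform {ν : Measure ℝ} [IsFiniteMeasure ν] {ε : ℝ} (hε : 0 < ε) (k : ℝ) :
    Real.log ‖1 + cauchyTransform ν (k + ε * Complex.I)‖ =
      logRatio ν ε k / 2 + Real.log (1 + poissonInt ν ε k) := by
  have hP := poissonInt_nonneg (ν := ν) hε.le k
  have h1 : ‖1 + cauchyTransform ν (k + ε * Complex.I)‖ ^ 2 =
      (1 + conjPoissonInt ν ε k ^ 2 / (1 + poissonInt ν ε k) ^ 2) * (1 + poissonInt ν ε k) ^ 2 := by
    rw [cauchyTransform_eq hε, ← Complex.normSq_eq_norm_sq, Complex.normSq_apply]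
    simp
    field_simp
  have h2 := congrArg Real.log h1
  rw [Real.log_pow, Real.log_mul (by positivity) (by positivity), Real.log_pow] at h2
  unfold logRatio
  push_cast at h2
  linarith

lemma one_add_cauchyTransform_mem_slitPlane {ν : Measure ℝ} [IsFiniteMeasure ν] {z : ℂ} (hz : 0 < z.im) :
    1 + cauchyTransform ν z ∈ Complex.slitPlane :=
  Or.inl (by have := re_cauchyTransform_nonneg (ν := ν) hz; simp; linarith)

lemma integrable_norm_cauchyTransform_sq {ν : Measure ℝ} [IsFiniteMeasure ν]
    {R : ℝ} (hR : ∀ᵐ y ∂ν, |y| ≤ R) {ε : ℝ} (hε : 0 < ε) :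
    Integrable fun k : ℝ => ‖cauchyTransform ν (k + ε * Complex.I)‖ ^ 2 := by
  have := (integral_horizontal_eq_zero (f := fun z => cauchyTransform ν z ^ 2) (ε := ε)
    (C := (2 * ν.real univ) ^ 2) (R := max (2 * R + 1) 1) hε.le
    (fun z hz => (differentiableAt_cauchyTransform (hε.trans_le hz)).pow 2) (fun z hz hzR => by
      rw [norm_pow, ← div_pow]
      gcongr
      exact norm_cauchyTransform_le hR ((le_max_left _ _).trans hzR))).1.norm
  simpa using this

/-- Subtracting F leaves O(|F|²) = O(1/|z|²), the decay needed for the integral over the line to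
vanish; log(1 + F) alone is only known to be O(1/|z|). The conclusion is the real part of that
integral. -/
lemma integral_log_sub {ν : Measure ℝ} [IsFiniteMeasure ν]
    {R : ℝ} (hR : ∀ᵐ y ∂ν, |y| ≤ R) {ε : ℝ} (hε : 0 < ε) :
    Integrable (fun k : ℝ => logRatio ν ε k / 2 - psi (poissonInt ν ε k)) ∧
      ∫ k : ℝ, (logRatio ν ε k / 2 - psi (poissonInt ν ε k)) = 0 := by
  obtain ⟨h1, h2⟩ := integral_horizontal_eq_zero
    (f := fun z => Complex.log (1 + cauchyTransform ν z) - cauchyTransform ν z) (ε := ε)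
    (C := (2 * ν.real univ) ^ 2) (R := max (2 * R + 1) 1) hε.le
    (fun z hz => by
      have hd := differentiableAt_cauchyTransform (ν := ν) (hε.trans_le hz)
      exact ((hd.const_add 1).clog (one_add_cauchyTransform_mem_slitPlane
        (hε.trans_le hz))).sub hd) (fun z hz hzR => by
      refine (norm_log_one_add_sub_le (re_cauchyTransform_nonneg (hε.trans_le hz))).trans ?_
      rw [← div_pow]
      gcongr
      exact norm_cauchyTransform_le hR ((le_max_left _ _).trans hzR))
  have hre : ∀ k : ℝ, (Complex.log (1 + cauchyTransform ν (k + ε * Complex.I)) -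
      cauchyTransform ν (k + ε * Complex.I)).re =
        logRatio ν ε k / 2 - psi (poissonInt ν ε k) := fun k => by
    rw [Complex.sub_re, Complex.log_re, log_norm_one_add_cauchyTransform hε, cauchyTransform_eq hε]
    simp [psi]
    ring
  have h3 : Integrable fun k : ℝ => (Complex.log (1 + cauchyTransform ν (k + ε * Complex.I)) -
      cauchyTransform ν (k + ε * Complex.I)).re := h1.re
  have h4 := integral_re h1
  simp only [RCLike.re_eq_complex_re, h2, Complex.zero_re] at h4
  simp only [hre] at h3 h4
  exact ⟨h3, h4⟩

/-- The square of log(1 + F) already decays quadratically. Its real part equates the L² norms of log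
|1 + F| and of the argument, and the latter is easy to bound. -/
lemma integral_log_sq_sub {ν : Measure ℝ} [IsFiniteMeasure ν]
    {R : ℝ} (hR : ∀ᵐ y ∂ν, |y| ≤ R) {ε : ℝ} (hε : 0 < ε) :
    Integrable (fun k : ℝ => (logRatio ν ε k / 2 + Real.log (1 + poissonInt ν ε k)) ^ 2 -
        (1 + cauchyTransform ν (k + ε * Complex.I)).arg ^ 2) ∧
      ∫ k : ℝ, ((logRatio ν ε k / 2 + Real.log (1 + poissonInt ν ε k)) ^ 2 -
        (1 + cauchyTransform ν (k + ε * Complex.I)).arg ^ 2) = 0 := by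
  obtain ⟨h1, h2⟩ := integral_horizontal_eq_zero
    (f := fun z => Complex.log (1 + cauchyTransform ν z) ^ 2) (ε := ε)
    (C := (2 * ν.real univ) ^ 2) (R := max (2 * R + 1) 1) hε.le
    (fun z hz => by
      have hd := differentiableAt_cauchyTransform (ν := ν) (hε.trans_le hz)
      exact ((hd.const_add 1).clog (one_add_cauchyTransform_mem_slitPlane
        (hε.trans_le hz))).pow 2) (fun z hz hzR => by
      rw [norm_pow, ← div_pow]
      gcongr
      refine (norm_log_one_add_le (re_cauchyTransform_nonneg (hε.trans_le hz))).trans ?_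
      exact norm_cauchyTransform_le hR ((le_max_left _ _).trans hzR))
  have hre : ∀ k : ℝ, (Complex.log (1 + cauchyTransform ν (k + ε * Complex.I)) ^ 2).re =
        (logRatio ν ε k / 2 + Real.log (1 + poissonInt ν ε k)) ^ 2 -
        (1 + cauchyTransform ν (k + ε * Complex.I)).arg ^ 2 := fun k => by
    rw [sq, Complex.mul_re, Complex.log_re, Complex.log_im, log_norm_one_add_cauchyTransform hε]
    ring
  have h3 : Integrable fun k : ℝ =>
    (Complex.log (1 + cauchyTransform ν (k + ε * Complex.I)) ^ 2).re := h1.re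
  have h4 := integral_re h1
  simp only [RCLike.re_eq_complex_re, h2, Complex.zero_re] at h4
  simp only [hre] at h3 h4
  exact ⟨h3, h4⟩

lemma continuous_cauchyTransform_horizontal {ν : Measure ℝ} [IsFiniteMeasure ν] {ε : ℝ}
    (hε : 0 < ε) : Continuous fun k : ℝ => cauchyTransform ν (k + ε * Complex.I) :=
  continuous_comp_horizontal fun _ hz => differentiableAt_cauchyTransform (hε.trans_le hz)

lemma continuous_poissonInt {ν : Measure ℝ} [IsFiniteMeasure ν] {ε : ℝ} (hε : 0 < ε) :
    Continuous (poissonInt ν ε) := by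
  have := Complex.continuous_re.comp (continuous_cauchyTransform_horizontal (ν := ν) hε)
  refine this.congr fun k => ?_
  simp [cauchyTransform_eq hε]

lemma continuous_conjPoissonInt {ν : Measure ℝ} [IsFiniteMeasure ν] {ε : ℝ} (hε : 0 < ε) :
    Continuous (conjPoissonInt ν ε) := by
  have := Complex.continuous_im.comp (continuous_cauchyTransform_horizontal (ν := ν) hε)
  refine this.congr fun k => ?_
  simp [cauchyTransform_eq hε]

lemma continuous_logRatio {ν : Measure ℝ} [IsFiniteMeasure ν] {ε : ℝ} (hε : 0 < ε) :
    Continuous (logRatio ν ε) := by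
  have h1 := continuous_poissonInt (ν := ν) hε
  have h2 := continuous_conjPoissonInt (ν := ν) hε
  have h3 : ∀ k, 1 + poissonInt ν ε k ≠ 0 := fun k => by
    have := poissonInt_nonneg (ν := ν) hε.le k
    positivity
  unfold logRatio
  refine Continuous.log (continuous_const.add ((h2.pow 2).div₀ ((continuous_const.add h1).pow 2)
    fun k => pow_ne_zero 2 (h3 k))) fun k => ?_
  positivity

lemma continuous_psi_poissonInt {ν : Measure ℝ} [IsFiniteMeasure ν] {ε : ℝ} (hε : 0 < ε) :
    Continuous fun k => psi (poissonInt ν ε k) := by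
  have h1 := continuous_poissonInt (ν := ν) hε
  unfold psi
  refine h1.sub (Continuous.log (continuous_const.add h1) fun k => ?_)
  have := poissonInt_nonneg (ν := ν) hε.le k
  positivity

lemma norm_cauchyTransform_sq {ν : Measure ℝ} [IsFiniteMeasure ν] {ε : ℝ} (hε : 0 < ε) (k : ℝ) :
    ‖cauchyTransform ν (k + ε * Complex.I)‖ ^ 2 = poissonInt ν ε k ^ 2 + conjPoissonInt ν ε k ^ 2 := by
  rw [cauchyTransform_eq hε, ← Complex.normSq_eq_norm_sq, Complex.normSq_apply]
  simp; ring

lemma log_one_add_le_self {x : ℝ} (hx : 0 ≤ x) : Real.log (1 + x) ≤ x := by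
  have := Real.log_le_sub_one_of_pos (show (0:ℝ) < 1 + x by positivity)
  linarith

lemma logRatio_le_sq {ν : Measure ℝ} {ε : ℝ} (hε : 0 < ε) (k : ℝ) :
    logRatio ν ε k ≤ conjPoissonInt ν ε k ^ 2 :=
  (logRatio_le hε k).trans (log_one_add_le_self (sq_nonneg _))

lemma integrable_logRatio {ν : Measure ℝ} [IsFiniteMeasure ν]
    {R : ℝ} (hR : ∀ᵐ y ∂ν, |y| ≤ R) {ε : ℝ} (hε : 0 < ε) : Integrable (logRatio ν ε) := by
  refine (integrable_norm_cauchyTransform_sq hR hε).mono'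
    (continuous_logRatio hε).aestronglyMeasurable (Eventually.of_forall fun k => ?_)
  rw [Real.norm_of_nonneg (logRatio_nonneg _ _), norm_cauchyTransform_sq hε]
  nlinarith [logRatio_le_sq (ν := ν) hε k]

lemma integrable_psi_poissonInt {ν : Measure ℝ} [IsFiniteMeasure ν]
    {R : ℝ} (hR : ∀ᵐ y ∂ν, |y| ≤ R) {ε : ℝ} (hε : 0 < ε) :
    Integrable fun k => psi (poissonInt ν ε k) := by
  refine (integrable_norm_cauchyTransform_sq hR hε).mono'
    (continuous_psi_poissonInt hε).aestronglyMeasurable (Eventually.of_forall fun k => ?_)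
  have hP := poissonInt_nonneg (ν := ν) hε.le k
  rw [Real.norm_of_nonneg (psi_nonneg hP), norm_cauchyTransform_sq hε]
  nlinarith [psi_le_sq hP, sq_nonneg (conjPoissonInt ν ε k)]

/-- The key identity, obtained by integrating `log (1 + F) - F` along a horizontal line, where `F`
is the Cauchy transform of `ν`. -/
lemma integral_logRatio {ν : Measure ℝ} [IsFiniteMeasure ν]
    {R : ℝ} (hR : ∀ᵐ y ∂ν, |y| ≤ R) {ε : ℝ} (hε : 0 < ε) :
    ∫ k, logRatio ν ε k = 2 * ∫ k, psi (poissonInt ν ε k) := by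
  have h := (integral_log_sub hR hε).2
  rw [integral_sub ((integrable_logRatio hR hε).div_const 2) (integrable_psi_poissonInt hR hε),
    integral_div] at h
  linarith

/-- As Re(1 + F) > 0, the argument lies in [-π/2, π/2], where (2/π)|arg| ≤ |sin arg| = |Q|/|1 + F|.
The square of this ratio is 1 - 1/(1 + Q²/(1 + P)²), and 1 - 1/x ≤ log x. -/
lemma arg_sq_le {ν : Measure ℝ} [IsFiniteMeasure ν] {ε : ℝ} (hε : 0 < ε) (k : ℝ) :
    (1 + cauchyTransform ν (k + ε * Complex.I)).arg ^ 2 ≤ Real.pi ^ 2 / 4 * logRatio ν ε k := by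
  have hP := poissonInt_nonneg (ν := ν) hε.le k
  set G := 1 + cauchyTransform ν (k + ε * Complex.I) with hG
  set P := poissonInt ν ε k
  set Q := conjPoissonInt ν ε k with hQ
  have hGre : G.re = 1 + P := by rw [hG, cauchyTransform_eq hε]; simp [P]
  have hGim : G.im = Q := by rw [hG, cauchyTransform_eq hε]; simp [Q]
  have harg : |G.arg| ≤ Real.pi / 2 := Complex.abs_arg_le_pi_div_two_iff.2 (by rw [hGre]; linarith)
  have h1 := Real.mul_abs_le_abs_sin harg
  rw [Complex.sin_arg, hGim] at h1
  have hnorm : ‖G‖ ^ 2 = (1 + P) ^ 2 + Q ^ 2 := by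
    rw [← Complex.normSq_eq_norm_sq, Complex.normSq_apply, hGre, hGim]; ring
  have h2 : (2 / Real.pi * |G.arg|) ^ 2 ≤ Q ^ 2 / ((1 + P) ^ 2 + Q ^ 2) := by
    rw [← hnorm, ← div_pow, ← sq_abs (Q / ‖G‖)]
    gcongr
  have h3 : Q ^ 2 / ((1 + P) ^ 2 + Q ^ 2) ≤ logRatio ν ε k := by
    have := Real.one_sub_inv_le_log_of_pos (show 0 < 1 + Q ^ 2 / (1 + P) ^ 2 by positivity)
    refine le_trans (le_of_eq ?_) this
    field_simp
    ring
  have h4 : G.arg ^ 2 = Real.pi ^ 2 / 4 * (2 / Real.pi * |G.arg|) ^ 2 := by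
    rw [mul_pow, sq_abs, div_pow]
    field_simp
    ring
  rw [h4]
  exact mul_le_mul_of_nonneg_left (h2.trans h3) (by positivity)

lemma integral_log_norm_sq_le {ν : Measure ℝ} [IsFiniteMeasure ν]
    {R : ℝ} (hR : ∀ᵐ y ∂ν, |y| ≤ R) {ε : ℝ} (hε : 0 < ε) :
    Integrable (fun k => (logRatio ν ε k / 2 + Real.log (1 + poissonInt ν ε k)) ^ 2) ∧
    ∫ k, (logRatio ν ε k / 2 + Real.log (1 + poissonInt ν ε k)) ^ 2 ≤
      5 / 2 * ∫ k, logRatio ν ε k := by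
  have hU := integrable_logRatio hR hε
  obtain ⟨h1, h2⟩ := integral_log_sq_sub hR hε
  have hpi : Real.pi ^ 2 / 4 ≤ 5 / 2 := by nlinarith [Real.pi_lt_d2, Real.pi_pos]
  have hmeas : AEStronglyMeasurable
      (fun k : ℝ => (1 + cauchyTransform ν (k + ε * Complex.I)).arg ^ 2) volume :=
    ((Complex.measurable_arg.comp (measurable_const.add
      (continuous_cauchyTransform_horizontal hε).measurable)).pow_const 2).aestronglyMeasurable
  have harg : Integrable fun k : ℝ => (1 + cauchyTransform ν (k + ε * Complex.I)).arg ^ 2 := by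
    refine (hU.const_mul (Real.pi ^ 2 / 4)).mono' hmeas (Eventually.of_forall fun k => ?_)
    rw [Real.norm_of_nonneg (sq_nonneg _)]
    exact arg_sq_le hε k
  have h3 := h1.add harg
  simp only [Pi.add_def, sub_add_cancel] at h3
  refine ⟨h3, ?_⟩
  rw [integral_sub h3 harg, sub_eq_zero] at h2
  rw [h2, ← integral_const_mul]
  refine integral_mono harg (hU.const_mul _) fun k => (arg_sq_le hε k).trans ?_
  exact mul_le_mul_of_nonneg_right hpi (logRatio_nonneg _ _)

/-- Pointwise U ≤ min(U, 20) + (1/5)(U/2 + log(1 + P))², since U ≤ U²/20 for U ≥ 20. The last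
integral is at most (1/5)(5/2) ∫ U = (1/2) ∫ U and is absorbed on the left, where (1/2) ∫ U = ∫
ψ(P). The truncation is what permits dominated convergence later. -/
lemma integral_psi_poissonInt_le {ν : Measure ℝ} [IsFiniteMeasure ν]
    {R : ℝ} (hR : ∀ᵐ y ∂ν, |y| ≤ R) {ε : ℝ} (hε : 0 < ε) :
    ∫ k, psi (poissonInt ν ε k) ≤ ∫ k, min (logRatio ν ε k) 20 := by
  have hU := integrable_logRatio hR hε
  obtain ⟨h1, h2⟩ := integral_log_norm_sq_le hR hε
  have hUc := continuous_logRatio (ν := ν) hε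
  have hmin : Integrable fun k => min (logRatio ν ε k) 20 := by
    refine hU.mono' (hUc.min continuous_const).aestronglyMeasurable
      (Eventually.of_forall fun k => ?_)
    rw [Real.norm_of_nonneg (le_min (logRatio_nonneg _ _) (by norm_num))]
    exact min_le_left _ _
  have hpt : ∀ k, logRatio ν ε k ≤ min (logRatio ν ε k) 20 +
      1 / 5 * (logRatio ν ε k / 2 + Real.log (1 + poissonInt ν ε k)) ^ 2 := fun k => by
    have hu := logRatio_nonneg (ν := ν) ε k
    have hl : 0 ≤ Real.log (1 + poissonInt ν ε k) :=
      Real.log_nonneg (by linarith [poissonInt_nonneg (ν := ν) hε.le k])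
    rcases le_total (logRatio ν ε k) 20 with h | h
    · rw [min_eq_left h]
      nlinarith [sq_nonneg (logRatio ν ε k / 2 + Real.log (1 + poissonInt ν ε k))]
    · rw [min_eq_right h]
      nlinarith [mul_nonneg hu hl, sq_nonneg (Real.log (1 + poissonInt ν ε k))]
  have := integral_mono hU (hmin.add (h1.const_mul (1 / 5))) hpt
  simp only [Pi.add_apply] at this
  rw [integral_add hmin (h1.const_mul _), integral_const_mul] at this
  have hI := integral_logRatio hR hε
  linarith

lemma lintegral_psi_poissonInt_le {ν : Measure ℝ} [IsFiniteMeasure ν]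
    {R : ℝ} (hR : ∀ᵐ y ∂ν, |y| ≤ R) {ε : ℝ} (hε : 0 < ε) :
    ∫⁻ k, ENNReal.ofReal (psi (poissonInt ν ε k)) ≤
      ∫⁻ k, ENNReal.ofReal (min (Real.log (1 + conjPoissonInt ν ε k ^ 2)) 20) := by
  have hmin : Integrable fun k => min (logRatio ν ε k) 20 := by
    refine (integrable_logRatio hR hε).mono'
      ((continuous_logRatio hε).min continuous_const).aestronglyMeasurable
      (Eventually.of_forall fun k => ?_)
    rw [Real.norm_of_nonneg (le_min (logRatio_nonneg _ _) (by norm_num))]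
    exact min_le_left _ _
  rw [← ofReal_integral_eq_lintegral_ofReal (integrable_psi_poissonInt hR hε)
    (Eventually.of_forall fun k => psi_nonneg (poissonInt_nonneg hε.le k))]
  refine (ENNReal.ofReal_le_ofReal (integral_psi_poissonInt_le hR hε)).trans ?_
  rw [ofReal_integral_eq_lintegral_ofReal hmin
    (Eventually.of_forall fun k => le_min (logRatio_nonneg _ _) (by norm_num))]
  exact lintegral_mono fun k => ENNReal.ofReal_le_ofReal (min_le_min_right _ (logRatio_le hε k))

/-- The pointwise bound 4U + 12ψ(P) is integrated with ∫ U = 2 ∫ ψ(P), and 4·2 + 12 = 20. -/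
lemma lintegral_log_conjPoissonInt_le {ν : Measure ℝ} [IsFiniteMeasure ν]
    {R : ℝ} (hR : ∀ᵐ y ∂ν, |y| ≤ R) {ε : ℝ} (hε : 0 < ε) :
    ∫⁻ k, ENNReal.ofReal (Real.log (1 + conjPoissonInt ν ε k ^ 2)) ≤
      20 * ∫⁻ k, ENNReal.ofReal (psi (poissonInt ν ε k)) := by
  have hU := integrable_logRatio hR hε
  have hψ := integrable_psi_poissonInt hR hε
  have hint : Integrable fun k => 4 * logRatio ν ε k + 12 * psi (poissonInt ν ε k) :=
    (hU.const_mul 4).add (hψ.const_mul 12)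
  have h0 : ∀ k, 0 ≤ 4 * logRatio ν ε k + 12 * psi (poissonInt ν ε k) := fun k => by
    have h1 := logRatio_nonneg (ν := ν) ε k
    have h2 := psi_nonneg (poissonInt_nonneg (ν := ν) hε.le k)
    positivity
  calc _ ≤ ∫⁻ k, ENNReal.ofReal (4 * logRatio ν ε k + 12 * psi (poissonInt ν ε k)) :=
        lintegral_mono fun k => ENNReal.ofReal_le_ofReal
          (log_one_add_sq_le (poissonInt_nonneg hε.le k))
    _ = ENNReal.ofReal (20 * ∫ k, psi (poissonInt ν ε k)) := by
      rw [← ofReal_integral_eq_lintegral_ofReal hint (Eventually.of_forall h0),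
        integral_add (hU.const_mul 4) (hψ.const_mul 12), integral_const_mul, integral_const_mul,
        integral_logRatio hR hε]
      congr 1; ring
    _ = _ := by
      rw [ENNReal.ofReal_mul (by norm_num), ofReal_integral_eq_lintegral_ofReal hψ
        (Eventually.of_forall fun k => psi_nonneg (poissonInt_nonneg hε.le k)),
        ENNReal.ofReal_ofNat]

/-! ### Boundary values of the Cauchy transform -/

lemma integrable_halfPlanePoisson_sub (ν : Measure ℝ) [IsFiniteMeasure ν] {ε : ℝ} (hε : 0 < ε)
    (k : ℝ) : Integrable (fun y => halfPlanePoisson ε (k - y)) ν := by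
  refine Integrable.of_bound ((continuous_halfPlanePoisson hε).comp
    (continuous_const.sub continuous_id)).aestronglyMeasurable (1 / ε)
    (Eventually.of_forall fun y => ?_)
  rw [Real.norm_of_nonneg (halfPlanePoisson_nonneg hε.le _)]
  exact halfPlanePoisson_le_inv hε _

lemma ofReal_poissonInt (ν : Measure ℝ) [IsFiniteMeasure ν] {ε : ℝ} (hε : 0 < ε) (k : ℝ) :
    ENNReal.ofReal (poissonInt ν ε k) = ∫⁻ y, ENNReal.ofReal (halfPlanePoisson ε (k - y)) ∂ν :=
  ofReal_integral_eq_lintegral_ofReal (integrable_halfPlanePoisson_sub ν hε k)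
    (Eventually.of_forall fun _ => halfPlanePoisson_nonneg hε.le _)

lemma measurable_ofReal_halfPlanePoisson_sub {ε : ℝ} (hε : 0 < ε) :
    Measurable fun p : ℝ × ℝ => ENNReal.ofReal (halfPlanePoisson ε (p.1 - p.2)) :=
  ((continuous_halfPlanePoisson hε).measurable.comp
    (measurable_fst.sub measurable_snd)).ennreal_ofReal

lemma lintegral_poissonInt (ν : Measure ℝ) [IsFiniteMeasure ν] {ε : ℝ} (hε : 0 < ε) :
    ∫⁻ k, ENNReal.ofReal (poissonInt ν ε k) = ν univ := by
  simp only [ofReal_poissonInt ν hε]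
  rw [lintegral_lintegral_swap (measurable_ofReal_halfPlanePoisson_sub hε).aemeasurable]
  have h1 : ∀ y : ℝ, ∫⁻ k, ENNReal.ofReal (halfPlanePoisson ε (k - y)) = 1 := fun y => by
    rw [← ofReal_integral_eq_lintegral_ofReal ((integrable_halfPlanePoisson hε).comp_sub_right y)
      (Eventually.of_forall fun _ => halfPlanePoisson_nonneg hε.le _),
      integral_sub_right_eq_self (halfPlanePoisson ε), integral_halfPlanePoisson hε,
      ENNReal.ofReal_one]
  simp [h1]

/-- The L² bound for log |1 + F| by (5/2) ∫ U = 5 ∫ ψ(P) ≤ 5 ∫ P. Being uniform in ε, it excludes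
infinite boundary values of F outside a null set. -/
lemma lintegral_log_norm_sq_le {ν : Measure ℝ} [IsFiniteMeasure ν]
    {R : ℝ} (hR : ∀ᵐ y ∂ν, |y| ≤ R) {ε : ℝ} (hε : 0 < ε) :
    ∫⁻ k : ℝ, ENNReal.ofReal (Real.log ‖1 + cauchyTransform ν (k + ε * Complex.I)‖ ^ 2) ≤
      5 * ν univ := by
  obtain ⟨h1, h2⟩ := integral_log_norm_sq_le hR hε
  have hψ := integrable_psi_poissonInt hR hε
  simp only [log_norm_one_add_cauchyTransform hε]
  rw [← ofReal_integral_eq_lintegral_ofReal h1 (Eventually.of_forall fun k => sq_nonneg _)]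
  rw [integral_logRatio hR hε] at h2
  calc _ ≤ ENNReal.ofReal (5 * ∫ k, psi (poissonInt ν ε k)) :=
        ENNReal.ofReal_le_ofReal (h2.trans (le_of_eq (by ring)))
    _ = 5 * ∫⁻ k, ENNReal.ofReal (psi (poissonInt ν ε k)) := by
      rw [ENNReal.ofReal_mul (by norm_num), ofReal_integral_eq_lintegral_ofReal hψ
        (Eventually.of_forall fun k => psi_nonneg (poissonInt_nonneg hε.le k)),
        ENNReal.ofReal_ofNat]
    _ ≤ 5 * ∫⁻ k, ENNReal.ofReal (poissonInt ν ε k) := by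
      gcongr with k
      exact psi_le_self (poissonInt_nonneg hε.le k)
    _ = _ := by rw [lintegral_poissonInt ν hε]

/-- The Cauchy transform of a compactly supported measure has finite vertical limits at almost
every boundary point. -/
lemma ae_exists_tendsto_cauchyTransform {ν : Measure ℝ} [IsFiniteMeasure ν]
    {R : ℝ} (hR : ∀ᵐ y ∂ν, |y| ≤ R) :
    ∀ᵐ x : ℝ, ∃ l : ℂ,
      Tendsto (fun ε : ℝ => cauchyTransform ν (x + ε * Complex.I)) (𝓝[>] 0) (𝓝 l) := by
  have hne : ∀ z : ℂ, 0 < z.im → 1 + cauchyTransform ν z ≠ 0 := fun z hz =>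
    Complex.slitPlane_ne_zero (one_add_cauchyTransform_mem_slitPlane hz)
  have hI : ∀ z : ℂ, 0 ≤ z.im → z + Complex.I ≠ 0 := fun z hz h => by
    have := congrArg Complex.im h
    simp at this; linarith
  -- Re(1 + F) ≥ 1 makes 1/(1 + F) bounded by 1; the factor 1/(z + i) supplies the decay required by
  -- Fatou's theorem.
  have hF := ae_exists_boundary_limit
    (g := fun z => (1 + cauchyTransform ν z)⁻¹ * (z + Complex.I)⁻¹) (C := 1)
    (fun z hz => (((differentiableAt_cauchyTransform hz).const_add 1).inv (hne z hz)).mul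
      (DifferentiableAt.inv (by fun_prop) (hI z hz.le))) (fun z hz => by
      have h1 : 1 ≤ ‖1 + cauchyTransform ν z‖ := by
        have h2 := Complex.abs_re_le_norm (1 + cauchyTransform ν z)
        have h3 := re_cauchyTransform_nonneg (ν := ν) hz
        simp only [Complex.add_re, Complex.one_re] at h2
        linarith [le_abs_self (1 + (cauchyTransform ν z).re)]
      rw [norm_mul, norm_inv, norm_inv, div_eq_mul_inv]
      gcongr
      exact inv_le_one_of_one_le₀ h1)
  set e : ℕ → ℝ := fun n => 1 / ((n : ℝ) + 1)
  have he : ∀ n, 0 < e n := fun n => by positivity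
  have helim : Tendsto e atTop (𝓝[>] 0) := tendsto_nhdsWithin_iff.2
    ⟨tendsto_one_div_add_atTop_nhds_zero_nat, Eventually.of_forall he⟩
  have hmeas : ∀ n, Measurable fun k : ℝ =>
      ENNReal.ofReal (Real.log ‖1 + cauchyTransform ν (k + e n * Complex.I)‖ ^ 2) := fun n =>
    ((Real.measurable_log.comp (continuous_const.add
      (continuous_cauchyTransform_horizontal (he n))).norm.measurable).pow_const 2).ennreal_ofReal
  have hfatou : ∫⁻ k : ℝ, liminf (fun n =>
      ENNReal.ofReal (Real.log ‖1 + cauchyTransform ν (k + e n * Complex.I)‖ ^ 2)) atTop < ∞ := by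
    refine (lintegral_liminf_le hmeas).trans_lt ?_
    refine lt_of_le_of_lt (b := 5 * ν univ) ?_ (ENNReal.mul_lt_top (by simp) (measure_lt_top _ _))
    refine liminf_le_of_le (by isBoundedDefault) fun b hb => ?_
    obtain ⟨n, hn⟩ := hb.exists
    exact hn.trans (lintegral_log_norm_sq_le hR (he n))
  have hfin := ae_lt_top (Measurable.liminf hmeas) hfatou.ne
  filter_upwards [hF, hfin] with x ⟨l, hl⟩ hx
  have hz : Tendsto (fun ε : ℝ => (x : ℂ) + ε * Complex.I) (𝓝[>] 0) (𝓝 x) := by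
    have h2 : Continuous fun s : ℝ => (x : ℂ) + s * Complex.I := by fun_prop
    have := h2.tendsto 0
    simp only [Complex.ofReal_zero, zero_mul, add_zero] at this
    exact this.mono_left nhdsWithin_le_nhds
  have hinv : Tendsto (fun ε : ℝ => (1 + cauchyTransform ν (x + ε * Complex.I))⁻¹) (𝓝[>] 0)
      (𝓝 (l * (x + Complex.I))) := by
    refine (hl.mul (hz.add_const Complex.I)).congr' ?_
    filter_upwards [self_mem_nhdsWithin] with ε hε
    rw [mul_assoc, inv_mul_cancel₀ (hI _ (by simpa using (le_of_lt hε))), mul_one]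
  -- A zero limit of 1/(1 + F) would force |1 + F| → ∞, against the almost everywhere finite lower
  -- limit of log² |1 + F|.
  by_cases hl0 : l * (x + Complex.I) = 0
  · exfalso
    rw [hl0] at hinv
    have h1 : Tendsto (fun ε : ℝ => ‖1 + cauchyTransform ν (x + ε * Complex.I)‖) (𝓝[>] 0) atTop := by
      have h3 : Tendsto (fun ε : ℝ => ‖(1 + cauchyTransform ν (x + ε * Complex.I))⁻¹‖)
          (𝓝[>] 0) (𝓝[>] 0) := by
        refine tendsto_nhdsWithin_iff.2 ⟨by simpa using hinv.norm, ?_⟩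
        filter_upwards [self_mem_nhdsWithin] with ε hε
        simp only [mem_Ioi, norm_pos_iff]
        exact inv_ne_zero (hne _ (by simpa using hε))
      refine (tendsto_inv_nhdsGT_zero.comp h3).congr fun ε => ?_
      simp
    have h2 : Tendsto (fun n => ENNReal.ofReal
        (Real.log ‖1 + cauchyTransform ν (x + e n * Complex.I)‖ ^ 2)) atTop (𝓝 ∞) :=
      ENNReal.tendsto_ofReal_nhds_top.2
        ((tendsto_pow_atTop two_ne_zero).comp (Real.tendsto_log_atTop.comp (h1.comp helim)))
    rw [h2.liminf_eq] at hx
    exact lt_irrefl _ hx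
  · refine ⟨(l * (x + Complex.I))⁻¹ - 1, ?_⟩
    refine ((hinv.inv₀ hl0).sub_const 1).congr fun ε => ?_
    simp

/-! ### Principal values as limits of conjugate Poisson integrals -/

/-- The difference of the kernels of the truncated Hilbert transform and of the conjugate Poisson
integral. -/
noncomputable def truncSubConjKernel (ε t : ℝ) : ℝ :=
  Real.pi⁻¹ * ({t : ℝ | ε < |t|}.indicator (fun t => t⁻¹) t - t / (t ^ 2 + ε ^ 2))

/-- For |t| > ε, 1/t - t/(t² + ε²) is ε/(t² + ε²) times ε/t, a factor of modulus below 1; for |t| ≤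
ε only t/(t² + ε²) is left. So Poisson estimates apply to a kernel that is moreover odd. -/
lemma abs_truncSubConjKernel_le {ε : ℝ} (hε : 0 < ε) (t : ℝ) :
    |truncSubConjKernel ε t| ≤ halfPlanePoisson ε t := by
  unfold truncSubConjKernel halfPlanePoisson
  rw [abs_mul, abs_of_pos (inv_pos.2 Real.pi_pos)]
  refine mul_le_mul_of_nonneg_left ?_ (inv_pos.2 Real.pi_pos).le
  by_cases h : ε < |t|
  · rw [indicator_of_mem (show t ∈ {t : ℝ | ε < |t|} from h)]
    have ht : t ≠ 0 := by rintro rfl; simp at h; linarith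
    have h1 : t⁻¹ - t / (t ^ 2 + ε ^ 2) = ε / (t ^ 2 + ε ^ 2) * (ε / t) := by
      field_simp; ring
    rw [h1, abs_mul, abs_of_nonneg (by positivity), abs_div, abs_of_pos hε]
    refine mul_le_of_le_one_right (by positivity) ?_
    exact div_le_one_of_le₀ h.le (abs_nonneg _)
  · rw [indicator_of_notMem (show t ∉ {t : ℝ | ε < |t|} from h), zero_sub, abs_neg, abs_div,
      abs_of_pos (show 0 < t ^ 2 + ε ^ 2 by positivity)]
    push Not at h
    gcongr

lemma measurable_truncSubConjKernel (ε : ℝ) : Measurable (truncSubConjKernel ε) := by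
  unfold truncSubConjKernel
  refine measurable_const.mul (Measurable.sub ?_ ?_)
  · exact measurable_inv.indicator (measurableSet_lt measurable_const measurable_id.abs)
  · exact measurable_id.div ((measurable_id.pow_const 2).add_const _)

lemma truncSubConjKernel_neg (ε t : ℝ) :
    truncSubConjKernel ε (-t) = -truncSubConjKernel ε t := by
  unfold truncSubConjKernel
  by_cases h : ε < |t|
  · rw [indicator_of_mem (show t ∈ {t : ℝ | ε < |t|} from h),
      indicator_of_mem (show -t ∈ {t : ℝ | ε < |t|} by simpa using h)]
    rw [neg_sq, inv_neg]; ring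
  · rw [indicator_of_notMem (show t ∉ {t : ℝ | ε < |t|} from h),
      indicator_of_notMem (show -t ∉ {t : ℝ | ε < |t|} by simpa using h)]
    rw [neg_sq]; ring

lemma integrable_truncSubConjKernel (ν : Measure ℝ) [IsFiniteMeasure ν] {ε : ℝ} (hε : 0 < ε)
    (x : ℝ) : Integrable (fun y => truncSubConjKernel ε (x - y)) ν :=
  (integrable_halfPlanePoisson_sub ν hε x).mono'
    ((measurable_truncSubConjKernel ε).comp
      (measurable_const.sub measurable_id)).aestronglyMeasurable
    (Eventually.of_forall fun _ => abs_truncSubConjKernel_le hε _)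

lemma integrableOn_inv_sub (ν : Measure ℝ) [IsFiniteMeasure ν] {ε : ℝ} (hε : 0 < ε)
    (x : ℝ) : IntegrableOn (fun y => (x - y)⁻¹) {y | ε < |x - y|} ν := by
  refine Integrable.of_bound (measurable_const.sub measurable_id).inv.aestronglyMeasurable ε⁻¹ ?_
  refine (ae_restrict_iff' ?_).2 (Eventually.of_forall fun y hy => ?_)
  · exact measurableSet_lt measurable_const (measurable_const.sub measurable_id).abs
  · rw [norm_inv]
    exact inv_anti₀ hε (le_of_lt hy)

lemma truncHilbert_sub_conjPoissonInt (ν : Measure ℝ) [IsFiniteMeasure ν] {ε : ℝ} (hε : 0 < ε)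
    (x : ℝ) : truncHilbert ν ε x - conjPoissonInt ν ε x =
      ∫ y, truncSubConjKernel ε (x - y) ∂ν := by
  have hm : MeasurableSet {y : ℝ | ε < |x - y|} :=
    measurableSet_lt measurable_const (measurable_const.sub measurable_id).abs
  have h1 := integrableOn_inv_sub ν hε x
  rw [← integrable_indicator_iff hm] at h1
  have h2 : Integrable (fun y => (x - y) / ((x - y) ^ 2 + ε ^ 2)) ν := by
    have h3 := h1.sub ((integrable_truncSubConjKernel ν hε x).const_mul Real.pi)
    refine h3.congr (Eventually.of_forall fun y => ?_)
    have : {y : ℝ | ε < |x - y|}.indicator (fun y => (x - y)⁻¹) y =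
      {t : ℝ | ε < |t|}.indicator (fun t => t⁻¹) (x - y) := rfl
    simp only [Pi.sub_apply, this, truncSubConjKernel]
    field_simp
    ring
  unfold truncHilbert conjPoissonInt
  rw [← mul_sub, ← integral_indicator hm, ← integral_sub h1 h2, ← integral_const_mul]
  rfl

lemma setIntegral_truncSubConjKernel (ε x : ℝ) :
    ∫ y in Metric.closedBall x 1, truncSubConjKernel ε (x - y) = 0 := by
  rw [Real.closedBall_eq_Icc, integral_Icc_eq_integral_Ioc,
    ← intervalIntegral.integral_of_le (by linarith),
    intervalIntegral.integral_comp_sub_left (fun t => truncSubConjKernel ε t) x]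
  have h := intervalIntegral.integral_comp_neg (a := -1) (b := 1) (fun t => truncSubConjKernel ε t)
  simp only [truncSubConjKernel_neg, intervalIntegral.integral_neg, neg_neg] at h
  have e1 : x - (x + 1) = -1 := by ring
  have e2 : x - (x - 1) = 1 := by ring
  rw [e1, e2]
  linarith

/-- By the Lebesgue decomposition of ν: at almost every x the singular part has density zero and the
density φ of the other part has a Lebesgue point. Oddness of the kernel allows φ(x) to be
subtracted, so near x only measures of zero density at x remain, and the far part is O(ε). -/
lemma ae_tendsto_truncHilbert_sub (ν : Measure ℝ) [IsFiniteMeasure ν] :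
    ∀ᵐ x, Tendsto (fun ε => truncHilbert ν ε x - conjPoissonInt ν ε x) (𝓝[>] 0) (𝓝 0) := by
  set f : ℝ → ℝ≥0∞ := ν.rnDeriv volume with hf
  set φ : ℝ → ℝ := fun y => (f y).toReal with hφ
  set s := ν.singularPart volume
  have hφint : Integrable φ := Measure.integrable_toReal_rnDeriv
  have hν : ν = s + volume.withDensity f := Measure.haveLebesgueDecomposition_add ν volume
  filter_upwards [ae_tendsto_lintegral_enorm_sub_div hφint.locallyIntegrable,
    (Besicovitch.vitaliFamily (volume : Measure ℝ)).ae_eventually_measure_zero_of_singular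
      (Measure.mutuallySingular_singularPart ν volume)] with x hx1 hx2
  set B := Metric.closedBall x 1 with hB
  have hBm : MeasurableSet B := Metric.isClosed_closedBall.measurableSet
  have hsing : Tendsto (fun r : ℝ => s (Metric.closedBall x r) / ENNReal.ofReal r)
      (𝓝[>] 0) (𝓝 0) := by
    have h1 := hx2.comp (Besicovitch.tendsto_filterAt volume x)
    have h2 := ENNReal.Tendsto.const_mul (a := 2) h1 (Or.inr (by norm_num))
    rw [mul_zero] at h2
    refine h2.congr' ?_
    filter_upwards [self_mem_nhdsWithin] with r hr
    simp only [Function.comp, Real.volume_closedBall]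
    rw [ENNReal.ofReal_mul (by norm_num), ENNReal.ofReal_ofNat, ← mul_div_assoc]
    exact ENNReal.mul_div_mul_left _ _ (by norm_num) (by norm_num)
  have h1 := tendsto_lintegral_halfPlanePoisson_zero (measure_ne_top s _) hsing
  have hψm : AEStronglyMeasurable (fun y => φ y - φ x) volume :=
    hφint.1.sub aestronglyMeasurable_const
  have hσ : ∀ r, (volume.withDensity fun t => ‖φ t - φ x‖ₑ) (Metric.closedBall x r) =
      ∫⁻ t in Metric.closedBall x r, ‖φ t - φ x‖ₑ := fun r =>
    withDensity_apply _ Metric.isClosed_closedBall.measurableSet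
  have hψint : IntegrableOn (fun y => φ y - φ x) B :=
    hφint.integrableOn.sub (integrableOn_const (by simp [hB]))
  have h2 := tendsto_lintegral_halfPlanePoisson_zero (k := x)
    (σ := volume.withDensity fun t => ‖φ t - φ x‖ₑ) (by
      rw [hσ]; exact hψint.2.ne) (by simpa only [hσ] using hx1)
  have h3 : Tendsto (fun ε : ℝ => ENNReal.ofReal ε * ν univ) (𝓝[>] 0) (𝓝 0) := by
    have := (ENNReal.continuous_ofReal.tendsto 0).mono_left (nhdsWithin_le_nhds (s := Ioi 0))
    simp only [ENNReal.ofReal_zero] at this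
    simpa using ENNReal.Tendsto.mul_const this (Or.inr (measure_ne_top ν univ))
  have h4 := (h1.add h2).add h3
  simp only [add_zero] at h4
  rw [tendsto_zero_iff_enorm_tendsto_zero]
  refine tendsto_of_tendsto_of_tendsto_of_le_of_le' tendsto_const_nhds h4
    (Eventually.of_forall fun _ => zero_le) ?_
  filter_upwards [self_mem_nhdsWithin] with ε hε
  simp only [mem_Ioi] at hε
  set κ : ℝ → ℝ := fun y => truncSubConjKernel ε (x - y)
  have hκm : Measurable κ :=
    (measurable_truncSubConjKernel ε).comp (measurable_const.sub measurable_id)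
  have hκe : ∀ y, ‖κ y‖ₑ ≤ ENNReal.ofReal (halfPlanePoisson ε (x - y)) := fun y => by
    rw [← ofReal_norm]
    exact ENNReal.ofReal_le_ofReal (abs_truncSubConjKernel_le hε _)
  have hκν : Integrable κ ν := integrable_truncSubConjKernel ν hε x
  have hκs : Integrable κ s := integrable_truncSubConjKernel s hε x
  have hκw : Integrable κ (volume.withDensity f) := by
    have : IsFiniteMeasure (volume.withDensity f) := by
      refine isFiniteMeasure_of_le ν ?_
      exact Measure.withDensity_rnDeriv_le ν volume
    exact integrable_truncSubConjKernel _ hε x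
  have hflt : ∀ᵐ y, f y < ∞ := Measure.rnDeriv_lt_top ν volume
  have hκvol : IntegrableOn κ B := by
    have : IsFiniteMeasure (volume.restrict B) := ⟨by simp [hB]⟩
    exact integrable_truncSubConjKernel _ hε x
  -- The constant φ(x) enters for free because the odd kernel integrates to zero over the ball
  -- centred at x.
  have hsplit : ∫ y, κ y ∂ν = (∫ y in B, κ y ∂s) + (∫ y in B, κ y * (φ y - φ x)) +
      ∫ y in Bᶜ, κ y ∂ν := by
    rw [← integral_add_compl hBm hκν]
    congr 1
    have hk : ∫ y in B, κ y ∂ν = (∫ y in B, κ y ∂s) + ∫ y in B, κ y ∂(volume.withDensity f) := by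
      conv_lhs => rw [hν]
      rw [Measure.restrict_add, integral_add_measure hκs.integrableOn hκw.integrableOn]
    rw [hk]
    congr 1
    rw [restrict_withDensity hBm, integral_withDensity_eq_integral_toReal_smul
      (Measure.measurable_rnDeriv ν volume) (ae_restrict_of_ae hflt)]
    have hi : IntegrableOn (fun y => κ y * φ y) B := by
      refine (hφint.integrableOn.const_mul (1 / ε)).mono'
        (hκm.aestronglyMeasurable.mul hφint.integrableOn.1) (Eventually.of_forall fun y => ?_)
      rw [norm_mul, Real.norm_eq_abs, Real.norm_of_nonneg (ENNReal.toReal_nonneg)]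
      exact mul_le_mul_of_nonneg_right ((abs_truncSubConjKernel_le hε _).trans
        (halfPlanePoisson_le_inv hε _)) ENNReal.toReal_nonneg
    simp only [mul_sub]
    rw [integral_sub hi (hκvol.mul_const _), integral_mul_const, setIntegral_truncSubConjKernel]
    simp only [zero_mul, sub_zero, smul_eq_mul, hφ, hf]
    exact integral_congr_ae (Eventually.of_forall fun y => mul_comm _ _)
  rw [truncHilbert_sub_conjPoissonInt ν hε, hsplit]
  refine (enorm_add_le _ _).trans (add_le_add ((enorm_add_le _ _).trans (add_le_add ?_ ?_)) ?_)
  · exact (enorm_integral_le_lintegral_enorm _).trans (lintegral_mono fun y => hκe y)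
  · refine (enorm_integral_le_lintegral_enorm _).trans ?_
    rw [restrict_withDensity hBm, lintegral_withDensity_eq_lintegral_mul₀ hψm.enorm.restrict]
    · refine lintegral_mono fun y => ?_
      rw [enorm_mul, Pi.mul_apply, mul_comm]
      gcongr
      exact hκe y
    · exact ((continuous_halfPlanePoisson hε).measurable.comp
        (measurable_const.sub measurable_id)).ennreal_ofReal.aemeasurable
  · refine (enorm_integral_le_lintegral_enorm _).trans ?_
    calc _ ≤ ∫⁻ y in Bᶜ, ENNReal.ofReal ε ∂ν := by
          refine setLIntegral_mono' hBm.compl fun y hy => (hκe y).trans ?_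
          apply ENNReal.ofReal_le_ofReal
          simp only [hB, mem_compl_iff, Metric.mem_closedBall, Real.dist_eq, not_le] at hy
          rw [abs_sub_comm] at hy
          simpa using halfPlanePoisson_le_div_sq hε one_pos hy.le
      _ ≤ _ := by
        rw [setLIntegral_const]
        gcongr
        exact subset_univ _

/-- The principal value of a compactly supported measure exists almost everywhere, and it is the
limit of the conjugate Poisson integrals. -/
lemma ae_tendsto_hilbertTransform {ν : Measure ℝ} [IsFiniteMeasure ν]
    {R : ℝ} (hR : ∀ᵐ y ∂ν, |y| ≤ R) :
    ∀ᵐ x, Tendsto (fun ε => truncHilbert ν ε x) (𝓝[>] 0) (𝓝 (hilbertTransform ν x)) ∧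
      Tendsto (fun ε => conjPoissonInt ν ε x) (𝓝[>] 0) (𝓝 (hilbertTransform ν x)) := by
  filter_upwards [ae_exists_tendsto_cauchyTransform hR, ae_tendsto_truncHilbert_sub ν]
    with x ⟨l, hl⟩ hx
  have h1 : Tendsto (fun ε => conjPoissonInt ν ε x) (𝓝[>] 0) (𝓝 l.im) := by
    refine ((Complex.continuous_im.tendsto l).comp hl).congr' ?_
    filter_upwards [self_mem_nhdsWithin] with ε hε
    simp [cauchyTransform_eq (ν := ν) hε]
  have h2 : Tendsto (fun ε => truncHilbert ν ε x) (𝓝[>] 0) (𝓝 l.im) := by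
    simpa using hx.add h1
  have h3 : hilbertTransform ν x = l.im := h2.limUnder_eq
  rw [h3]
  exact ⟨h2, h1⟩

/-! ### Logarithmic integrals of the Hilbert transform as boundary limits -/

/-- Fatou's lemma along the heights 1/(n + 1), the integrand being a continuous function of the
conjugate Poisson integral. -/
lemma lintegral_log_hilbertTransform_le {ν : Measure ℝ} [IsFiniteMeasure ν]
    {R : ℝ} (hR : ∀ᵐ y ∂ν, |y| ≤ R) {b : ℝ≥0∞}
    (hb : ∀ ε : ℝ, 0 < ε → ∫⁻ k, ENNReal.ofReal (psi (poissonInt ν ε k)) ≤ b) :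
    ∫⁻ k, ENNReal.ofReal (Real.log (1 + hilbertTransform ν k ^ 2)) ≤ 20 * b := by
  set e : ℕ → ℝ := fun n => 1 / ((n : ℝ) + 1)
  have he : ∀ n, 0 < e n := fun n => by positivity
  have helim : Tendsto e atTop (𝓝[>] 0) := tendsto_nhdsWithin_iff.2
    ⟨tendsto_one_div_add_atTop_nhds_zero_nat, Eventually.of_forall he⟩
  have hmeas : ∀ n, Measurable fun k : ℝ =>
      ENNReal.ofReal (Real.log (1 + conjPoissonInt ν (e n) k ^ 2)) := fun n =>
    (Real.measurable_log.comp (measurable_const.add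
      ((continuous_conjPoissonInt (he n)).measurable.pow_const 2))).ennreal_ofReal
  calc _ = ∫⁻ k, liminf (fun n =>
        ENNReal.ofReal (Real.log (1 + conjPoissonInt ν (e n) k ^ 2))) atTop := by
        refine lintegral_congr_ae ?_
        filter_upwards [ae_tendsto_hilbertTransform hR] with k hk
        have hc : Continuous fun q : ℝ => ENNReal.ofReal (Real.log (1 + q ^ 2)) :=
          ENNReal.continuous_ofReal.comp (Continuous.log (by fun_prop) fun q => by positivity)
        exact ((hc.tendsto _).comp (hk.2.comp helim)).liminf_eq.symm
    _ ≤ _ := lintegral_liminf_le hmeas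
    _ ≤ 20 * b := by
        refine liminf_le_of_le (by isBoundedDefault) fun c hc => ?_
        obtain ⟨n, hn⟩ := hc.exists
        refine hn.trans ((lintegral_log_conjPoissonInt_le hR (he n)).trans ?_)
        gcongr
        exact hb _ (he n)

/-- If a quantity is dominated by the integrals of `psi` along all Poisson integrals of small
parameter, then it is dominated by the logarithmic integral of the Hilbert transform. -/
lemma le_lintegral_log_hilbertTransform {ν : Measure ℝ} [IsFiniteMeasure ν]
    {R : ℝ} (hR0 : 0 ≤ R) (hR : ∀ᵐ y ∂ν, |y| ≤ R) {b : ℝ≥0∞}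
    (hb : ∀ᶠ ε in 𝓝[>] (0 : ℝ), b ≤ ∫⁻ k, ENNReal.ofReal (psi (poissonInt ν ε k))) :
    b ≤ ∫⁻ k, ENNReal.ofReal (Real.log (1 + hilbertTransform ν k ^ 2)) := by
  set e : ℕ → ℝ := fun n => 1 / ((n : ℝ) + 1)
  have he : ∀ n, 0 < e n := fun n => by positivity
  have helim : Tendsto e atTop (𝓝[>] 0) := tendsto_nhdsWithin_iff.2
    ⟨tendsto_one_div_add_atTop_nhds_zero_nat, Eventually.of_forall he⟩
  -- Constant of the dominating function D/(1 + k²): for |k| ≤ 2R + 1 the truncation gives 20,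
  -- beyond that |Q| ≤ 2ν(ℝ)/|k| and 1 + k² ≤ 2k².
  set D := 20 * (1 + (2 * R + 1) ^ 2) + 2 * (2 * ν.real univ) ^ 2
  have hmeas : ∀ n, Measurable fun k : ℝ =>
      ENNReal.ofReal (min (Real.log (1 + conjPoissonInt ν (e n) k ^ 2)) 20) := fun n =>
    ((Real.measurable_log.comp (measurable_const.add
      ((continuous_conjPoissonInt (he n)).measurable.pow_const 2))).min
        measurable_const).ennreal_ofReal
  have hbound : ∀ (n : ℕ) (k : ℝ), min (Real.log (1 + conjPoissonInt ν (e n) k ^ 2)) 20 ≤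
      D * (1 + k ^ 2)⁻¹ := fun n k => by
    rw [← div_eq_mul_inv, le_div_iff₀ (by positivity)]
    have hm0 : 0 ≤ min (Real.log (1 + conjPoissonInt ν (e n) k ^ 2)) 20 :=
      le_min (Real.log_nonneg (by nlinarith [sq_nonneg (conjPoissonInt ν (e n) k)])) (by norm_num)
    rcases le_total |k| (2 * R + 1) with h | h
    · have h1 : k ^ 2 ≤ (2 * R + 1) ^ 2 := by rw [← sq_abs]; gcongr
      calc _ ≤ 20 * (1 + (2 * R + 1) ^ 2) := by
            gcongr
            exact min_le_right _ _
        _ ≤ D := by simp only [D]; linarith [sq_nonneg (2 * ν.real univ)]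
    · have hk1 : 1 ≤ |k| := by linarith
      have hk2 : 1 ≤ k ^ 2 := by rw [← sq_abs]; exact one_le_pow₀ hk1
      have hz : |k| ≤ ‖(k + e n * Complex.I : ℂ)‖ := by
        have := Complex.abs_re_le_norm (k + e n * Complex.I : ℂ)
        simpa using this
      have h1 := norm_cauchyTransform_le hR (h.trans hz)
      have h2 : conjPoissonInt ν (e n) k ^ 2 ≤ (2 * ν.real univ / |k|) ^ 2 := by
        calc _ ≤ ‖cauchyTransform ν (k + e n * Complex.I)‖ ^ 2 := by
              rw [norm_cauchyTransform_sq (he n)]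
              nlinarith [sq_nonneg (poissonInt ν (e n) k)]
          _ ≤ (2 * ν.real univ / |k|) ^ 2 := by
              gcongr
              refine h1.trans ?_
              gcongr
      rw [div_pow, sq_abs] at h2
      have h3 : min (Real.log (1 + conjPoissonInt ν (e n) k ^ 2)) 20 ≤
          (2 * ν.real univ) ^ 2 / k ^ 2 :=
        (min_le_left _ _).trans ((log_one_add_le_self (sq_nonneg _)).trans h2)
      rw [le_div_iff₀ (by positivity)] at h3
      have h4 : 0 ≤ 20 * (1 + (2 * R + 1) ^ 2) := by positivity
      simp only [D]
      nlinarith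
  have hlim := tendsto_lintegral_of_dominated_convergence
    (F := fun n k => ENNReal.ofReal (min (Real.log (1 + conjPoissonInt ν (e n) k ^ 2)) 20))
    (f := fun k => ENNReal.ofReal (min (Real.log (1 + hilbertTransform ν k ^ 2)) 20))
    (fun k => ENNReal.ofReal (D * (1 + k ^ 2)⁻¹)) hmeas
    (fun n => Eventually.of_forall fun k => ENNReal.ofReal_le_ofReal (hbound n k))
    (integrable_inv_one_add_sq.const_mul D).lintegral_lt_top.ne (by
      filter_upwards [ae_tendsto_hilbertTransform hR] with k hk
      have hc : Continuous fun q : ℝ => ENNReal.ofReal (min (Real.log (1 + q ^ 2)) 20) :=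
        ENNReal.continuous_ofReal.comp ((Continuous.log (by fun_prop)
          fun q => by positivity).min continuous_const)
      exact (hc.tendsto _).comp (hk.2.comp helim))
  refine (ge_of_tendsto hlim ?_).trans
    (lintegral_mono fun k => ENNReal.ofReal_le_ofReal (min_le_left _ _))
  filter_upwards [helim.eventually hb] with n hn
  exact hn.trans (lintegral_psi_poissonInt_le hR (he n))

/-! ### The dyadic maximal function -/

/-- The dyadic variant of the short-range maximal function. -/
noncomputable def dyadicMaximal (ν : Measure ℝ) (k : ℝ) : ℝ≥0∞ :=
  ⨆ j : ℕ, ν (Metric.closedBall k ((1 / 2) ^ j)) / ENNReal.ofReal (2 * (1 / 2) ^ j)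

/-- The dyadic maximal function with only finitely many scales. -/
noncomputable def dyadicMaximalTrunc (ν : Measure ℝ) (J : ℕ) (k : ℝ) : ℝ≥0∞ :=
  ⨆ (j : ℕ) (_ : j < J), ν (Metric.closedBall k ((1 / 2) ^ j)) / ENNReal.ofReal (2 * (1 / 2) ^ j)

lemma dyadicMaximal_le_shortMaximal (ν : Measure ℝ) (k : ℝ) :
    dyadicMaximal ν k ≤ shortMaximal ν k := by
  refine iSup_le fun j => ?_
  rw [Real.closedBall_eq_Icc]
  exact le_iSup₂_of_le ((1 / 2 : ℝ) ^ j)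
    ⟨by positivity, pow_le_one₀ (by norm_num) (by norm_num)⟩ le_rfl

/-- Rounding L up to a power of 1/2 enlarges the interval and costs at most a factor 2 in its
length. -/
lemma shortMaximal_le_dyadicMaximal (ν : Measure ℝ) (k : ℝ) :
    shortMaximal ν k ≤ 2 * dyadicMaximal ν k := by
  refine iSup₂_le fun L hL => ?_
  obtain ⟨j, hj1, hj2⟩ := exists_nat_pow_near_of_lt_one hL.1 hL.2
    (show (0:ℝ) < 1 / 2 by norm_num) (by norm_num)
  have hr : (0:ℝ) < (1 / 2) ^ j := by positivity
  calc _ ≤ ν (Metric.closedBall k ((1 / 2) ^ j)) / (ENNReal.ofReal (2 * (1 / 2) ^ j) / 2) := by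
        gcongr
        · rw [← Real.closedBall_eq_Icc]
          exact Metric.closedBall_subset_closedBall hj2
        · rw [show (2 : ℝ≥0∞) = ENNReal.ofReal 2 by simp, ← ENNReal.ofReal_div_of_pos two_pos]
          apply ENNReal.ofReal_le_ofReal
          rw [pow_succ] at hj1
          linarith
    _ = 2 * (ν (Metric.closedBall k ((1 / 2) ^ j)) / ENNReal.ofReal (2 * (1 / 2) ^ j)) := by
        simp only [div_eq_mul_inv]
        rw [ENNReal.mul_inv (by right; norm_num) (by right; norm_num), inv_inv]
        ring
    _ ≤ _ := by
        gcongr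
        exact le_iSup (fun j : ℕ =>
          ν (Metric.closedBall k ((1 / 2) ^ j)) / ENNReal.ofReal (2 * (1 / 2) ^ j)) j

lemma measurable_measure_closedBall (ν : Measure ℝ) [SFinite ν] (r : ℝ) :
    Measurable fun k => ν (Metric.closedBall k r) := by
  have : MeasurableSet {p : ℝ × ℝ | dist p.2 p.1 ≤ r} :=
    measurableSet_le (measurable_snd.dist measurable_fst) measurable_const
  exact measurable_measure_prodMk_left this

lemma measurable_dyadicMaximal (ν : Measure ℝ) [SFinite ν] : Measurable (dyadicMaximal ν) :=
  Measurable.iSup fun _ => (measurable_measure_closedBall ν _).div_const _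

lemma measurable_dyadicMaximalTrunc (ν : Measure ℝ) [SFinite ν] (J : ℕ) :
    Measurable (dyadicMaximalTrunc ν J) :=
  Measurable.iSup fun _ => Measurable.iSup fun _ => (measurable_measure_closedBall ν _).div_const _

lemma dyadicMaximalTrunc_mono (ν : Measure ℝ) (k : ℝ) :
    Monotone fun J => dyadicMaximalTrunc ν J k := fun _ _ h =>
  iSup_mono fun _ => iSup_mono' fun hj => ⟨hj.trans_le h, le_rfl⟩

lemma iSup_dyadicMaximalTrunc (ν : Measure ℝ) (k : ℝ) :
    ⨆ J, dyadicMaximalTrunc ν J k = dyadicMaximal ν k := by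
  refine le_antisymm (iSup_le fun J => iSup₂_le fun j _ => le_iSup (fun j : ℕ =>
    ν (Metric.closedBall k ((1 / 2) ^ j)) / ENNReal.ofReal (2 * (1 / 2) ^ j)) j)
    (iSup_le fun j => ?_)
  exact le_iSup_of_le (j + 1) (le_iSup₂_of_le j (Nat.lt_succ_self j) le_rfl)

lemma dyadicMaximalTrunc_ne_top (ν : Measure ℝ) [IsFiniteMeasure ν] (J : ℕ) (k : ℝ) :
    dyadicMaximalTrunc ν J k ≠ ∞ := by
  refine ne_top_of_le_ne_top (b := ν univ / ENNReal.ofReal (2 * (1 / 2) ^ J))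
    (ENNReal.div_ne_top (measure_ne_top _ _) (by simp)) ?_
  refine iSup₂_le fun j hj => ?_
  gcongr ?_ / ENNReal.ofReal (2 * ?_)
  · exact measure_mono (subset_univ _)
  · exact pow_le_pow_of_le_one (by norm_num) (by norm_num) hj.le

lemma continuous_logOneAdd : Continuous logOneAdd :=
  EReal.continuous_toENNReal.comp (ENNReal.continuous_log.comp (by fun_prop))

/-! ### Bounding the maximal function by Poisson integrals -/

lemma exists_vitali_cover (t : Set ℝ) (r : ℝ → ℝ) {R : ℝ} (h0 : ∀ x ∈ t, 0 < r x)
    (hR : ∀ x ∈ t, r x ≤ R) : ∃ u ⊆ t, u.Countable ∧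
      (u.PairwiseDisjoint fun x => Metric.closedBall x (r x)) ∧
        t ⊆ ⋃ b ∈ u, Metric.closedBall b (5 * r b) := by
  obtain ⟨u, hut, hdisj, hcov⟩ := Vitali.exists_disjoint_subfamily_covering_enlargement_closedBall
    t (fun x : ℝ => x) r R hR 5 (by norm_num)
  refine ⟨u, hut, hdisj.countable_of_nonempty_interior fun x hx => ?_, hdisj, fun x hx => ?_⟩
  · refine ⟨x, ?_⟩
    exact mem_interior_iff_mem_nhds.2 (Metric.closedBall_mem_nhds x (h0 x (hut hx)))
  · obtain ⟨b, hb, hsub⟩ := hcov x hx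
    exact mem_biUnion hb (hsub (Metric.mem_closedBall_self (h0 x hx).le))

/-- Each point y of the ball spreads at least a quarter of its Poisson mass inside the doubled ball:
the kernel is at least 1/(8ε) on [y - ε, y + ε], as π < 4, and this interval stays inside because ε
≤ r. -/
lemma measure_closedBall_le_lintegral_poissonInt (ν : Measure ℝ) [IsFiniteMeasure ν] {ε r : ℝ}
    (hε : 0 < ε) (hr : ε ≤ r) (b : ℝ) :
    ν (Metric.closedBall b r) ≤
      4 * ∫⁻ k in Metric.closedBall b (2 * r), ENNReal.ofReal (poissonInt ν ε k) := by
  simp only [ofReal_poissonInt ν hε]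
  rw [lintegral_lintegral_swap (measurable_ofReal_halfPlanePoisson_sub hε).aemeasurable]
  have hy : ∀ y ∈ Metric.closedBall b r, (1 : ℝ≥0∞) ≤ 4 * ∫⁻ k in Metric.closedBall b (2 * r),
      ENNReal.ofReal (halfPlanePoisson ε (k - y)) := fun y hy => by
    have hsub : Metric.closedBall y ε ⊆ Metric.closedBall b (2 * r) :=
      Metric.closedBall_subset_closedBall' (by rw [Metric.mem_closedBall] at hy; linarith)
    have h1 : ∫⁻ k in Metric.closedBall y ε, ENNReal.ofReal (1 / (8 * ε)) ≤
        ∫⁻ k in Metric.closedBall b (2 * r), ENNReal.ofReal (halfPlanePoisson ε (k - y)) := by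
      refine le_trans ?_ (lintegral_mono_set hsub)
      refine setLIntegral_mono' Metric.isClosed_closedBall.measurableSet fun k hk => ?_
      apply ENNReal.ofReal_le_ofReal
      rw [Metric.mem_closedBall, Real.dist_eq] at hk
      have h2 : (k - y) ^ 2 ≤ ε ^ 2 := by rw [← sq_abs]; gcongr
      unfold halfPlanePoisson
      rw [← div_eq_inv_mul, div_div, div_le_div_iff₀ (by positivity)
        (mul_pos (by positivity) Real.pi_pos)]
      have h3 := Real.pi_lt_four
      have h4 : 0 ≤ (k - y) ^ 2 := sq_nonneg _
      nlinarith [mul_le_mul_of_nonneg_left h3.le (show 0 ≤ (k - y) ^ 2 + ε ^ 2 by positivity)]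
    rw [setLIntegral_const, Real.volume_closedBall, ← ENNReal.ofReal_mul (by positivity)] at h1
    calc (1 : ℝ≥0∞) = 4 * ENNReal.ofReal (1 / (8 * ε) * (2 * ε)) := by
          rw [show (4 : ℝ≥0∞) = ENNReal.ofReal 4 by simp, ← ENNReal.ofReal_mul (by norm_num)]
          rw [← ENNReal.ofReal_one]; congr 1; field_simp; norm_num
      _ ≤ _ := by gcongr
  calc ν (Metric.closedBall b r) = ∫⁻ y in Metric.closedBall b r, 1 ∂ν := by simp
    _ ≤ ∫⁻ y in Metric.closedBall b r, 4 * (∫⁻ k in Metric.closedBall b (2 * r),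
        ENNReal.ofReal (halfPlanePoisson ε (k - y))) ∂ν :=
      setLIntegral_mono' Metric.isClosed_closedBall.measurableSet hy
    _ ≤ ∫⁻ y, 4 * (∫⁻ k in Metric.closedBall b (2 * r),
        ENNReal.ofReal (halfPlanePoisson ε (k - y))) ∂ν := setLIntegral_le_lintegral _ _
    _ = _ := lintegral_const_mul' _ _ (by norm_num)

/-- A weak type inequality for the maximal function in terms of Poisson integrals. -/
lemma volume_lt_dyadicMaximalTrunc_le (ν : Measure ℝ) [IsFiniteMeasure ν] {J : ℕ} {ε : ℝ}
    (hε : 0 < ε) (hεJ : ε ≤ (1 / 2) ^ J) {s : ℝ} (hs : 0 < s) :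
    volume {k | ENNReal.ofReal s < dyadicMaximalTrunc ν J k} ≤ ENNReal.ofReal (80 / s) *
      ∫⁻ k in {k | s / 16 < poissonInt ν ε k}, ENNReal.ofReal (poissonInt ν ε k) := by
  set t := {k | ENNReal.ofReal s < dyadicMaximalTrunc ν J k}
  set S := {k | s / 16 < poissonInt ν ε k}
  have hSm : MeasurableSet S := measurableSet_lt measurable_const (continuous_poissonInt hε).measurable
  -- Only scales j < J occur, so every selected radius is at least ε; this is why the maximal
  -- function is truncated.
  have hex : ∀ k, ∃ r : ℝ, k ∈ t → ε ≤ r ∧ r ≤ 1 ∧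
      ENNReal.ofReal (2 * s * r) ≤ ν (Metric.closedBall k r) := fun k => by
    by_cases hk : k ∈ t
    · obtain ⟨j, hj, hlt⟩ := lt_biSup_iff.1 (show ENNReal.ofReal s < dyadicMaximalTrunc ν J k from hk)
      refine ⟨(1 / 2) ^ j, fun _ => ⟨hεJ.trans (pow_le_pow_of_le_one (by norm_num) (by norm_num)
        (le_of_lt hj)), pow_le_one₀ (by norm_num) (by norm_num), ?_⟩⟩
      rw [ENNReal.lt_div_iff_mul_lt (Or.inl (by simp)) (Or.inl ENNReal.ofReal_ne_top), ← ENNReal.ofReal_mul hs.le] at hlt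
      refine le_trans (ENNReal.ofReal_le_ofReal (le_of_eq ?_)) hlt.le
      ring
    · exact ⟨0, fun h => absurd h hk⟩
  choose r hr using hex
  have hr0 : ∀ k ∈ t, 0 < r k := fun k hk => hε.trans_le (hr k hk).1
  -- Disjointness is needed for the doubled balls, over which P is integrated. The fivefold
  -- enlargements then have length 20r.
  obtain ⟨u, hut, hcount, hdisj, hcov⟩ := exists_vitali_cover t (fun k => 2 * r k) (R := 2)
    (fun k hk => by have := hr0 k hk; positivity) (fun k hk => by linarith [(hr k hk).2.1])
  have hmass : ∀ b ∈ u, ENNReal.ofReal (20 * r b) ≤ ENNReal.ofReal (80 / s) *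
      ∫⁻ k in Metric.closedBall b (2 * r b) ∩ S, ENNReal.ofReal (poissonInt ν ε k) := fun b hb => by
    obtain ⟨h1, -, h3⟩ := hr b (hut hb)
    have hrb := hr0 b (hut hb)
    have h4 := h3.trans (measure_closedBall_le_lintegral_poissonInt ν hε h1 b)
    rw [← lintegral_inter_add_sdiff (μ := volume) (B := S) _ (Metric.closedBall b (2 * r b)) hSm] at h4
    -- Where P ≤ s/16 the integral over a length 4r is at most sr/4; four times that is sr, half of
    -- the mass 2sr. The other half must come from S.
    have h5 : ∫⁻ k in Metric.closedBall b (2 * r b) \ S, ENNReal.ofReal (poissonInt ν ε k) ≤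
        ENNReal.ofReal (s * r b / 4) := by
      calc _ ≤ ∫⁻ k in Metric.closedBall b (2 * r b) \ S, ENNReal.ofReal (s / 16) := by
            refine setLIntegral_mono' (Metric.isClosed_closedBall.measurableSet.diff hSm)
              fun k hk => ENNReal.ofReal_le_ofReal ?_
            have := hk.2
            simp only [S, mem_ofPred_eq, not_lt] at this
            exact this
        _ ≤ ENNReal.ofReal (s / 16) * volume (Metric.closedBall b (2 * r b)) := by
            rw [setLIntegral_const]; gcongr; exact sdiff_subset
        _ = _ := by
            rw [Real.volume_closedBall, ← ENNReal.ofReal_mul (by positivity)]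
            congr 1; ring
    set A := ∫⁻ k in Metric.closedBall b (2 * r b) ∩ S, ENNReal.ofReal (poissonInt ν ε k)
    have h6 : ENNReal.ofReal (2 * s * r b) ≤ 4 * A + ENNReal.ofReal (s * r b) := by
      refine h4.trans ?_
      rw [mul_add]
      gcongr
      calc _ ≤ 4 * ENNReal.ofReal (s * r b / 4) := by gcongr
        _ = _ := by
          rw [show (4 : ℝ≥0∞) = ENNReal.ofReal 4 by simp, ← ENNReal.ofReal_mul (by norm_num)]
          congr 1; ring
    have h7 : ENNReal.ofReal (s * r b) ≤ 4 * A := by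
      have : ENNReal.ofReal (2 * s * r b) = ENNReal.ofReal (s * r b) + ENNReal.ofReal (s * r b) := by
        rw [← ENNReal.ofReal_add (by positivity) (by positivity)]; congr 1; ring
      rw [this] at h6
      exact (ENNReal.add_le_add_iff_right ENNReal.ofReal_ne_top).1 h6
    calc ENNReal.ofReal (20 * r b) = ENNReal.ofReal (20 / s) * ENNReal.ofReal (s * r b) := by
          rw [← ENNReal.ofReal_mul (by positivity)]; congr 1; field_simp
      _ ≤ ENNReal.ofReal (20 / s) * (4 * A) := by gcongr
      _ = _ := by
          rw [← mul_assoc, show (4 : ℝ≥0∞) = ENNReal.ofReal 4 by simp,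
            ← ENNReal.ofReal_mul (by positivity)]
          congr 2; ring
  calc volume t ≤ volume (⋃ b ∈ u, Metric.closedBall b (5 * (2 * r b))) := measure_mono hcov
    _ ≤ ∑' b : u, volume (Metric.closedBall (b : ℝ) (5 * (2 * r b))) := measure_biUnion_le _ hcount _
    _ ≤ ∑' b : u, ENNReal.ofReal (80 / s) *
        ∫⁻ k in Metric.closedBall (b : ℝ) (2 * r b) ∩ S, ENNReal.ofReal (poissonInt ν ε k) := by
      refine ENNReal.tsum_le_tsum fun b => ?_
      rw [Real.volume_closedBall, show 2 * (5 * (2 * r b)) = 20 * r b by ring]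
      exact hmass b b.2
    _ = ENNReal.ofReal (80 / s) * ∫⁻ k in ⋃ b ∈ u, (Metric.closedBall (b : ℝ) (2 * r b) ∩ S),
        ENNReal.ofReal (poissonInt ν ε k) := by
      rw [ENNReal.tsum_mul_left, lintegral_biUnion hcount
        (fun b _ => Metric.isClosed_closedBall.measurableSet.inter hSm)]
      exact hdisj.mono fun b => inter_subset_left
    _ ≤ _ := by
      gcongr
      exact iUnion₂_subset fun b _ => inter_subset_right

lemma integral_log_deriv (x : ℝ) :
    ∫ t in (0 : ℝ)..x, 2 * t / (1 + t ^ 2) = Real.log (1 + x ^ 2) := by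
  have hd : ∀ t : ℝ, HasDerivAt (fun t => Real.log (1 + t ^ 2)) (2 * t / (1 + t ^ 2)) t := fun t => by
    have := ((hasDerivAt_pow 2 t).const_add 1).log (by positivity)
    simpa using this
  rw [intervalIntegral.integral_eq_sub_of_hasDerivAt (fun t _ => hd t)]
  · simp
  · exact (Continuous.div (by fun_prop) (by fun_prop) fun t => by positivity).intervalIntegrable _ _

/-- Layer cake formula with the derivative 2t/(1 + t²) of log(1 + t²). The weak type bound cancels
the factor t, leaving P times the integral of 160/(1 + t²) over t < 16P. That is at most 160·16P² =
2560P² and at most 160πP ≤ 2560P; min(P, P²) ≤ 6ψ(P) gives 15360. -/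
lemma lintegral_log_dyadicMaximalTrunc_le (ν : Measure ℝ) [IsFiniteMeasure ν] {J : ℕ} {ε : ℝ}
    (hε : 0 < ε) (hεJ : ε ≤ (1 / 2) ^ J) :
    ∫⁻ k, logOneAdd (dyadicMaximalTrunc ν J k ^ 2) ≤
      15360 * ∫⁻ k, ENNReal.ofReal (psi (poissonInt ν ε k)) := by
  set N : ℝ → ℝ := fun k => (dyadicMaximalTrunc ν J k).toReal
  have hN : ∀ k, ENNReal.ofReal (N k) = dyadicMaximalTrunc ν J k := fun k =>
    ENNReal.ofReal_toReal (dyadicMaximalTrunc_ne_top ν J k)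
  have hNm : Measurable N := (measurable_dyadicMaximalTrunc ν J).ennreal_toReal
  have hN0 : ∀ k, 0 ≤ N k := fun k => ENNReal.toReal_nonneg
  have hPm : Measurable (poissonInt ν ε) := (continuous_poissonInt hε).measurable
  have hP0 := fun k => poissonInt_nonneg (ν := ν) hε.le k
  set φ : ℝ × ℝ → ℝ≥0∞ := {q : ℝ × ℝ | q.1 / 16 < poissonInt ν ε q.2}.indicator
    (fun q => ENNReal.ofReal (160 / (1 + q.1 ^ 2)) * ENNReal.ofReal (poissonInt ν ε q.2))
  have hφm : Measurable φ := by
    refine Measurable.indicator ?_ (measurableSet_lt (measurable_fst.div_const _)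
      (hPm.comp measurable_snd))
    refine Measurable.mul (Measurable.ennreal_ofReal ?_) (hPm.comp measurable_snd).ennreal_ofReal
    exact measurable_const.div (measurable_const.add (measurable_fst.pow_const 2))
  calc _ = ∫⁻ k, ENNReal.ofReal (∫ t in (0 : ℝ)..N k, 2 * t / (1 + t ^ 2)) := by
        refine lintegral_congr fun k => ?_
        rw [integral_log_deriv, ← hN, ← ENNReal.ofReal_pow (hN0 k), logOneAdd_ofReal (by positivity)]
    _ = ∫⁻ t in Ioi 0, volume {k | t < N k} * ENNReal.ofReal (2 * t / (1 + t ^ 2)) := by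
        refine lintegral_comp_eq_lintegral_meas_lt_mul _ (Eventually.of_forall hN0) hNm.aemeasurable
          (fun t _ => Continuous.intervalIntegrable (Continuous.div (by fun_prop) (by fun_prop)
            fun t => by positivity) _ _) ?_
        filter_upwards [ae_restrict_mem measurableSet_Ioi] with t ht
        simp only [mem_Ioi] at ht
        positivity
    _ ≤ ∫⁻ t in Ioi 0, ∫⁻ k, φ (t, k) := by
        refine setLIntegral_mono' measurableSet_Ioi fun t ht => ?_
        simp only [mem_Ioi] at ht
        have h1 : {k | t < N k} = {k | ENNReal.ofReal t < dyadicMaximalTrunc ν J k} := by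
          ext k
          simp only [mem_ofPred_eq, ← hN]
          exact (ENNReal.ofReal_lt_ofReal_iff_of_nonneg ht.le).symm
        rw [h1]
        have hSm : MeasurableSet {k | t / 16 < poissonInt ν ε k} :=
          measurableSet_lt measurable_const hPm
        calc _ ≤ ENNReal.ofReal (80 / t) * (∫⁻ k in {k | t / 16 < poissonInt ν ε k},
              ENNReal.ofReal (poissonInt ν ε k)) * ENNReal.ofReal (2 * t / (1 + t ^ 2)) := by
              gcongr
              exact volume_lt_dyadicMaximalTrunc_le ν hε hεJ ht
          _ = ENNReal.ofReal (160 / (1 + t ^ 2)) * (∫⁻ k in {k | t / 16 < poissonInt ν ε k},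
              ENNReal.ofReal (poissonInt ν ε k)) := by
              rw [mul_right_comm, ← ENNReal.ofReal_mul (by positivity)]
              congr 2
              field_simp
              norm_num
          _ = ∫⁻ k, φ (t, k) := by
              rw [← lintegral_const_mul' _ _ ENNReal.ofReal_ne_top, ← lintegral_indicator hSm]
              rfl
    _ = ∫⁻ k, ∫⁻ t in Ioi 0, φ (t, k) :=
        lintegral_lintegral_swap hφm.aemeasurable
    _ ≤ ∫⁻ k, 15360 * ENNReal.ofReal (psi (poissonInt ν ε k)) := by
        refine lintegral_mono fun k => ?_
        set p := poissonInt ν ε k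
        have hp : 0 ≤ p := hP0 k
        have hle1 : ∫⁻ t in Ioi 0, φ (t, k) ≤ ENNReal.ofReal (2560 * p ^ 2) := by
          calc _ ≤ ∫⁻ t in Ioi 0, (Iio (16 * p)).indicator
                  (fun _ => ENNReal.ofReal 160 * ENNReal.ofReal p) t := by
                refine lintegral_mono fun t => ?_
                by_cases h : t / 16 < p
                · rw [indicator_of_mem (show t ∈ Iio (16 * p) by simp; linarith)]
                  simp only [φ]
                  rw [indicator_of_mem (show (t, k) ∈ {q : ℝ × ℝ | q.1 / 16 < poissonInt ν ε q.2}
                    from h)]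
                  gcongr
                  exact div_le_self (by norm_num) (by nlinarith [sq_nonneg t])
                · simp only [φ]
                  rw [indicator_of_notMem (show (t, k) ∉
                    {q : ℝ × ℝ | q.1 / 16 < poissonInt ν ε q.2} from h)]
                  exact zero_le
            _ = _ := by
                rw [setLIntegral_indicator measurableSet_Iio, setLIntegral_const, Iio_inter_Ioi,
                  Real.volume_Ioo, ← ENNReal.ofReal_mul (by norm_num),
                  ← ENNReal.ofReal_mul (by positivity)]
                congr 1; ring
        have hle2 : ∫⁻ t in Ioi 0, φ (t, k) ≤ ENNReal.ofReal (2560 * p) := by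
          calc _ ≤ ∫⁻ t, ENNReal.ofReal p * ENNReal.ofReal (160 * (1 + t ^ 2)⁻¹) := by
                refine (setLIntegral_le_lintegral _ _).trans (lintegral_mono fun t => ?_)
                simp only [φ]
                refine (indicator_le_self _ _ _).trans (le_of_eq ?_)
                rw [mul_comm, div_eq_mul_inv]
            _ = ENNReal.ofReal p * ENNReal.ofReal (160 * Real.pi) := by
                rw [lintegral_const_mul' _ _ ENNReal.ofReal_ne_top,
                  ← ofReal_integral_eq_lintegral_ofReal (integrable_inv_one_add_sq.const_mul _)
                    (Eventually.of_forall fun t => by positivity), integral_const_mul,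
                  integral_univ_inv_one_add_sq]
            _ ≤ _ := by
                rw [← ENNReal.ofReal_mul hp]
                apply ENNReal.ofReal_le_ofReal
                nlinarith [Real.pi_lt_four]
        have hψ := min_le_psi hp
        rw [show (15360 : ℝ≥0∞) = ENNReal.ofReal 15360 by simp, ← ENNReal.ofReal_mul (by norm_num)]
        rcases le_total p (p ^ 2) with h | h
        · rw [min_eq_left h] at hψ
          exact hle2.trans (ENNReal.ofReal_le_ofReal (by linarith))
        · rw [min_eq_right h] at hψ
          exact hle1.trans (ENNReal.ofReal_le_ofReal (by linarith))
    _ = _ := lintegral_const_mul' _ _ (by simp)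

/-- The logarithmic integral of the maximal function of a compactly supported measure is dominated
by that of its Hilbert transform. -/
lemma lintegral_log_dyadicMaximal_le {ν : Measure ℝ} [IsFiniteMeasure ν]
    {R : ℝ} (hR0 : 0 ≤ R) (hR : ∀ᵐ y ∂ν, |y| ≤ R) :
    ∫⁻ k, logOneAdd (dyadicMaximal ν k ^ 2) ≤
      15360 * ∫⁻ k, ENNReal.ofReal (Real.log (1 + hilbertTransform ν k ^ 2)) := by
  have h15 : (15360 : ℝ≥0∞) ≠ 0 := by norm_num
  have h15' : (15360 : ℝ≥0∞) ≠ ∞ := by norm_num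
  -- With J fixed all ε ≤ 2^(-J) are admissible, so ε ↓ 0 is taken first; monotone convergence in J
  -- follows.
  have hJ : ∀ J, ∫⁻ k, logOneAdd (dyadicMaximalTrunc ν J k ^ 2) ≤
      15360 * ∫⁻ k, ENNReal.ofReal (Real.log (1 + hilbertTransform ν k ^ 2)) := fun J => by
    rw [mul_comm, ← ENNReal.div_le_iff h15 h15']
    refine le_lintegral_log_hilbertTransform hR0 hR ?_
    filter_upwards [Ioc_mem_nhdsGT (show (0:ℝ) < (1 / 2) ^ J by positivity)] with ε hε
    rw [ENNReal.div_le_iff h15 h15', mul_comm]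
    exact lintegral_log_dyadicMaximalTrunc_le ν hε.1 hε.2
  have hmono : ∀ k, Monotone fun J => logOneAdd (dyadicMaximalTrunc ν J k ^ 2) := fun k _ _ h =>
    logOneAdd_mono (pow_le_pow_left' (dyadicMaximalTrunc_mono ν k h) 2)
  have hsup : ∀ k, ⨆ J, logOneAdd (dyadicMaximalTrunc ν J k ^ 2) =
      logOneAdd (dyadicMaximal ν k ^ 2) := fun k => by
    have h1 := tendsto_atTop_iSup (dyadicMaximalTrunc_mono ν k)
    rw [iSup_dyadicMaximalTrunc] at h1
    have h2 := ((continuous_logOneAdd.comp (ENNReal.continuous_pow 2)).tendsto _).comp h1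
    exact tendsto_nhds_unique (tendsto_atTop_iSup (hmono k)) h2
  have hm : ∀ J, Measurable fun k => logOneAdd (dyadicMaximalTrunc ν J k ^ 2) := fun J =>
    measurable_logOneAdd.comp ((measurable_dyadicMaximalTrunc ν J).pow_const 2)
  simp only [← hsup]
  rw [lintegral_iSup hm (fun _ _ h k => hmono k h)]
  exact iSup_le hJ

/-! ### Bounding Poisson integrals by the maximal function -/

lemma measure_closedBall_le_dyadicMaximal (ν : Measure ℝ) (k : ℝ) (j : ℕ) :
    ν (Metric.closedBall k ((1 / 2) ^ j)) ≤
      dyadicMaximal ν k * ENNReal.ofReal (2 * (1 / 2) ^ j) := by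
  rw [← ENNReal.div_le_iff (by simp) ENNReal.ofReal_ne_top]
  exact le_iSup (fun j : ℕ =>
    ν (Metric.closedBall k ((1 / 2) ^ j)) / ENNReal.ofReal (2 * (1 / 2) ^ j)) j

/-- Radii up to 1 are controlled by the maximal function after rounding up to a dyadic radius,
larger ones by the total mass. This is the linear growth required to dominate Poisson integrals. -/
lemma measure_closedBall_le (ν : Measure ℝ) (k : ℝ) {r : ℝ} (hr : 0 < r) :
    ν (Metric.closedBall k r) ≤ (4 * dyadicMaximal ν k + ν univ) * ENNReal.ofReal r := by
  rw [add_mul]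
  rcases le_total r 1 with h | h
  · obtain ⟨j, hj1, hj2⟩ := exists_nat_pow_near_of_lt_one hr h
      (show (0:ℝ) < 1 / 2 by norm_num) (by norm_num)
    refine le_trans ?_ le_self_add
    calc _ ≤ ν (Metric.closedBall k ((1 / 2) ^ j)) :=
          measure_mono (Metric.closedBall_subset_closedBall hj2)
      _ ≤ dyadicMaximal ν k * ENNReal.ofReal (2 * (1 / 2) ^ j) :=
          measure_closedBall_le_dyadicMaximal ν k j
      _ ≤ dyadicMaximal ν k * (4 * ENNReal.ofReal r) := by
          gcongr
          rw [show (4 : ℝ≥0∞) = ENNReal.ofReal 4 by simp, ← ENNReal.ofReal_mul (by norm_num)]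
          apply ENNReal.ofReal_le_ofReal
          rw [pow_succ] at hj1
          linarith
      _ = _ := by ring
  · refine le_trans ?_ le_add_self
    calc _ ≤ ν univ * 1 := by rw [mul_one]; exact measure_mono (subset_univ _)
      _ ≤ _ := by gcongr; rw [← ENNReal.ofReal_one]; exact ENNReal.ofReal_le_ofReal h

lemma const_le_logOneAdd {c x : ℝ} {t : ℝ≥0∞} (hx : 0 ≤ x) (h : c ≤ Real.log (1 + x))
    (ht : ENNReal.ofReal x ≤ t) : ENNReal.ofReal c ≤ logOneAdd t := by
  refine le_trans ?_ (logOneAdd_mono ht)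
  rw [logOneAdd_ofReal hx]
  exact ENNReal.ofReal_le_ofReal h

lemma self_le_two_mul_logOneAdd {t : ℝ≥0∞} (ht : t ≤ 1) : t ≤ 2 * logOneAdd t := by
  have hfin : t ≠ ∞ := ne_top_of_le_ne_top ENNReal.one_ne_top ht
  lift t to NNReal using hfin
  have ht1 : (t : ℝ) ≤ 1 := by exact_mod_cast ht
  have ht0 : (0 : ℝ) ≤ t := t.2
  rw [← ENNReal.ofReal_coe_nnreal, logOneAdd_ofReal ht0, show (2 : ℝ≥0∞) = ENNReal.ofReal 2 by simp,
    ← ENNReal.ofReal_mul (by norm_num)]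
  apply ENNReal.ofReal_le_ofReal
  have h := Real.one_sub_inv_le_log_of_pos (show (0:ℝ) < 1 + t by positivity)
  have : (t : ℝ) / 2 ≤ 1 - (1 + (t : ℝ))⁻¹ := by
    rw [show 1 - (1 + (t : ℝ))⁻¹ = t / (1 + t) by field_simp; ring]
    gcongr; linarith
  linarith

lemma measure_closedBall_eq_zero {ν : Measure ℝ} {c : ℝ} (hc : ν (Metric.closedBall c 2)ᶜ = 0) {k r : ℝ}
    (h : r < |k - c| - 2) : ν (Metric.closedBall k r) = 0 := by
  refine measure_mono_null (t := (Metric.closedBall c 2)ᶜ) (fun y hy => ?_) hc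
  intro hy2
  rw [Metric.mem_closedBall, Real.dist_eq] at hy hy2
  have := abs_sub_le k y c
  rw [abs_sub_comm k y] at this
  linarith

lemma dyadicMaximal_eq_zero {ν : Measure ℝ} {c : ℝ} (hc : ν (Metric.closedBall c 2)ᶜ = 0) {k : ℝ} (h : 3 < |k - c|) :
    dyadicMaximal ν k = 0 := by
  simp only [dyadicMaximal, ENNReal.iSup_eq_zero]
  intro j
  rw [measure_closedBall_eq_zero hc, ENNReal.zero_div]
  have : (1 / 2 : ℝ) ^ j ≤ 1 := pow_le_one₀ (by norm_num) (by norm_num)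
  linarith

/-- The mass of the set where the maximal function is large is controlled by the size of a similar
set. -/
lemma measure_one_lt_dyadicMaximal_le {ν : Measure ℝ} {c : ℝ} [IsFiniteMeasure ν]
    (hc : ν (Metric.closedBall c 2)ᶜ = 0)
    (hm : ν univ ≤ 1) :
    ν {k | 1 < dyadicMaximal ν k} ≤
      40 * ∫⁻ k in Metric.closedBall c 4, logOneAdd (dyadicMaximal ν k ^ 2) := by
  set E := {k | 1 < dyadicMaximal ν k}
  -- Stopping time: r is the largest dyadic radius with mean density above 1. The unit ball does not
  -- qualify, as the total mass is at most 1 < 2, so 2r is still an admissible scale of the maximal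
  -- function.
  have hex : ∀ k, ∃ r : ℝ, k ∈ E → 0 < r ∧ 2 * r ≤ 1 ∧ (∃ j : ℕ, 2 * r = (1 / 2) ^ j) ∧
      ENNReal.ofReal (2 * r) ≤ ν (Metric.closedBall k r) ∧
      ν (Metric.closedBall k (5 * r)) ≤ ENNReal.ofReal (16 * r) := fun k => by
    by_cases hk : k ∈ E
    · have hj : ∃ j : ℕ, ENNReal.ofReal (2 * (1 / 2) ^ j) <
          ν (Metric.closedBall k ((1 / 2) ^ j)) := by
        obtain ⟨j, hj⟩ := lt_iSup_iff.1 (show 1 < dyadicMaximal ν k from hk)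
        refine ⟨j, ?_⟩
        rwa [ENNReal.lt_div_iff_mul_lt (Or.inl (by simp)) (Or.inl ENNReal.ofReal_ne_top),
          one_mul] at hj
      classical
      set j := Nat.find hj with hjdef
      have hjs := Nat.find_spec hj
      have hj1 : 1 ≤ j := by
        by_contra! h0
        have h0 : j = 0 := by omega
        rw [← hjdef, h0, pow_zero, mul_one] at hjs
        have h2 := hjs.trans_le ((measure_mono (subset_univ _)).trans hm)
        rw [← ENNReal.ofReal_one] at h2
        have := (ENNReal.ofReal_lt_ofReal_iff one_pos).1 h2
        norm_num at this
      obtain ⟨i, hi⟩ : ∃ i, j = i + 1 := ⟨j - 1, by omega⟩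
      have h2r : 2 * (1 / 2 : ℝ) ^ j = (1 / 2) ^ i := by rw [hi, pow_succ]; ring
      refine ⟨(1 / 2) ^ j, fun _ => ⟨by positivity, ?_, ⟨i, h2r⟩, hjs.le, ?_⟩⟩
      · rw [h2r]; exact pow_le_one₀ (by norm_num) (by norm_num)
      · rcases lt_or_ge j 3 with h3 | h3
        · refine (measure_mono (subset_univ _)).trans (hm.trans ?_)
          rw [← ENNReal.ofReal_one]
          apply ENNReal.ofReal_le_ofReal
          have : (1 / 2 : ℝ) ^ 2 ≤ (1 / 2) ^ j :=
            pow_le_pow_of_le_one (by norm_num) (by norm_num) (by omega)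
          linarith
        · have hmin := Nat.find_min hj (show j - 3 < Nat.find hj by omega)
          push Not at hmin
          -- 8r is the first dyadic radius above 5r and was not selected, so its ball has mass at
          -- most 16r. For j < 3 no such scale exists, but then 16r ≥ 1.
          have h8 : (1 / 2 : ℝ) ^ (j - 3) = 8 * (1 / 2) ^ j := by
            obtain ⟨l, hl⟩ : ∃ l, j = l + 3 := ⟨j - 3, by omega⟩
            rw [hl, Nat.add_sub_cancel, pow_add]; norm_num; ring
          rw [h8] at hmin
          refine (measure_mono (Metric.closedBall_subset_closedBall ?_)).trans
            (hmin.trans (ENNReal.ofReal_le_ofReal (by linarith)))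
          have : (0:ℝ) < (1 / 2) ^ j := by positivity
          linarith
    · exact ⟨0, fun h => absurd h hk⟩
  choose r hr using hex
  obtain ⟨u, huE, hcount, hdisj, hcov⟩ := exists_vitali_cover E r (R := 1)
    (fun k hk => (hr k hk).1) (fun k hk => by have := hr k hk; linarith)
  set f : ℝ → ℝ≥0∞ := fun k => logOneAdd (dyadicMaximal ν k ^ 2)
  -- For k in the ball around b, the ball of radius 2r around k contains it, so N(k) ≥ 2r/(4r) = 1/2
  -- and log(1 + 1/4) ≥ 1/5. Finally 16r = 40·(1/5)·2r.
  have hball : ∀ b ∈ u, ENNReal.ofReal (16 * r b) ≤ 40 * ∫⁻ k in Metric.closedBall b (r b), f k := by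
    intro b hb
    obtain ⟨h0, h1, ⟨i, hi⟩, h2, -⟩ := hr b (huE hb)
    have hfb : ∀ k ∈ Metric.closedBall b (r b), ENNReal.ofReal (1 / 5) ≤ f k := fun k hk => by
      refine const_le_logOneAdd (x := 1 / 4) (by norm_num) ?_ ?_
      · have := Real.one_sub_inv_le_log_of_pos (show (0:ℝ) < 1 + 1 / 4 by norm_num)
        norm_num at this ⊢
        linarith
      · have hN : ENNReal.ofReal (1 / 2) ≤ dyadicMaximal ν k := by
          refine le_trans ?_ (le_iSup (fun j : ℕ =>
            ν (Metric.closedBall k ((1 / 2) ^ j)) / ENNReal.ofReal (2 * (1 / 2) ^ j)) i)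
          rw [← hi, ENNReal.le_div_iff_mul_le (Or.inl (by simpa using h0))
            (Or.inl ENNReal.ofReal_ne_top), ← ENNReal.ofReal_mul (by norm_num)]
          calc _ = ENNReal.ofReal (2 * r b) := by congr 1; ring
            _ ≤ _ := h2
            _ ≤ _ := measure_mono (Metric.closedBall_subset_closedBall' (by
              rw [Metric.mem_closedBall, dist_comm] at hk
              linarith))
        calc ENNReal.ofReal (1 / 4) = ENNReal.ofReal (1 / 2) ^ 2 := by
              rw [← ENNReal.ofReal_pow (by norm_num)]; norm_num
          _ ≤ _ := by gcongr
    calc ENNReal.ofReal (16 * r b) = 40 * (ENNReal.ofReal (1 / 5) * ENNReal.ofReal (2 * r b)) := by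
          rw [show (40 : ℝ≥0∞) = ENNReal.ofReal 40 by simp, ← ENNReal.ofReal_mul (by norm_num),
            ← ENNReal.ofReal_mul (by norm_num)]
          congr 1; ring
      _ = 40 * ∫⁻ k in Metric.closedBall b (r b), ENNReal.ofReal (1 / 5) := by
          rw [setLIntegral_const, Real.volume_closedBall]
      _ ≤ _ := by
          gcongr 40 * ?_
          exact setLIntegral_mono' Metric.isClosed_closedBall.measurableSet hfb
  calc ν E ≤ ν (⋃ b ∈ u, Metric.closedBall b (5 * r b)) := measure_mono hcov
    _ ≤ ∑' b : u, ν (Metric.closedBall (b : ℝ) (5 * r b)) := measure_biUnion_le _ hcount _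
    _ ≤ ∑' b : u, 40 * ∫⁻ k in Metric.closedBall (b : ℝ) (r b), f k :=
      ENNReal.tsum_le_tsum fun b => (hr b (huE b.2)).2.2.2.2.trans (hball b b.2)
    _ = 40 * ∫⁻ k in ⋃ b ∈ u, Metric.closedBall (b : ℝ) (r b), f k := by
      rw [ENNReal.tsum_mul_left, lintegral_biUnion hcount
        (fun b _ => Metric.isClosed_closedBall.measurableSet) hdisj]
    _ ≤ _ := by
      gcongr
      refine iUnion₂_subset fun b hb => Metric.closedBall_subset_closedBall' ?_
      have h1 := hr b (huE hb)
      have h2 : |b - c| ≤ 3 := by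
        by_contra! h
        have h3 : 1 < dyadicMaximal ν b := huE hb
        rw [dyadicMaximal_eq_zero hc h] at h3
        simp at h3
      rw [Real.dist_eq]; linarith

lemma poissonInt_restrict_add {ν : Measure ℝ} [IsFiniteMeasure ν] {E : Set ℝ} (hE : MeasurableSet E) {ε : ℝ}
    (hε : 0 < ε) (k : ℝ) :
    poissonInt ν ε k = poissonInt (ν.restrict E) ε k + poissonInt (ν.restrict Eᶜ) ε k :=
  (integral_add_compl hE (integrable_halfPlanePoisson_sub ν hε k)).symm

lemma ofReal_poissonInt_le {ν : Measure ℝ} [IsFiniteMeasure ν] {k ε : ℝ} {b : ℝ≥0∞} (hε : 0 < ε)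
    (h : ∀ r : ℝ, 0 < r → ν (Metric.closedBall k r) ≤ b * ENNReal.ofReal r) :
    ENNReal.ofReal (poissonInt ν ε k) ≤ 8 * b := by
  rw [ofReal_poissonInt ν hε]
  exact lintegral_halfPlanePoisson_le hε h

/-- The integrals of `psi` along the Poisson integrals of a measure supported in a short interval
are dominated by the logarithmic integral of the maximal function and the square of the mass. -/
lemma lintegral_psi_poissonInt_le_dyadicMaximal {ν : Measure ℝ} {c : ℝ} [IsFiniteMeasure ν]
    (hc : ν (Metric.closedBall c 2)ᶜ = 0) {ε : ℝ} (hε : 0 < ε) :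
    ∫⁻ k, ENNReal.ofReal (psi (poissonInt ν ε k)) ≤
      100000 * ((∫⁻ k in Metric.closedBall c 4, logOneAdd (dyadicMaximal ν k ^ 2)) +
        ν univ ^ 2) := by
  set m := ν univ
  set f : ℝ → ℝ≥0∞ := fun k => logOneAdd (dyadicMaximal ν k ^ 2)
  have hfm : Measurable f := measurable_logOneAdd.comp ((measurable_dyadicMaximal ν).pow_const 2)
  set I := ∫⁻ k in Metric.closedBall c 4, f k
  -- For mass above 1 the trivial bound ∫ ψ(P) ≤ ∫ P = m ≤ m² suffices.
  rcases lt_or_ge 1 m with h1m | hm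
  · calc _ ≤ ∫⁻ k, ENNReal.ofReal (poissonInt ν ε k) :=
          lintegral_mono fun k => ENNReal.ofReal_le_ofReal (psi_le_self (poissonInt_nonneg hε.le k))
      _ = m := lintegral_poissonInt ν hε
      _ ≤ 1 * m ^ 2 := by rw [one_mul, sq]; exact le_mul_of_one_le_left zero_le h1m.le
      _ ≤ _ := by
          gcongr
          · norm_num
          · exact le_add_self
  set E := {k | 1 < dyadicMaximal ν k}
  have hEm : MeasurableSet E := measurableSet_lt measurable_const (measurable_dyadicMaximal ν)
  set B := Metric.closedBall c 4
  have hBm : MeasurableSet B := Metric.isClosed_closedBall.measurableSet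
  set p1 := poissonInt (ν.restrict E) ε
  set p2 := poissonInt (ν.restrict Eᶜ) ε
  have hp1 : ∀ k, 0 ≤ p1 k := fun k => poissonInt_nonneg hε.le k
  have hp2 : ∀ k, 0 ≤ p2 k := fun k => poissonInt_nonneg hε.le k
  have hgrowth : ∀ k ∉ E, ∀ r : ℝ, 0 < r → ν (Metric.closedBall k r) ≤ 5 * ENNReal.ofReal r := by
    intro k hk r hr
    refine (measure_closedBall_le ν k hr).trans ?_
    have hk1 : dyadicMaximal ν k ≤ 1 := not_lt.1 hk
    gcongr
    calc 4 * dyadicMaximal ν k + m ≤ 4 * 1 + 1 := by gcongr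
      _ = 5 := by norm_num
  -- Off E the maximal function is at most 1, where N² ≤ 2 log(1 + N²).
  have hcase1 : ∀ k ∉ E, ENNReal.ofReal (p2 k) ^ 2 ≤ 4096 * f k + 128 * m ^ 2 := by
    intro k hk
    have h1 : ENNReal.ofReal (p2 k) ≤ 8 * (4 * dyadicMaximal ν k + m) :=
      ofReal_poissonInt_le hε fun r hr =>
        (Measure.restrict_apply_le _ _).trans (measure_closedBall_le ν k hr)
    have hk1 : dyadicMaximal ν k ≤ 1 := not_lt.1 hk
    have hfin : dyadicMaximal ν k ≠ ∞ := ne_top_of_le_ne_top ENNReal.one_ne_top hk1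
    have h2 : dyadicMaximal ν k ^ 2 ≤ 2 * f k :=
      self_le_two_mul_logOneAdd (pow_le_one₀ zero_le hk1)
    have h3 : (4 * dyadicMaximal ν k + m) ^ 2 ≤ 32 * dyadicMaximal ν k ^ 2 + 2 * m ^ 2 :=
      (ENNReal.add_sq_le_two_mul _ _).trans (le_of_eq (by ring))
    calc _ ≤ (8 * (4 * dyadicMaximal ν k + m)) ^ 2 := by gcongr
      _ = 64 * (4 * dyadicMaximal ν k + m) ^ 2 := by rw [mul_pow]; norm_num
      _ ≤ 64 * (32 * (2 * f k) + 2 * m ^ 2) := by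
          refine mul_le_mul_right (h3.trans ?_) 64
          gcongr
      _ = _ := by ring
  -- A ball meeting the complement of E lies in a ball of twice the radius about a point outside E,
  -- where growth is at most 5 per unit radius. So removing the mass on E makes the Poisson integral
  -- bounded everywhere, by 8·10.
  have hcase2 : ∀ k, ENNReal.ofReal (p2 k) ^ 2 ≤ 6400 := by
    intro k
    have h1 : ENNReal.ofReal (p2 k) ≤ 8 * 10 := by
      refine ofReal_poissonInt_le hε fun r hr => ?_
      rw [Measure.restrict_apply Metric.isClosed_closedBall.measurableSet]
      rcases (Metric.closedBall k r ∩ Eᶜ).eq_empty_or_nonempty with h | ⟨y, hy1, hy2⟩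
      · simp [h]
      · calc _ ≤ ν (Metric.closedBall y (2 * r)) := by
              refine measure_mono (inter_subset_left.trans
                (Metric.closedBall_subset_closedBall' ?_))
              rw [Metric.mem_closedBall, dist_comm] at hy1
              linarith
          _ ≤ 5 * ENNReal.ofReal (2 * r) := hgrowth y hy2 _ (by positivity)
          _ = 10 * ENNReal.ofReal r := by
              rw [ENNReal.ofReal_mul two_pos.le, ENNReal.ofReal_ofNat, ← mul_assoc]; norm_num
    calc _ ≤ (8 * 10 : ℝ≥0∞) ^ 2 := by gcongr
      _ = 6400 := by norm_num
  -- Balls around k of radius below |k - c| - 2 carry no mass, so the growth constant is m/(|k - c|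
  -- - 2).
  have hcase3 : ∀ k ∉ B, ENNReal.ofReal (p2 k) ^ 2 ≤
      m ^ 2 * ENNReal.ofReal (512 * (1 + (k - c) ^ 2)⁻¹) := by
    intro k hk
    simp only [B, Metric.mem_closedBall, Real.dist_eq, not_le] at hk
    set d := |k - c|
    have h1 : ENNReal.ofReal (p2 k) ≤ 8 * (m * ENNReal.ofReal (1 / (d - 2))) := by
      refine ofReal_poissonInt_le hε fun r hr => (Measure.restrict_apply_le _ _).trans ?_
      rcases lt_or_ge r (d - 2) with h | h
      · rw [measure_closedBall_eq_zero hc h]; exact zero_le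
      · rw [mul_assoc, ← ENNReal.ofReal_mul (by apply div_nonneg <;> linarith)]
        calc _ ≤ m * 1 := by rw [mul_one]; exact measure_mono (subset_univ _)
          _ ≤ _ := by
              gcongr
              rw [← ENNReal.ofReal_one]
              apply ENNReal.ofReal_le_ofReal
              rw [one_div_mul_eq_div, one_le_div (by linarith)]
              exact h
    calc _ ≤ (8 * (m * ENNReal.ofReal (1 / (d - 2)))) ^ 2 := by gcongr
      _ = m ^ 2 * ENNReal.ofReal (64 * (1 / (d - 2)) ^ 2) := by
          rw [mul_pow, mul_pow, ENNReal.ofReal_mul (by norm_num),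
            ← ENNReal.ofReal_pow (by apply div_nonneg <;> linarith)]
          norm_num
          ring
      _ ≤ _ := by
          gcongr m ^ 2 * ENNReal.ofReal ?_
          rw [← sq_abs (k - c)]
          change 64 * (1 / (d - 2)) ^ 2 ≤ 512 * (1 + d ^ 2)⁻¹
          rw [div_pow, one_pow, mul_one_div, ← div_eq_mul_inv,
            div_le_div_iff₀ (by nlinarith) (by positivity)]
          nlinarith
  have hpt : ∀ k, ENNReal.ofReal (p2 k) ^ 2 ≤
      B.indicator (fun k => 4096 * f k + 128 * m ^ 2 + 12800 * f k) k +
        m ^ 2 * ENNReal.ofReal (512 * (1 + (k - c) ^ 2)⁻¹) := by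
    intro k
    by_cases hkB : k ∈ B
    · rw [indicator_of_mem hkB]
      refine le_trans ?_ le_self_add
      -- On E, log(1 + N²) ≥ log 2 ≥ 1/2, so the constant 6400 is at most 12800 f.
      by_cases hkE : k ∈ E
      · refine le_trans ?_ le_add_self
        have h1 : ENNReal.ofReal (1 / 2) ≤ f k := by
          refine const_le_logOneAdd (x := 1) zero_le_one ?_ ?_
          · have := Real.one_sub_inv_le_log_of_pos (show (0:ℝ) < 1 + 1 by norm_num)
            norm_num at this ⊢
            linarith
          · rw [ENNReal.ofReal_one]
            exact one_le_pow₀ (le_of_lt hkE)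
        calc _ ≤ 6400 := hcase2 k
          _ = 12800 * ENNReal.ofReal (1 / 2) := by
              rw [show (12800 : ℝ≥0∞) = ENNReal.ofReal 12800 by simp,
                ← ENNReal.ofReal_mul (by norm_num)]
              norm_num
          _ ≤ _ := by gcongr
      · exact (hcase1 k hkE).trans le_self_add
    · exact (hcase3 k hkB).trans le_add_self
  have hint2 : ∫⁻ k, ENNReal.ofReal (p2 k) ^ 2 ≤ 16896 * I + 3072 * m ^ 2 := by
    have hmB : Measurable (B.indicator fun k => 4096 * f k + 128 * m ^ 2 + 12800 * f k) :=
      (((hfm.const_mul _).add_const _).add (hfm.const_mul _)).indicator hBm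
    have e1 : ∫⁻ k in B, (4096 * f k + 128 * m ^ 2 + 12800 * f k) = 16896 * I + 1024 * m ^ 2 := by
      have : ∀ k, 4096 * f k + 128 * m ^ 2 + 12800 * f k = 16896 * f k + 128 * m ^ 2 := fun k => by
        ring
      simp only [this]
      rw [lintegral_add_right _ measurable_const, lintegral_const_mul' _ _ (by simp),
        setLIntegral_const, Real.volume_closedBall]
      congr 1
      rw [show (2 * 4 : ℝ) = 8 by norm_num, ENNReal.ofReal_ofNat]
      ring
    have e2 : ∫⁻ k, m ^ 2 * ENNReal.ofReal (512 * (1 + (k - c) ^ 2)⁻¹) ≤ 2048 * m ^ 2 := by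
      have hi : Integrable fun k => 512 * (1 + (k - c) ^ 2)⁻¹ :=
        (integrable_inv_one_add_sq.comp_sub_right c).const_mul 512
      rw [lintegral_const_mul' _ _ (ENNReal.pow_ne_top (measure_ne_top _ _)),
        ← ofReal_integral_eq_lintegral_ofReal hi (Eventually.of_forall fun k => by positivity),
        integral_const_mul, integral_sub_right_eq_self (fun k : ℝ => (1 + k ^ 2)⁻¹),
        integral_univ_inv_one_add_sq, mul_comm]
      gcongr
      rw [show (2048 : ℝ≥0∞) = ENNReal.ofReal 2048 by simp]
      apply ENNReal.ofReal_le_ofReal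
      linarith [Real.pi_lt_four]
    calc _ ≤ _ := lintegral_mono hpt
      _ = (16896 * I + 1024 * m ^ 2) + ∫⁻ k, m ^ 2 * ENNReal.ofReal (512 * (1 + (k - c) ^ 2)⁻¹) := by
          rw [lintegral_add_left hmB, lintegral_indicator hBm, e1]
      _ ≤ (16896 * I + 1024 * m ^ 2) + 2048 * m ^ 2 := by gcongr
      _ = _ := by ring
  have hint1 : ∫⁻ k, ENNReal.ofReal (p1 k) ≤ 40 * I := by
    rw [lintegral_poissonInt (ν.restrict E) hε, Measure.restrict_apply_univ]
    exact measure_one_lt_dyadicMaximal_le hc hm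
  calc _ ≤ ∫⁻ k, (2 * ENNReal.ofReal (p1 k) + 4 * ENNReal.ofReal (p2 k) ^ 2) := by
        refine lintegral_mono fun k => ?_
        rw [poissonInt_restrict_add hEm hε, show (2 : ℝ≥0∞) = ENNReal.ofReal 2 by simp,
          show (4 : ℝ≥0∞) = ENNReal.ofReal 4 by simp, ← ENNReal.ofReal_pow (hp2 k),
          ← ENNReal.ofReal_mul (by norm_num), ← ENNReal.ofReal_mul (by norm_num),
          ← ENNReal.ofReal_add (by have := hp1 k; positivity) (by have := hp2 k; positivity)]
        exact ENNReal.ofReal_le_ofReal (psi_add_le (hp1 k) (hp2 k))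
    _ = 2 * (∫⁻ k, ENNReal.ofReal (p1 k)) + 4 * ∫⁻ k, ENNReal.ofReal (p2 k) ^ 2 := by
        rw [lintegral_add_left ((continuous_poissonInt hε).measurable.ennreal_ofReal.const_mul 2),
          lintegral_const_mul' _ _ (by simp), lintegral_const_mul' _ _ (by simp)]
    _ ≤ 2 * (40 * I) + 4 * (16896 * I + 3072 * m ^ 2) := by gcongr
    _ = 67664 * I + 12288 * m ^ 2 := by ring
    _ ≤ 100000 * I + 100000 * m ^ 2 := by gcongr <;> norm_num
    _ = _ := by ring

/-! ### The discrete Hilbert transform and convolutions on ℓ² -/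

lemma measurable_periodizedBernoulli (k : ℕ) : Measurable (periodizedBernoulli k) := by
  have h : Measurable (bernoulliFun k) := (Polynomial.continuous _).measurable
  exact (h.comp measurable_subtype_coe).comp (AddCircle.measurableEquivIco 1 0).measurable

lemma abs_periodizedBernoulli_one_le (x : UnitAddCircle) : |periodizedBernoulli 1 x| ≤ 1 := by
  have h := (AddCircle.equivIco 1 0 x).2
  have h2 : periodizedBernoulli 1 x = bernoulliFun 1 (AddCircle.equivIco 1 0 x : ℝ) := rfl
  rw [h2]
  simp only [bernoulliFun, Polynomial.bernoulli_one] 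
  simp at h ⊢
  rw [abs_le]
  constructor <;> linarith

/-- The discrete Hilbert transform is bounded on `ℓ²`. -/
lemma summable_discreteHilbert {a : ℤ → ℝ} (ha : Summable fun m => a m ^ 2) :
    (∀ n : ℤ, Summable fun m : ℤ => a m * ((n : ℝ) - m)⁻¹) ∧
      Summable fun n : ℤ => (∑' m : ℤ, a m * ((n : ℝ) - m)⁻¹) ^ 2 := by
  set μc := @AddCircle.haarAddCircle 1 _ with hμc
  have hmem : Memℓp (fun m : ℤ => (a m : ℂ)) 2 := by
    rw [memℓp_gen_iff (by norm_num)]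
    simpa using ha
  set f : Lp ℂ 2 μc := fourierBasis.repr.symm ⟨_, hmem⟩
  have hf : ∀ m, inner ℂ (fourierBasis m) f = (a m : ℂ) := fun m => by
    rw [← fourierBasis.repr_apply_apply, LinearIsometryEquiv.apply_symm_apply]
  -- The sawtooth is bounded with Fourier coefficients -1/(2πij), so convolution with 1/j on ℤ is,
  -- up to a constant, multiplication by it on the circle. Its mean is zero, in accordance with `0⁻¹
  -- = 0` in the diagonal terms.
  set g : UnitAddCircle → ℂ := (↑) ∘ periodizedBernoulli 1 with hg
  have hgm : Measurable g := Complex.measurable_ofReal.comp (measurable_periodizedBernoulli 1)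
  have hgb : ∀ x, ‖g x‖ ≤ 1 := fun x => by
    simpa [hg] using abs_periodizedBernoulli_one_le x
  have hh : ∀ n : ℤ, MemLp (fun x : UnitAddCircle => fourier n x * g x) 2 μc := fun n =>
    MemLp.of_bound ((fourier n).continuous.measurable.mul hgm).aestronglyMeasurable 1
      (Eventually.of_forall fun x => by
        rw [norm_mul]
        have : ‖fourier n x‖ = 1 := by rw [fourier_apply]; exact Circle.norm_coe _
        rw [this, one_mul]
        exact hgb x)
  have hgf : MemLp (fun x => g x * f x) 2 μc := by
    refine (Lp.memLp f).of_le (hgm.aestronglyMeasurable.mul (Lp.memLp f).1)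
      (Eventually.of_forall fun x => ?_)
    rw [norm_mul]
    exact mul_le_of_le_one_left (norm_nonneg _) (hgb x)
  have hgconj : ∀ x, starRingEnd ℂ (g x) = g x := fun x => Complex.conj_ofReal _
  have h1 : ∀ n m : ℤ, inner ℂ ((hh n).toLp) (fourierBasis m) =
      -(2 * Real.pi * Complex.I)⁻¹ * (((n : ℝ) - m)⁻¹ : ℝ) := fun n m => by
    have : inner ℂ ((hh n).toLp) (fourierBasis m) = fourierCoeff g (n - m) := by
      rw [L2.inner_def, coe_fourierBasis]
      refine integral_congr_ae ?_
      filter_upwards [(hh n).coeFn_toLp, coeFn_fourierLp (T := 1) 2 m] with x hx hx2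
      rw [hx, hx2]
      simp only [RCLike.inner_apply, map_mul, hgconj, smul_eq_mul]
      rw [← fourier_neg, neg_sub, sub_eq_add_neg, fourier_add]
      ring
    rw [this, hg, fourierCoeff_bernoulli_eq one_ne_zero]
    push_cast
    simp [div_eq_mul_inv]
    ring
  have h2 : ∀ n : ℤ, inner ℂ ((hh n).toLp) f = fourierCoeff hgf.toLp n := fun n => by
    rw [L2.inner_def]
    refine integral_congr_ae ?_
    filter_upwards [(hh n).coeFn_toLp, hgf.coeFn_toLp] with x hx hx2
    rw [hx, hx2]
    simp only [RCLike.inner_apply, map_mul, hgconj, smul_eq_mul]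
    rw [← fourier_neg]
    ring
  have hc : (2 * Real.pi * Complex.I : ℂ) ≠ 0 := by
    simp [Real.pi_ne_zero]
  -- Parseval's identity for the inner product of f with a modulated sawtooth gives both convergence
  -- of the series and its value as a Fourier coefficient of gf.
  have h3 : ∀ n : ℤ, HasSum (fun m : ℤ => ((a m * ((n : ℝ) - m)⁻¹ : ℝ) : ℂ))
      (-(2 * Real.pi * Complex.I) * fourierCoeff hgf.toLp n) := fun n => by
    have h4 := (fourierBasis.hasSum_inner_mul_inner (hh n).toLp f).mul_left
      (-(2 * Real.pi * Complex.I))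
    rw [h2] at h4
    refine Eq.mpr (congrArg (fun u => HasSum u _) (funext fun m => ?_)) h4
    rw [h1, hf]
    push_cast
    field_simp
  have hsum : ∀ n : ℤ, Summable fun m : ℤ => a m * ((n : ℝ) - m)⁻¹ := fun n =>
    Complex.summable_ofReal.1 (h3 n).summable
  refine ⟨hsum, ?_⟩
  have h5 := (hasSum_sq_fourierCoeff hgf.toLp).summable.mul_left
    (‖-(2 * Real.pi * Complex.I : ℂ)‖ ^ 2)
  refine h5.congr fun n => ?_
  rw [← mul_pow, ← norm_mul, ← (h3 n).tsum_eq, ← Complex.ofReal_tsum, Complex.norm_real,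
    Real.norm_eq_abs, sq_abs]

/-- The summable weight `(1 + j²)⁻¹` on `ℤ`. -/
noncomputable def sqWeight (j : ℤ) : ℝ := (1 + (j : ℝ) ^ 2)⁻¹

lemma sqWeight_pos (j : ℤ) : 0 < sqWeight j := by unfold sqWeight; positivity

lemma summable_sqWeight : Summable sqWeight := by
  have h : Summable fun j : ℤ => 1 / (j : ℝ) ^ 2 := Real.summable_one_div_int_pow.2 one_lt_two
  refine Summable.of_norm_bounded_eventually h ?_
  filter_upwards [(Set.finite_singleton (0 : ℤ)).compl_mem_cofinite] with j hj
  have hj : (j : ℝ) ≠ 0 := by exact_mod_cast hj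
  rw [Real.norm_of_nonneg (sqWeight_pos j).le]
  unfold sqWeight
  rw [one_div]
  exact inv_anti₀ (by positivity) (by linarith)

/-- Cauchy–Schwarz with respect to the weight w, passed to the limit from finite sums. -/
lemma tsum_mul_sq_le {ι : Type*} {w b : ι → ℝ} (hw : ∀ i, 0 ≤ w i) (hws : Summable w)
    (h : Summable fun i => w i * b i ^ 2) (hr : Summable fun i => w i * b i) :
    (∑' i, w i * b i) ^ 2 ≤ (∑' i, w i) * ∑' i, w i * b i ^ 2 := by
  have t0 : Tendsto (fun s : Finset ι => ∑ i ∈ s, w i * b i) atTop (𝓝 (∑' i, w i * b i)) :=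
    hr.hasSum
  have t1 : Tendsto (fun s : Finset ι => ∑ i ∈ s, w i) atTop (𝓝 (∑' i, w i)) := hws.hasSum
  have t2 : Tendsto (fun s : Finset ι => ∑ i ∈ s, w i * b i ^ 2) atTop
    (𝓝 (∑' i, w i * b i ^ 2)) := h.hasSum
  refine le_of_tendsto_of_tendsto' (t0.pow 2) (t1.mul t2) fun s => ?_
  exact Finset.sum_sq_le_sum_mul_sum_of_sq_le_mul s (fun i _ => hw i)
    (fun i _ => mul_nonneg (hw i) (sq_nonneg _)) (fun i _ => le_of_eq (by ring))

lemma summable_mul_of_sq {a b : ℤ → ℝ} (ha : Summable fun m => a m ^ 2)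
    (hb : Summable fun m => b m ^ 2) : Summable fun m => a m * b m := by
  refine Summable.of_norm_bounded (ha.add hb) fun m => ?_
  rw [Real.norm_eq_abs, abs_mul]
  nlinarith [sq_nonneg (|a m| - |b m|), sq_abs (a m), sq_abs (b m), abs_nonneg (a m),
    abs_nonneg (b m), mul_nonneg (abs_nonneg (a m)) (abs_nonneg (b m))]

lemma summable_sqWeight_sub (n : ℤ) : Summable fun m : ℤ => sqWeight (n - m) :=
  (Equiv.subLeft n).summable_iff.2 summable_sqWeight

lemma summable_sqWeight_mul {a : ℤ → ℝ} (ha : Summable fun m => a m ^ 2) (n : ℤ) :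
    Summable fun m => sqWeight (n - m) * a m := by
  refine summable_mul_of_sq ?_ ha
  refine Summable.of_nonneg_of_le (fun _ => sq_nonneg _) (fun m => ?_) (summable_sqWeight_sub n)
  have h1 := sqWeight_pos (n - m)
  have h2 : sqWeight (n - m) ≤ 1 := inv_le_one_of_one_le₀ (by
    have := sq_nonneg ((n - m : ℤ) : ℝ)
    linarith)
  nlinarith

/-- Young's inequality for the convolution with a summable weight. -/
lemma summable_sq_convolution {a : ℤ → ℝ} (ha : Summable fun m => a m ^ 2) :
    Summable fun n => (∑' m, sqWeight (n - m) * a m) ^ 2 := by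
  have h1 : Summable fun p : ℤ × ℤ => sqWeight p.1 * a p.2 ^ 2 :=
    summable_sqWeight.mul_of_nonneg ha (fun j => (sqWeight_pos j).le) (fun m => sq_nonneg _)
  let e : ℤ × ℤ ≃ ℤ × ℤ :=
    { toFun := fun p => (p.1 - p.2, p.2)
      invFun := fun p => (p.1 + p.2, p.2)
      left_inv := fun p => by simp
      right_inv := fun p => by simp }
  have h2 : Summable fun p : ℤ × ℤ => sqWeight (p.1 - p.2) * a p.2 ^ 2 := e.summable_iff.2 h1
  have h3 : Summable fun n => (∑' j, sqWeight j) * ∑' m, sqWeight (n - m) * a m ^ 2 :=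
    h2.prod.mul_left _
  refine Summable.of_nonneg_of_le (fun _ => sq_nonneg _) (fun n => ?_) h3
  have h4 := tsum_mul_sq_le (b := a) (fun m => (sqWeight_pos (n - m)).le)
    (summable_sqWeight_sub n) (h2.prod_factor n) (summable_sqWeight_mul ha n)
  have h5 : ∑' m, sqWeight (n - m) = ∑' j, sqWeight j := (Equiv.subLeft n).tsum_eq sqWeight
  rwa [h5] at h4

/-! ### Unit masses, cutoff functions and the commutator -/

/-- The masses of the half-open unit intervals. -/
noncomputable def unitMass (μ : Measure ℝ) (m : ℤ) : ℝ := μ.real (Ico (m : ℝ) (m + 1))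

lemma unitMass_nonneg (μ : Measure ℝ) (m : ℤ) : 0 ≤ unitMass μ m := measureReal_nonneg

lemma measure_Icc_lt_top_of_ell2 {μ : Measure ℝ} (hμ : ell2MNormSq μ < ∞) (m : ℤ) :
    μ (Icc (m : ℝ) (m + 1)) < ∞ := by
  have h := ENNReal.ne_top_of_tsum_ne_top hμ.ne m
  rw [lt_top_iff_ne_top]
  intro h2
  simp [h2] at h

lemma measure_Ico_lt_top_of_ell2 {μ : Measure ℝ} (hμ : ell2MNormSq μ < ∞) (m : ℤ) :
    μ (Ico (m : ℝ) (m + 1)) < ∞ :=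
  (measure_mono Ico_subset_Icc_self).trans_lt (measure_Icc_lt_top_of_ell2 hμ m)

lemma isLocallyFiniteMeasure_of_ell2 {μ : Measure ℝ} (hμ : ell2MNormSq μ < ∞) :
    IsLocallyFiniteMeasure μ := by
  refine ⟨fun x => ⟨Icc ((⌊x⌋ - 1 : ℤ) : ℝ) ((⌊x⌋ - 1 : ℤ) + 1) ∪ Icc (⌊x⌋ : ℝ) (⌊x⌋ + 1), ?_,
    (measure_union_le _ _).trans_lt (ENNReal.add_lt_top.2 ⟨measure_Icc_lt_top_of_ell2 hμ _,
      measure_Icc_lt_top_of_ell2 hμ _⟩)⟩⟩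
  refine mem_of_superset (Ioo_mem_nhds (a := (⌊x⌋ : ℝ) - 1) (b := ⌊x⌋ + 1)
    (by linarith [Int.floor_le x]) (Int.lt_floor_add_one x)) fun y hy => ?_
  rcases le_total y ⌊x⌋ with h | h
  · left; push_cast; exact ⟨hy.1.le, by linarith⟩
  · right; exact ⟨h, hy.2.le⟩

lemma summable_unitMass_sq {μ : Measure ℝ} (hμ : ell2MNormSq μ < ∞) :
    Summable fun m => unitMass μ m ^ 2 := by
  have h := ENNReal.summable_toReal hμ.ne
  refine Summable.of_nonneg_of_le (fun _ => sq_nonneg _) (fun m => ?_) h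
  rw [ENNReal.toReal_pow]
  refine pow_le_pow_left₀ (unitMass_nonneg μ m) ?_ 2
  exact ENNReal.toReal_mono (measure_Icc_lt_top_of_ell2 hμ m).ne (measure_mono Ico_subset_Icc_self)

/-- A piecewise linear cutoff function around the interval `[n, n + 1]`. -/
noncomputable def cutoff (n : ℤ) (y : ℝ) : ℝ := max 0 (min 1 (4 - 2 * |y - (n + 1 / 2)|))

lemma cutoff_nonneg (n : ℤ) (y : ℝ) : 0 ≤ cutoff n y := le_max_left _ _

lemma cutoff_le_one (n : ℤ) (y : ℝ) : cutoff n y ≤ 1 := max_le zero_le_one (min_le_left _ _)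

lemma continuous_cutoff (n : ℤ) : Continuous (cutoff n) := by unfold cutoff; fun_prop

lemma cutoff_eq_one {n : ℤ} {y : ℝ} (h1 : n - 1 ≤ y) (h2 : y ≤ n + 2) : cutoff n y = 1 := by
  have h : |y - (n + 1 / 2)| ≤ 3 / 2 := by rw [abs_le]; constructor <;> linarith
  unfold cutoff
  rw [min_eq_left (by linarith), max_eq_right zero_le_one]

lemma cutoff_eq_zero {n : ℤ} {y : ℝ} (h : 2 ≤ |y - (n + 1 / 2)|) : cutoff n y = 0 := by
  unfold cutoff
  rw [max_eq_left]
  exact (min_le_right _ _).trans (by linarith)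

lemma abs_cutoff_sub_le (n : ℤ) (x y : ℝ) : |cutoff n x - cutoff n y| ≤ 2 * |x - y| := by
  unfold cutoff
  refine (abs_max_sub_max_le_max _ _ _ _).trans (max_le (by simp) ?_)
  refine (abs_min_sub_min_le_max _ _ _ _).trans (max_le (by simp) ?_)
  have h := abs_abs_sub_abs_le_abs_sub (x - (n + 1 / 2)) (y - (n + 1 / 2))
  have e1 : 4 - 2 * |x - (n + 1 / 2)| - (4 - 2 * |y - (n + 1 / 2)|) =
      -2 * (|x - (n + 1 / 2)| - |y - (n + 1 / 2)|) := by ring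
  have e2 : x - (n + 1 / 2) - (y - (n + 1 / 2)) = x - y := by ring
  rw [e1, abs_mul]
  rw [e2] at h
  norm_num
  exact h

/-- The kernel of the commutator of the Hilbert transform with the cutoff function. -/
noncomputable def commKernel (n : ℤ) (k y : ℝ) : ℝ := (cutoff n y - cutoff n k) * (k - y)⁻¹

lemma measurable_commKernel (n : ℤ) (k : ℝ) : Measurable (commKernel n k) :=
  ((continuous_cutoff n).measurable.sub_const _).mul (measurable_const.sub measurable_id).inv

lemma abs_commKernel_le_two (n : ℤ) (k y : ℝ) : |commKernel n k y| ≤ 2 := by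
  unfold commKernel
  rcases eq_or_ne k y with h | h
  · simp [h]
  · have h0 : 0 < |k - y| := abs_pos.2 (sub_ne_zero.2 h)
    rw [abs_mul, abs_inv, ← div_eq_mul_inv, div_le_iff₀ h0, abs_sub_comm k y]
    exact abs_cutoff_sub_le n y k

/-- The numbers k - y and n - m differ by at most 4, which is at most 4/7 of |n - m| once |n - m| ≥
7; so |k - y| ≥ (3/7)|n - m|. At this distance the cutoff vanishes at y. -/
lemma far_bounds {n m : ℤ} {k y : ℝ} (hk1 : n - 3 ≤ k) (hk2 : k ≤ n + 4) (hy1 : (m : ℝ) ≤ y)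
    (hy2 : y < m + 1) (hm : 7 ≤ |n - m|) :
    commKernel n k y = -cutoff n k * (k - y)⁻¹ ∧ |(k - y)⁻¹| ≤ 3 * |(n : ℝ) - m|⁻¹ ∧
      |(k - y)⁻¹ - ((n : ℝ) - m)⁻¹| ≤ 10 * (((n : ℝ) - m) ^ 2)⁻¹ := by
  have hm' : (7 : ℝ) ≤ |(n : ℝ) - m| := by exact_mod_cast hm
  set d := (n : ℝ) - m with hd
  have hdiff : |d - (k - y)| ≤ 4 := by rw [abs_le]; constructor <;> linarith
  have hky : 3 / 7 * |d| ≤ |k - y| := by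
    have := abs_sub_abs_le_abs_sub d (k - y)
    linarith
  have hky0 : 0 < |k - y| := by linarith
  have hd0 : d ≠ 0 := by intro h; rw [h, abs_zero] at hm'; linarith
  have hkyne : k - y ≠ 0 := abs_pos.1 hky0
  refine ⟨?_, ?_, ?_⟩
  · unfold commKernel
    rw [cutoff_eq_zero, zero_sub]
    have h2 : |d| ≤ |y - (n + 1 / 2)| + 3 / 2 := by
      have : d = -(y - (n + 1 / 2)) + (y - m - 1 / 2) := by rw [hd]; ring
      calc |d| ≤ |-(y - (n + 1 / 2))| + |y - m - 1 / 2| := by rw [this]; exact abs_add_le _ _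
        _ ≤ _ := by
          rw [abs_neg]
          gcongr
          rw [abs_le]; constructor <;> linarith
    linarith
  · rw [abs_inv]
    calc |k - y|⁻¹ ≤ (3 / 7 * |d|)⁻¹ := inv_anti₀ (by linarith) hky
      _ = 7 / 3 * |d|⁻¹ := by rw [mul_inv]; norm_num
      _ ≤ 3 * |d|⁻¹ := by gcongr; norm_num
  · have : (k - y)⁻¹ - d⁻¹ = (d - (k - y)) * ((k - y) * d)⁻¹ := by field_simp
    rw [this, abs_mul, abs_inv, abs_mul, ← sq_abs d]
    calc _ ≤ 4 * (3 / 7 * |d| * |d|)⁻¹ := by gcongr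
      _ = 28 / 3 * (|d| ^ 2)⁻¹ := by rw [mul_assoc, mul_inv, ← sq]; ring
      _ ≤ _ := by gcongr; norm_num

lemma abs_commKernel_le {n m : ℤ} {k y : ℝ} (hk1 : n - 3 ≤ k) (hk2 : k ≤ n + 4)
    (hy1 : (m : ℝ) ≤ y) (hy2 : y < m + 1) :
    |commKernel n k y| ≤ 20 * (1 + |(n : ℝ) - m|)⁻¹ := by
  have h0 := abs_nonneg ((n : ℝ) - m)
  rcases lt_or_ge |n - m| 7 with h | h
  · refine (abs_commKernel_le_two n k y).trans ?_
    have h' : |(n : ℝ) - m| ≤ 6 := by exact_mod_cast (by omega : |n - m| ≤ 6)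
    rw [← div_eq_mul_inv, le_div_iff₀ (by linarith)]
    linarith
  · obtain ⟨h1, h2, -⟩ := far_bounds hk1 hk2 hy1 hy2 h
    have h' : (7 : ℝ) ≤ |(n : ℝ) - m| := by exact_mod_cast h
    rw [h1, abs_mul, abs_neg, abs_of_nonneg (cutoff_nonneg _ _)]
    calc _ ≤ 1 * (3 * |(n : ℝ) - m|⁻¹) := by gcongr; exact cutoff_le_one _ _
      _ ≤ _ := by
        rw [one_mul, ← div_eq_mul_inv, ← div_eq_mul_inv, div_le_div_iff₀ (by linarith)
          (by linarith)]
        linarith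

lemma iUnion_Ico_int : ⋃ m : ℤ, Ico (m : ℝ) (m + 1) = univ := iUnion_Ico_intCast ℝ

lemma pairwise_disjoint_Ico_int :
    Pairwise (Function.onFun Disjoint fun m : ℤ => Ico (m : ℝ) (m + 1)) :=
  pairwise_disjoint_Ico_intCast ℝ

/-- The Lipschitz cutoff removes the singularity at k. At infinity the kernel decays like 1/|n - m|,
which is square summable, as are the unit masses. -/
lemma integrable_commKernel {μ : Measure ℝ} (hμ : ell2MNormSq μ < ∞) {n : ℤ} {k : ℝ}
    (hk1 : n - 3 ≤ k) (hk2 : k ≤ n + 4) : Integrable (commKernel n k) μ := by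
  have ha := summable_unitMass_sq hμ
  rw [← integrableOn_univ, ← iUnion_Ico_int]
  have hint : ∀ m : ℤ, IntegrableOn (commKernel n k) (Ico (m : ℝ) (m + 1)) μ := fun m => by
    refine Measure.integrableOn_of_bounded (M := 2) (measure_Ico_lt_top_of_ell2 hμ m).ne
      (measurable_commKernel n k).aestronglyMeasurable
      (Eventually.of_forall fun y => abs_commKernel_le_two n k y)
  refine integrableOn_iUnion_of_summable_integral_norm hint ?_
  have hb : Summable fun m : ℤ => ((1 + |(n : ℝ) - m|)⁻¹) ^ 2 := by
    refine Summable.of_nonneg_of_le (fun _ => sq_nonneg _) (fun m => ?_) (summable_sqWeight_sub n)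
    unfold sqWeight
    rw [inv_pow]
    refine inv_anti₀ (by positivity) ?_
    push_cast
    nlinarith [abs_nonneg ((n : ℝ) - m), sq_abs ((n : ℝ) - m)]
  refine Summable.of_nonneg_of_le (fun m => integral_nonneg fun _ => norm_nonneg _) (fun m => ?_)
    ((summable_mul_of_sq ha hb).mul_left 20)
  calc ∫ y in Ico (m : ℝ) (m + 1), ‖commKernel n k y‖ ∂μ ≤
      ∫ y in Ico (m : ℝ) (m + 1), 20 * (1 + |(n : ℝ) - m|)⁻¹ ∂μ := by
        refine setIntegral_mono_on (hint m).norm (integrableOn_const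
          (measure_Ico_lt_top_of_ell2 hμ m).ne) measurableSet_Ico fun y hy => ?_
        exact abs_commKernel_le hk1 hk2 hy.1 hy.2
    _ = _ := by
        rw [setIntegral_const, smul_eq_mul]
        unfold unitMass
        ring

/-- A bound for the commutator of the Hilbert transform with the cutoff function around
`[n, n + 1]`. -/
noncomputable def commBound (μ : Measure ℝ) (n : ℤ) : ℝ :=
  |∑' m : ℤ, unitMass μ m * ((n : ℝ) - m)⁻¹| + 111 * ∑' m : ℤ, sqWeight (n - m) * unitMass μ m

lemma convolution_unitMass_nonneg (μ : Measure ℝ) (n : ℤ) :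
    0 ≤ ∑' m : ℤ, sqWeight (n - m) * unitMass μ m :=
  tsum_nonneg fun m => mul_nonneg (sqWeight_pos _).le (unitMass_nonneg μ m)

lemma commBound_nonneg (μ : Measure ℝ) (n : ℤ) : 0 ≤ commBound μ n :=
  add_nonneg (abs_nonneg _) (mul_nonneg (by norm_num) (convolution_unitMass_nonneg μ n))

lemma summable_commBound_sq {μ : Measure ℝ} (hμ : ell2MNormSq μ < ∞) :
    Summable fun n => commBound μ n ^ 2 := by
  have ha := summable_unitMass_sq hμ
  refine Summable.of_nonneg_of_le (fun _ => sq_nonneg _) (fun n => ?_)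
    (((summable_discreteHilbert ha).2.mul_left 2).add
      ((summable_sq_convolution ha).mul_left (2 * 111 ^ 2)))
  unfold commBound
  refine (add_sq_le).trans (le_of_eq ?_)
  rw [sq_abs]; ring

/-- With a_m = `unitMass μ m`, absolute values would leave a convolution with 1/|j|, which is
unbounded on ℓ². Replacing 1/(k - y) by 1/(n - m) on each far unit interval costs only O((n - m)⁻²),
and the main term becomes χ(k) times the discrete Hilbert transform of (a_m), where cancellation is
kept. -/
lemma abs_integral_commKernel_le {μ : Measure ℝ} (hμ : ell2MNormSq μ < ∞) {n : ℤ} {k : ℝ}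
    (hk1 : n - 3 ≤ k) (hk2 : k ≤ n + 4) : |∫ y, commKernel n k y ∂μ| ≤ commBound μ n := by
  have ha := summable_unitMass_sq hμ
  have hi := integrable_commKernel hμ hk1 hk2
  have h1 : HasSum (fun m : ℤ => ∫ y in Ico (m : ℝ) (m + 1), commKernel n k y ∂μ)
      (∫ y, commKernel n k y ∂μ) := by
    have := hasSum_integral_iUnion (fun m : ℤ => measurableSet_Ico (a := (m : ℝ)) (b := m + 1))
      pairwise_disjoint_Ico_int (f := commKernel n k) (μ := μ) hi.integrableOn
    rwa [iUnion_Ico_int, setIntegral_univ] at this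
  have h2 := ((summable_discreteHilbert ha).1 n).hasSum.mul_left (cutoff n k)
  have h3 := h1.add h2
  -- The constant comes from |n - m| ≤ 6: there the kernels sum to at most 2 + 1 = 3, and 3·(1 + 6²)
  -- = 111. Far intervals need less.
  have hterm : ∀ m : ℤ, ‖(∫ y in Ico (m : ℝ) (m + 1), commKernel n k y ∂μ) +
      cutoff n k * (unitMass μ m * ((n : ℝ) - m)⁻¹)‖ ≤ 111 * (sqWeight (n - m) * unitMass μ m) := by
    intro m
    have hfin := measure_Ico_lt_top_of_ell2 hμ m
    have ham := unitMass_nonneg μ m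
    have hc0 := cutoff_nonneg n k
    have hc1 := cutoff_le_one n k
    have e : (∫ y in Ico (m : ℝ) (m + 1), commKernel n k y ∂μ) +
        cutoff n k * (unitMass μ m * ((n : ℝ) - m)⁻¹) =
        ∫ y in Ico (m : ℝ) (m + 1), (commKernel n k y + cutoff n k * ((n : ℝ) - m)⁻¹) ∂μ := by
      rw [integral_add hi.integrableOn (integrableOn_const hfin.ne), setIntegral_const, smul_eq_mul]
      unfold unitMass
      ring
    rw [e]
    have hw : 111 * (sqWeight (n - m) * unitMass μ m) =
        111 * sqWeight (n - m) * μ.real (Ico (m : ℝ) (m + 1)) := by unfold unitMass; ring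
    rw [hw]
    refine norm_setIntegral_le_of_norm_le_const hfin fun y hy => ?_
    have hsw : sqWeight (n - m) = (1 + ((n : ℝ) - m) ^ 2)⁻¹ := by unfold sqWeight; push_cast; rfl
    rw [Real.norm_eq_abs, hsw, ← sq_abs ((n : ℝ) - m)]
    rcases lt_or_ge |n - m| 7 with h | h
    · have h' : |(n : ℝ) - m| ≤ 6 := by exact_mod_cast (by omega : |n - m| ≤ 6)
      have h4 : |((n : ℝ) - m)⁻¹| ≤ 1 := by
        rcases eq_or_ne n m with rfl | hne
        · simp
        · rw [abs_inv]
          refine inv_le_one_of_one_le₀ ?_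
          exact_mod_cast Int.one_le_abs (sub_ne_zero.2 hne)
      have h5 : |commKernel n k y + cutoff n k * ((n : ℝ) - m)⁻¹| ≤ 3 := by
        refine (abs_add_le _ _).trans ?_
        rw [abs_mul, abs_of_nonneg hc0]
        have := abs_commKernel_le_two n k y
        nlinarith [abs_nonneg ((n : ℝ) - m)⁻¹]
      refine h5.trans ?_
      rw [← div_eq_mul_inv, le_div_iff₀ (by positivity)]
      nlinarith [abs_nonneg ((n : ℝ) - m)]
    · obtain ⟨f1, -, f3⟩ := far_bounds hk1 hk2 hy.1 hy.2 h
      have h' : (7 : ℝ) ≤ |(n : ℝ) - m| := by exact_mod_cast h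
      have e2 : -cutoff n k * (k - y)⁻¹ + cutoff n k * ((n : ℝ) - m)⁻¹ =
          -cutoff n k * ((k - y)⁻¹ - ((n : ℝ) - m)⁻¹) := by ring
      rw [f1, e2, abs_mul, abs_neg, abs_of_nonneg hc0]
      calc _ ≤ 1 * (10 * (((n : ℝ) - m) ^ 2)⁻¹) := by gcongr
        _ ≤ _ := by
          rw [one_mul, ← div_eq_mul_inv, ← div_eq_mul_inv, sq_abs, ← sq_abs ((n : ℝ) - m),
            div_le_div_iff₀ (by positivity) (by positivity)]
          nlinarith
  have h6 := tsum_of_norm_bounded ((summable_sqWeight_mul ha n).hasSum.mul_left 111) hterm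
  rw [h3.tsum_eq, Real.norm_eq_abs] at h6
  set D := ∫ y, commKernel n k y ∂μ
  set S := ∑' m : ℤ, unitMass μ m * ((n : ℝ) - m)⁻¹ with hS
  have h7 : |D| ≤ |D + cutoff n k * S| + |cutoff n k * S| := by
    have := abs_sub (D + cutoff n k * S) (cutoff n k * S)
    rwa [add_sub_cancel_right] at this
  have h8 : |cutoff n k * S| ≤ |S| := by
    rw [abs_mul, abs_of_nonneg (cutoff_nonneg n k)]
    exact mul_le_of_le_one_left (abs_nonneg _) (cutoff_le_one n k)
  unfold commBound
  linarith

/-! ### Localized measures and existence of the Hilbert transform -/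

/-- The size `1 + |n|` of the interval `[n, n + 1]` in the weighted integrals. -/
noncomputable def intScale (n : ℤ) : ℝ := 1 + |(n : ℝ)|

lemma one_le_intScale (n : ℤ) : 1 ≤ intScale n := le_add_of_nonneg_right (abs_nonneg _)

lemma intScale_pos (n : ℤ) : 0 < intScale n := zero_lt_one.trans_le (one_le_intScale n)

/-- The rescaled localization of a measure to the neighborhood of `[n, n + 1]`. -/
noncomputable def localMeasure (μ : Measure ℝ) (n : ℤ) : Measure ℝ :=
  μ.withDensity fun y => ENNReal.ofReal (cutoff n y / intScale n)

lemma measurable_localDensity (n : ℤ) :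
    Measurable fun y => ENNReal.ofReal (cutoff n y / intScale n) :=
  ((continuous_cutoff n).measurable.div_const _).ennreal_ofReal

lemma localMeasure_compl_closedBall (μ : Measure ℝ) (n : ℤ) :
    localMeasure μ n (Metric.closedBall ((n : ℝ) + 1 / 2) 2)ᶜ = 0 := by
  unfold localMeasure
  rw [withDensity_apply _ Metric.isClosed_closedBall.measurableSet.compl]
  refine (setLIntegral_congr_fun Metric.isClosed_closedBall.measurableSet.compl
    (g := fun _ => 0) fun y hy => ?_).trans (by simp)
  have h : 2 < |y - (n + 1 / 2)| := by
    simpa [Real.dist_eq] using hy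
  simp [cutoff_eq_zero h.le]

lemma integrable_cutoff {μ : Measure ℝ} (hμ : ell2MNormSq μ < ∞) (n : ℤ) :
    Integrable (cutoff n) μ := by
  have := isLocallyFiniteMeasure_of_ell2 hμ
  refine (continuous_cutoff n).integrable_of_hasCompactSupport
    (HasCompactSupport.intro (isCompact_closedBall ((n : ℝ) + 1 / 2) 2) fun y hy => ?_)
  have h : 2 < |y - (n + 1 / 2)| := by simpa [Real.dist_eq] using hy
  exact cutoff_eq_zero h.le

/-- The cutoff lives on the five unit intervals with |n - m| ≤ 2, where 5/(1 + (n - m)²) ≥ 1. The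
convolution form is chosen because it is already known to lie in ℓ². -/
lemma localMeasure_univ_le {μ : Measure ℝ} (hμ : ell2MNormSq μ < ∞) (n : ℤ) :
    localMeasure μ n univ ≤
      ENNReal.ofReal (5 * (∑' m : ℤ, sqWeight (n - m) * unitMass μ m) / intScale n) := by
  have ha := summable_unitMass_sq hμ
  have h1 : Integrable (fun y => cutoff n y / intScale n) μ := (integrable_cutoff hμ n).div_const _
  unfold localMeasure
  rw [withDensity_apply _ MeasurableSet.univ, Measure.restrict_univ,
    ← ofReal_integral_eq_lintegral_ofReal h1 (Eventually.of_forall fun y =>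
      div_nonneg (cutoff_nonneg n y) (intScale_pos n).le), integral_div]
  refine ENNReal.ofReal_le_ofReal ?_
  gcongr
  · exact (intScale_pos n).le
  have h2 : ∫ y, cutoff n y ∂μ ≤ ∑ m ∈ Finset.Icc (n - 2) (n + 2), unitMass μ m := by
    have h3 : ∀ y, cutoff n y ≤ ∑ m ∈ Finset.Icc (n - 2) (n + 2),
        (Ico (m : ℝ) (m + 1)).indicator 1 y := by
      intro y
      by_cases hy : |y - (n + 1 / 2)| < 2
      · rw [abs_lt] at hy
        have hm : ⌊y⌋ ∈ Finset.Icc (n - 2) (n + 2) := by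
          rw [Finset.mem_Icc, Int.le_floor, ← Int.lt_add_one_iff, Int.floor_lt]
          push_cast
          constructor <;> linarith
        calc cutoff n y ≤ 1 := cutoff_le_one n y
          _ = (Ico (⌊y⌋ : ℝ) (⌊y⌋ + 1)).indicator 1 y := by
            have hy : y ∈ Ico (⌊y⌋ : ℝ) (⌊y⌋ + 1) := ⟨Int.floor_le y, Int.lt_floor_add_one y⟩
            rw [indicator_of_mem hy, Pi.one_apply]
          _ ≤ _ := Finset.single_le_sum (f := fun m : ℤ => (Ico (m : ℝ) (m + 1)).indicator 1 y)
            (fun m _ => indicator_nonneg (fun _ _ => zero_le_one) _) hm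
      · rw [cutoff_eq_zero (not_lt.1 hy)]
        exact Finset.sum_nonneg fun m _ => indicator_nonneg (fun _ _ => zero_le_one) _
    have h4 : ∀ m : ℤ, Integrable ((Ico (m : ℝ) (m + 1)).indicator (1 : ℝ → ℝ)) μ := fun m =>
      (integrable_indicator_iff measurableSet_Ico).2
        (integrableOn_const (measure_Ico_lt_top_of_ell2 hμ m).ne)
    refine (integral_mono (integrable_cutoff hμ n) (integrable_finsetSum _ fun m _ => h4 m)
      h3).trans (le_of_eq ?_)
    rw [integral_finsetSum _ fun m _ => h4 m]
    refine Finset.sum_congr rfl fun m _ => ?_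
    rw [integral_indicator_one measurableSet_Ico]; rfl
  refine h2.trans ?_
  rw [← tsum_mul_left]
  refine (Finset.sum_le_sum fun m hm => ?_).trans
    (((summable_sqWeight_mul ha n).mul_left 5).sum_le_tsum _ fun m _ =>
      mul_nonneg (by norm_num) (mul_nonneg (sqWeight_pos _).le (unitMass_nonneg μ m)))
  rw [Finset.mem_Icc] at hm
  have h5 : (((n - m : ℤ) : ℝ)) ^ 2 ≤ 4 := by
    have : (n - m) ^ 2 ≤ 4 := by nlinarith
    exact_mod_cast this
  have h6 : 1 ≤ 5 * sqWeight (n - m) := by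
    unfold sqWeight
    rw [← div_eq_mul_inv, le_div_iff₀ (by positivity)]
    linarith
  rw [← mul_assoc]
  exact le_mul_of_one_le_left (unitMass_nonneg μ m) h6

lemma isFiniteMeasure_localMeasure {μ : Measure ℝ} (hμ : ell2MNormSq μ < ∞) (n : ℤ) :
    IsFiniteMeasure (localMeasure μ n) :=
  ⟨(localMeasure_univ_le hμ n).trans_lt ENNReal.ofReal_lt_top⟩

lemma ae_abs_le_localMeasure (μ : Measure ℝ) (n : ℤ) :
    ∀ᵐ y ∂localMeasure μ n, |y| ≤ |(n : ℝ) + 1 / 2| + 2 := by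
  filter_upwards [compl_mem_ae_iff.2 (localMeasure_compl_closedBall μ n)] with y hy
  have h : |y - ((n : ℝ) + 1 / 2)| ≤ 2 := by simpa [Real.dist_eq] using hy
  have := abs_sub_abs_le_abs_sub y ((n : ℝ) + 1 / 2)
  linarith

lemma measurableSet_lt_abs_sub (ε k : ℝ) : MeasurableSet {y : ℝ | ε < |k - y|} :=
  measurableSet_lt measurable_const (by fun_prop)

lemma integrableOn_cutoff_mul {μ : Measure ℝ} (hμ : ell2MNormSq μ < ∞) (n : ℤ) {ε k : ℝ}
    (hε : 0 < ε) : IntegrableOn (fun y => cutoff n y * (k - y)⁻¹) {y | ε < |k - y|} μ := by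
  refine ((integrable_cutoff hμ n).integrableOn.mul_const ε⁻¹).mono'
    ((continuous_cutoff n).measurable.mul
      (measurable_const.sub measurable_id).inv).aestronglyMeasurable ?_
  refine ae_restrict_of_forall_mem (measurableSet_lt_abs_sub ε k) fun y hy => ?_
  rw [Real.norm_eq_abs, abs_mul, abs_of_nonneg (cutoff_nonneg n y), abs_inv]
  exact mul_le_mul_of_nonneg_left (inv_anti₀ hε (le_of_lt hy)) (cutoff_nonneg n y)

/-- For n = ⌊k⌋ the cutoff is 1 at k, so 1/(k - y) is a compactly supported term minus the
integrable commutator kernel. -/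
lemma integrableOn_inv_sub_of_ell2 {μ : Measure ℝ} (hμ : ell2MNormSq μ < ∞) (k : ℝ) {ε : ℝ}
    (hε : 0 < ε) : IntegrableOn (fun y => (k - y)⁻¹) {y | ε < |k - y|} μ := by
  have h1 := Int.floor_le k
  have h2 := Int.lt_floor_add_one k
  have h3 := (integrableOn_cutoff_mul hμ ⌊k⌋ (k := k) hε).sub
    (integrable_commKernel hμ (n := ⌊k⌋) (k := k) (by linarith) (by linarith)).integrableOn
  refine h3.congr (Eventually.of_forall fun y => ?_)
  simp only [commKernel, Pi.sub_apply, cutoff_eq_one (n := ⌊k⌋) (y := k) (by linarith)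
    (by linarith)]
  ring

lemma intScale_mul_truncHilbert_sub {μ : Measure ℝ} (hμ : ell2MNormSq μ < ∞) {n : ℤ} {k ε : ℝ}
    (hε : 0 < ε) :
    intScale n * truncHilbert (localMeasure μ n) ε k - cutoff n k * truncHilbert μ ε k =
      Real.pi⁻¹ * ∫ y in {y : ℝ | ε < |k - y|}, commKernel n k y ∂μ := by
  have hT := (intScale_pos n).ne'
  have h1 : ∫ y in {y : ℝ | ε < |k - y|}, (k - y)⁻¹ ∂(localMeasure μ n) =
      ∫ y in {y : ℝ | ε < |k - y|}, (cutoff n y / intScale n) * (k - y)⁻¹ ∂μ := by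
    unfold localMeasure
    rw [restrict_withDensity (measurableSet_lt_abs_sub ε k),
      integral_withDensity_eq_integral_toReal_smul (measurable_localDensity n)
        (Eventually.of_forall fun _ => ENNReal.ofReal_lt_top)]
    refine integral_congr_ae (Eventually.of_forall fun y => ?_)
    simp only [smul_eq_mul]
    rw [ENNReal.toReal_ofReal (div_nonneg (cutoff_nonneg n y) (intScale_pos n).le)]
  have h2 : ∫ y in {y : ℝ | ε < |k - y|}, (cutoff n y / intScale n) * (k - y)⁻¹ ∂μ =
      (intScale n)⁻¹ * ∫ y in {y : ℝ | ε < |k - y|}, cutoff n y * (k - y)⁻¹ ∂μ := by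
    rw [← integral_const_mul]
    congr 1 with y
    ring
  have h3 : ∫ y in {y : ℝ | ε < |k - y|}, commKernel n k y ∂μ =
      (∫ y in {y : ℝ | ε < |k - y|}, cutoff n y * (k - y)⁻¹ ∂μ) -
        cutoff n k * ∫ y in {y : ℝ | ε < |k - y|}, (k - y)⁻¹ ∂μ := by
    rw [← integral_const_mul, ← integral_sub (integrableOn_cutoff_mul hμ n hε)
      ((integrableOn_inv_sub_of_ell2 hμ k hε).const_mul _)]
    congr 1 with y
    unfold commKernel
    ring
  unfold truncHilbert
  rw [h1, h2, h3]
  field_simp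

lemma tendsto_setIntegral_commKernel {μ : Measure ℝ} (hμ : ell2MNormSq μ < ∞) {n : ℤ} {k : ℝ}
    (hk1 : n - 3 ≤ k) (hk2 : k ≤ n + 4) :
    Tendsto (fun ε => ∫ y in {y : ℝ | ε < |k - y|}, commKernel n k y ∂μ) (𝓝[>] 0)
      (𝓝 (∫ y, commKernel n k y ∂μ)) := by
  have hi := integrable_commKernel hμ hk1 hk2
  simp_rw [← integral_indicator (measurableSet_lt_abs_sub _ k)]
  refine tendsto_integral_filter_of_dominated_convergence (fun y => ‖commKernel n k y‖)
    (Eventually.of_forall fun ε => hi.aestronglyMeasurable.indicator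
      (measurableSet_lt_abs_sub ε k))
    (Eventually.of_forall fun ε => Eventually.of_forall fun y => norm_indicator_le_norm_self _ _)
    hi.norm (Eventually.of_forall fun y => ?_)
  rcases eq_or_ne k y with rfl | h
  · simp [indicator_apply, commKernel]
  · refine tendsto_const_nhds.congr' ?_
    filter_upwards [Ioo_mem_nhdsGT (abs_pos.2 (sub_ne_zero.2 h))] with ε hε
    rw [indicator_of_mem]
    exact hε.2

lemma ae_tendsto_localMeasure {μ : Measure ℝ} (hμ : ell2MNormSq μ < ∞) (n : ℤ) :
    ∀ᵐ k : ℝ, Tendsto (fun ε => truncHilbert (localMeasure μ n) ε k) (𝓝[>] 0)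
      (𝓝 (hilbertTransform (localMeasure μ n) k)) := by
  have := isFiniteMeasure_localMeasure hμ n
  filter_upwards [ae_tendsto_hilbertTransform (ae_abs_le_localMeasure μ n)] with k hk
  exact hk.1

/-- With n = ⌊k⌋ the truncations for μ are those of the rescaled local measure minus commutator
integrals, and the latter converge at every k. Only the local measures, countably many, contribute
null sets. -/
lemma ae_hasHilbertTransformAt {μ : Measure ℝ} (hμ : ell2MNormSq μ < ∞) :
    ∀ᵐ k : ℝ, HasHilbertTransformAt μ k (hilbertTransform μ k) := by
  filter_upwards [ae_all_iff.2 fun n => ae_tendsto_localMeasure hμ n] with k hk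
  refine ⟨fun ε hε => integrableOn_inv_sub_of_ell2 hμ k hε, tendsto_nhds_limUnder ?_⟩
  have h1 := Int.floor_le k
  have h2 := Int.lt_floor_add_one k
  refine ⟨_, (((hk ⌊k⌋).const_mul (intScale ⌊k⌋)).sub ((tendsto_setIntegral_commKernel hμ
    (n := ⌊k⌋) (k := k) (by linarith) (by linarith)).const_mul Real.pi⁻¹)).congr' ?_⟩
  filter_upwards [self_mem_nhdsWithin] with ε hε
  rw [← intScale_mul_truncHilbert_sub hμ hε, cutoff_eq_one (n := ⌊k⌋) (y := k) (by linarith)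
    (by linarith)]
  ring

lemma ae_abs_hilbertTransform_localMeasure_sub_le {μ : Measure ℝ} (hμ : ell2MNormSq μ < ∞)
    (n : ℤ) : ∀ᵐ k : ℝ, n - 3 ≤ k → k ≤ n + 4 →
      |intScale n * hilbertTransform (localMeasure μ n) k - cutoff n k * hilbertTransform μ k| ≤
        commBound μ n := by
  filter_upwards [ae_tendsto_localMeasure hμ n, ae_hasHilbertTransformAt hμ] with k h1 h2 hk1 hk2
  have h3 := (h1.const_mul (intScale n)).sub (h2.2.const_mul (cutoff n k))
  have h4 : Tendsto (fun ε => intScale n * truncHilbert (localMeasure μ n) ε k -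
      cutoff n k * truncHilbert μ ε k) (𝓝[>] 0) (𝓝 (Real.pi⁻¹ * ∫ y, commKernel n k y ∂μ)) := by
    refine ((tendsto_setIntegral_commKernel hμ hk1 hk2).const_mul Real.pi⁻¹).congr' ?_
    filter_upwards [self_mem_nhdsWithin] with ε hε
    rw [intScale_mul_truncHilbert_sub hμ hε]
  rw [tendsto_nhds_unique h3 h4, abs_mul, abs_of_pos (inv_pos.2 Real.pi_pos)]
  refine (mul_le_of_le_one_left (abs_nonneg _) (inv_le_one_of_one_le₀ ?_)).trans
    (abs_integral_commKernel_le hμ hk1 hk2)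
  linarith [Real.pi_gt_three]

/-! ### Weighted logarithmic integrals as sums over unit intervals -/

/-- The discretized form of the weighted logarithmic integrals. -/
noncomputable def logEnergy (v : ℝ → ℝ≥0∞) (n : ℤ) : ℝ≥0∞ :=
  ENNReal.ofReal (intScale n ^ 2) *
    ∫⁻ k in Ico (n : ℝ) (n + 1), logOneAdd (v k ^ 2 / ENNReal.ofReal (intScale n ^ 2))

lemma logEnergy_eq (v : ℝ → ℝ≥0∞) (n : ℤ) : logEnergy v n = ∫⁻ k in Ico (n : ℝ) (n + 1),
    ENNReal.ofReal (intScale n ^ 2) * logOneAdd (v k ^ 2 / ENNReal.ofReal (intScale n ^ 2)) :=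
  (lintegral_const_mul' _ _ ENNReal.ofReal_ne_top).symm

lemma lintegral_eq_tsum_Ico_int (f : ℝ → ℝ≥0∞) :
    ∫⁻ k, f k = ∑' n : ℤ, ∫⁻ k in Ico (n : ℝ) (n + 1), f k := by
  rw [← lintegral_iUnion (fun _ => measurableSet_Ico) pairwise_disjoint_Ico_int, iUnion_Ico_int,
    Measure.restrict_univ]

lemma div_ofReal_le_mul {v : ℝ≥0∞} {c x y : ℝ} (hx : 0 < x) (hy : 0 < y) (hc : 0 ≤ c)
    (h : y ≤ c * x) : v / ENNReal.ofReal x ≤ ENNReal.ofReal c * (v / ENNReal.ofReal y) := by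
  rw [div_eq_mul_inv, div_eq_mul_inv, ← ENNReal.ofReal_inv_of_pos hx,
    ← ENNReal.ofReal_inv_of_pos hy, mul_left_comm, ← ENNReal.ofReal_mul hc]
  gcongr
  rw [← div_eq_mul_inv, le_div_iff₀ hy, inv_mul_le_iff₀ hx]
  linarith

lemma logOneAdd_div_ofReal_le {v : ℝ≥0∞} {c x y : ℝ} (hx : 0 < x) (hy : 0 < y) (hc : 1 ≤ c)
    (h : y ≤ c * x) : logOneAdd (v / ENNReal.ofReal x) ≤
      ENNReal.ofReal c * logOneAdd (v / ENNReal.ofReal y) :=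
  (logOneAdd_mono (div_ofReal_le_mul hx hy (zero_le_one.trans hc) h)).trans
    (logOneAdd_mul_le hc _)

lemma intScale_bounds {n : ℤ} {k : ℝ} (h1 : n ≤ k) (h2 : k < n + 1) :
    k ^ 2 ≤ intScale n ^ 2 ∧ intScale n ^ 2 ≤ 5 * (1 + k ^ 2) := by
  have hk : |k| ≤ intScale n := by
    unfold intScale
    have := abs_add_le (n : ℝ) (k - n)
    rw [add_sub_cancel] at this
    have h3 : |k - n| ≤ 1 := by rw [abs_le]; constructor <;> linarith
    linarith
  have hn : intScale n ≤ |k| + 2 := by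
    unfold intScale
    have := abs_add_le k (n - k)
    rw [add_sub_cancel] at this
    have h3 : |n - k| ≤ 1 := by rw [abs_le]; constructor <;> linarith
    linarith
  have h0 := intScale_pos n
  have h4 := abs_nonneg k
  rw [← sq_abs k]
  constructor
  · gcongr
  · nlinarith [sq_nonneg (2 * |k| - 1)]

lemma tsum_logEnergy_lt_top {v : ℝ → ℝ≥0∞}
    (h : ∫⁻ k : ℝ, logOneAdd (v k ^ 2 / ENNReal.ofReal (k ^ 2)) * ENNReal.ofReal (1 + k ^ 2) < ∞) :
    ∑' n, logEnergy v n < ∞ := by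
  have h1 : ∑' n, logEnergy v n ≤ ∑' n : ℤ, ENNReal.ofReal 5 * ∫⁻ k in Ico (n : ℝ) (n + 1),
      logOneAdd (v k ^ 2 / ENNReal.ofReal (k ^ 2)) * ENNReal.ofReal (1 + k ^ 2) := by
    refine ENNReal.tsum_le_tsum fun n => ?_
    rw [logEnergy_eq, ← lintegral_const_mul' _ _ ENNReal.ofReal_ne_top]
    refine setLIntegral_mono' measurableSet_Ico fun k hk => ?_
    obtain ⟨h2, h3⟩ := intScale_bounds hk.1 hk.2
    rw [mul_left_comm, ← ENNReal.ofReal_mul (by norm_num), mul_comm (logOneAdd _)]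
    gcongr
    exact logOneAdd_mono (ENNReal.div_le_div_left (ENNReal.ofReal_le_ofReal h2) _)
  refine h1.trans_lt ?_
  rw [ENNReal.tsum_mul_left, ← lintegral_eq_tsum_Ico_int]
  exact ENNReal.mul_lt_top ENNReal.ofReal_lt_top h

lemma logOneAdd_mul_le_add (s t : ℝ≥0∞) : logOneAdd (s * t) ≤ logOneAdd s + logOneAdd t := by
  unfold logOneAdd
  have h1 : (1 : ℝ≥0∞) ≤ (1 + s) := le_self_add
  have h2 : (1 : ℝ≥0∞) ≤ (1 + t) := le_self_add
  rw [← EReal.toENNReal_add (by simp)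
    (by simp), ← ENNReal.log_mul_add]
  refine EReal.toENNReal_le_toENNReal (ENNReal.log_monotone ?_)
  calc 1 + s * t ≤ 1 + s * t + (s + t) := le_self_add
    _ = (1 + s) * (1 + t) := by ring

/-- Near the origin k² is not comparable to (1 + |n|)²; the discrepancy is a logarithmic
singularity, which is integrable. -/
lemma lintegral_log_inv_sq_lt_top :
    ∫⁻ k in Ioo (-1 : ℝ) 1, logOneAdd (ENNReal.ofReal (10 / k ^ 2)) < ∞ := by
  have h1 : IntegrableOn (fun k : ℝ => Real.log 11 - 2 * Real.log k) (Ioo (-1) 1) := by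
    have h2 : IntervalIntegrable Real.log volume (-1) 1 := intervalIntegral.intervalIntegrable_log'
    rw [intervalIntegrable_iff_integrableOn_Ioo_of_le (by norm_num)] at h2
    exact (integrableOn_const (by simp)).sub (h2.const_mul 2)
  refine lt_of_le_of_lt ?_ h1.lintegral_lt_top
  refine lintegral_mono_ae ?_
  filter_upwards [ae_restrict_mem measurableSet_Ioo,
    ae_restrict_of_ae (compl_mem_ae_iff.2 (measure_singleton (0 : ℝ)))] with k hk hk0
  have hk0 : k ≠ 0 := hk0
  have hk2 : 0 < k ^ 2 := by positivity
  have hk1 : k ^ 2 ≤ 1 := by nlinarith [hk.1, hk.2]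
  rw [logOneAdd_ofReal (by positivity)]
  refine ENNReal.ofReal_le_ofReal ?_
  have h3 : Real.log (11 / k ^ 2) = Real.log 11 - 2 * Real.log k := by
    rw [Real.log_div (by norm_num) hk2.ne', Real.log_pow]
    norm_num
  rw [← h3]
  refine Real.log_le_log (by positivity) ?_
  rw [le_div_iff₀ hk2, add_mul, div_mul_cancel₀ _ hk2.ne']
  linarith

/-- For |k| ≥ 1 the quantities k² and T² are comparable. For |k| < 1, T² ≤ 10 and log(1 + st) ≤
log(1 + s) + log(1 + t) with t = 10/k² separates an integrable error independent of v. -/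
lemma lintegral_lt_top_of_tsum_logEnergy {v : ℝ → ℝ≥0∞} (h : ∑' n, logEnergy v n < ∞) :
    ∫⁻ k : ℝ, logOneAdd (v k ^ 2 / ENNReal.ofReal (k ^ 2)) * ENNReal.ofReal (1 + k ^ 2) < ∞ := by
  set g : ℝ → ℝ≥0∞ := (Ioo (-1 : ℝ) 1).indicator
    fun k => 2 * logOneAdd (ENNReal.ofReal (10 / k ^ 2)) with hg
  have hgm : Measurable g := Measurable.indicator (measurable_const.mul
    (measurable_logOneAdd.comp (by fun_prop))) measurableSet_Ioo
  have hgi : ∫⁻ k, g k < ∞ := by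
    rw [hg, lintegral_indicator measurableSet_Ioo, lintegral_const_mul' _ _ (by simp)]
    exact ENNReal.mul_lt_top (by simp) lintegral_log_inv_sq_lt_top
  have hpt : ∀ n : ℤ, ∀ᵐ k : ℝ, k ∈ Ico (n : ℝ) (n + 1) →
      logOneAdd (v k ^ 2 / ENNReal.ofReal (k ^ 2)) * ENNReal.ofReal (1 + k ^ 2) ≤
      20 * (ENNReal.ofReal (intScale n ^ 2) *
        logOneAdd (v k ^ 2 / ENNReal.ofReal (intScale n ^ 2))) + g k := by
    intro n
    filter_upwards [compl_mem_ae_iff.2 (measure_singleton (0 : ℝ))] with k hk0 hk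
    have hk0 : k ≠ 0 := hk0
    have hk2 : 0 < k ^ 2 := by positivity
    have hT := one_le_intScale n
    have hT2 : 0 < intScale n ^ 2 := by positivity
    obtain ⟨h2, h3⟩ := intScale_bounds hk.1 hk.2
    have h4 : ENNReal.ofReal (1 + k ^ 2) ≤ 2 * ENNReal.ofReal (intScale n ^ 2) := by
      rw [← ENNReal.ofReal_ofNat 2, ← ENNReal.ofReal_mul (by norm_num)]
      refine ENNReal.ofReal_le_ofReal ?_
      nlinarith
    by_cases hk1 : k ∈ Ioo (-1 : ℝ) 1
    · have hk3 : k ^ 2 ≤ 1 := by nlinarith [hk1.1, hk1.2]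
      have h5 : logOneAdd (v k ^ 2 / ENNReal.ofReal (k ^ 2)) ≤
          logOneAdd (v k ^ 2 / ENNReal.ofReal (intScale n ^ 2)) +
            logOneAdd (ENNReal.ofReal (10 / k ^ 2)) := by
        refine (logOneAdd_mono ?_).trans (logOneAdd_mul_le_add _ _)
        rw [mul_comm]
        refine div_ofReal_le_mul hk2 hT2 (by positivity) ?_
        rw [div_mul_cancel₀ _ hk2.ne']
        linarith
      have h6 : ENNReal.ofReal (1 + k ^ 2) ≤ 2 := by
        rw [← ENNReal.ofReal_ofNat 2]
        exact ENNReal.ofReal_le_ofReal (by linarith)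
      rw [hg, indicator_of_mem hk1]
      calc _ ≤ (logOneAdd (v k ^ 2 / ENNReal.ofReal (intScale n ^ 2)) +
            logOneAdd (ENNReal.ofReal (10 / k ^ 2))) * ENNReal.ofReal (1 + k ^ 2) := by gcongr
        _ = ENNReal.ofReal (1 + k ^ 2) * logOneAdd (v k ^ 2 / ENNReal.ofReal (intScale n ^ 2)) +
            ENNReal.ofReal (1 + k ^ 2) * logOneAdd (ENNReal.ofReal (10 / k ^ 2)) := by ring
        _ ≤ 2 * ENNReal.ofReal (intScale n ^ 2) *
              logOneAdd (v k ^ 2 / ENNReal.ofReal (intScale n ^ 2)) +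
            2 * logOneAdd (ENNReal.ofReal (10 / k ^ 2)) := by gcongr
        _ ≤ _ := by
          rw [mul_assoc]
          gcongr
          norm_num
    · have hk3 : 1 ≤ k ^ 2 := by
        rw [mem_Ioo, ← abs_lt, not_lt] at hk1
        rw [← sq_abs]
        nlinarith
      have h5 := logOneAdd_div_ofReal_le (v := v k ^ 2) (c := 10) hk2 hT2 (by norm_num)
        (by linarith)
      rw [hg, indicator_of_notMem hk1, add_zero]
      calc _ ≤ (ENNReal.ofReal 10 * logOneAdd (v k ^ 2 / ENNReal.ofReal (intScale n ^ 2))) *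
            (2 * ENNReal.ofReal (intScale n ^ 2)) := by gcongr
        _ = ENNReal.ofReal 10 * 2 * (ENNReal.ofReal (intScale n ^ 2) *
            logOneAdd (v k ^ 2 / ENNReal.ofReal (intScale n ^ 2))) := by ring
        _ = _ := by
          rw [ENNReal.ofReal_ofNat]
          norm_num
  rw [lintegral_eq_tsum_Ico_int]
  have h1 : ∑' n : ℤ, ∫⁻ k in Ico (n : ℝ) (n + 1),
      logOneAdd (v k ^ 2 / ENNReal.ofReal (k ^ 2)) * ENNReal.ofReal (1 + k ^ 2) ≤
      ∑' n : ℤ, (20 * logEnergy v n + ∫⁻ k in Ico (n : ℝ) (n + 1), g k) := by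
    refine ENNReal.tsum_le_tsum fun n => ?_
    rw [logEnergy_eq, ← lintegral_const_mul' _ _ (by simp), ← lintegral_add_right _ hgm]
    exact setLIntegral_mono_ae' measurableSet_Ico (hpt n)
  refine h1.trans_lt ?_
  rw [ENNReal.tsum_add, ENNReal.tsum_mul_left, ← lintegral_eq_tsum_Ico_int]
  exact ENNReal.add_lt_top.2 ⟨ENNReal.mul_lt_top (by simp) h, hgi⟩

lemma intScale_sq_le {n m : ℤ} (h : |n - m| ≤ 4) : intScale n ^ 2 ≤ 25 * intScale m ^ 2 := by
  have h' : |(n : ℝ) - m| ≤ 4 := by exact_mod_cast h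
  have h1 : intScale n ≤ 5 * intScale m := by
    unfold intScale
    have := abs_add_le (m : ℝ) (n - m)
    rw [add_sub_cancel] at this
    linarith [abs_nonneg (m : ℝ)]
  have := intScale_pos n
  nlinarith

/-- Each ball meets only the nine unit intervals at index distance at most 4, between which T²
changes by a factor of at most 25. It enters once in front of and once inside the logarithm: 9·25² =
5625. -/
lemma tsum_lintegral_closedBall_le (v : ℝ → ℝ≥0∞) :
    ∑' n : ℤ, (ENNReal.ofReal (intScale n ^ 2) *
      ∫⁻ k in Metric.closedBall ((n : ℝ) + 1 / 2) 4,
        logOneAdd (v k ^ 2 / ENNReal.ofReal (intScale n ^ 2))) ≤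
      5625 * ∑' n, logEnergy v n := by
  have h1 : ∀ n : ℤ, (ENNReal.ofReal (intScale n ^ 2) *
      ∫⁻ k in Metric.closedBall ((n : ℝ) + 1 / 2) 4,
        logOneAdd (v k ^ 2 / ENNReal.ofReal (intScale n ^ 2))) ≤
      ∑ j ∈ Finset.Icc (-4 : ℤ) 4, 625 * logEnergy v (n + j) := by
    intro n
    have hsub : Metric.closedBall ((n : ℝ) + 1 / 2) 4 ⊆
        ⋃ j : Finset.Icc (-4 : ℤ) 4, Ico (((n + j : ℤ) : ℝ)) ((n + j : ℤ) + 1) := by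
      intro y hy
      rw [Metric.mem_closedBall, Real.dist_eq, abs_le] at hy
      have hj : ⌊y⌋ - n ∈ Finset.Icc (-4 : ℤ) 4 := by
        have h3 : n - 4 ≤ ⌊y⌋ := by
          rw [Int.le_floor]; push_cast; linarith
        have h4 : ⌊y⌋ < n + 5 := by
          rw [Int.floor_lt]; push_cast; linarith
        rw [Finset.mem_Icc]
        omega
      refine mem_iUnion.2 ⟨⟨_, hj⟩, ?_⟩
      rw [add_sub_cancel]
      exact ⟨Int.floor_le y, Int.lt_floor_add_one y⟩
    rw [← lintegral_const_mul' _ _ ENNReal.ofReal_ne_top]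
    refine (lintegral_mono_set hsub).trans ((lintegral_iUnion_le _ _).trans ?_)
    rw [tsum_fintype, ← Finset.sum_coe_sort (Finset.Icc (-4 : ℤ) 4)]
    refine Finset.sum_le_sum fun ⟨j, hj⟩ _ => ?_
    rw [logEnergy_eq, ← lintegral_const_mul' _ _ (by simp)]
    refine lintegral_mono fun k => ?_
    have hj' : |j| ≤ 4 := abs_le.2 (Finset.mem_Icc.1 hj)
    have e1 := intScale_sq_le (n := n) (m := n + j) (by simpa using hj')
    have e2 := intScale_sq_le (n := n + j) (m := n) (by simpa using hj')
    have hp1 : 0 < intScale n ^ 2 := pow_pos (intScale_pos n) 2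
    have hp2 : 0 < intScale (n + j) ^ 2 := pow_pos (intScale_pos _) 2
    calc _ ≤ ENNReal.ofReal (25 * intScale (n + j) ^ 2) *
          (ENNReal.ofReal 25 * logOneAdd (v k ^ 2 / ENNReal.ofReal (intScale (n + j) ^ 2))) := by
          gcongr
          exact logOneAdd_div_ofReal_le hp1 hp2 (by norm_num) e2
      _ = _ := by
          rw [ENNReal.ofReal_mul (by norm_num), ENNReal.ofReal_ofNat]
          ring
  refine (ENNReal.tsum_le_tsum h1).trans (le_of_eq ?_)
  rw [Summable.tsum_finsetSum fun _ _ => ENNReal.summable]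
  have h2 : ∀ j ∈ Finset.Icc (-4 : ℤ) 4, ∑' n : ℤ, 625 * logEnergy v (n + j) =
      625 * ∑' n, logEnergy v n := fun j _ => by
    rw [ENNReal.tsum_mul_left]
    congr 1
    exact (Equiv.addRight j).tsum_eq (logEnergy v)
  rw [Finset.sum_congr rfl h2, Finset.sum_const, Int.card_Icc, nsmul_eq_mul, ← mul_assoc]
  congr 1
  norm_num [Int.toNat]

/-! ### Comparison on a unit interval and conclusion -/

lemma localMeasure_le (μ : Measure ℝ) (n : ℤ) :
    localMeasure μ n ≤ (ENNReal.ofReal (intScale n))⁻¹ • μ := by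
  rw [← withDensity_const]
  refine withDensity_mono (Eventually.of_forall fun y => ?_)
  rw [← ENNReal.ofReal_inv_of_pos (intScale_pos n)]
  refine ENNReal.ofReal_le_ofReal ?_
  rw [div_eq_mul_inv]
  exact mul_le_of_le_one_left (inv_nonneg.2 (intScale_pos n).le) (cutoff_le_one n y)

lemma shortMaximal_localMeasure_le (μ : Measure ℝ) (n : ℤ) (k : ℝ) :
    shortMaximal (localMeasure μ n) k ≤ shortMaximal μ k / ENNReal.ofReal (intScale n) := by
  refine iSup₂_le fun L hL => ?_
  calc localMeasure μ n (Icc (k - L) (k + L)) / ENNReal.ofReal (2 * L) ≤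
      ((ENNReal.ofReal (intScale n))⁻¹ * μ (Icc (k - L) (k + L))) / ENNReal.ofReal (2 * L) := by
        gcongr
        exact localMeasure_le μ n _
    _ = (μ (Icc (k - L) (k + L)) / ENNReal.ofReal (2 * L)) / ENNReal.ofReal (intScale n) := by
        simp only [div_eq_mul_inv]; ring
    _ ≤ _ := by
        gcongr
        exact le_iSup₂ (f := fun L (_ : L ∈ Ioc (0 : ℝ) 1) =>
          μ (Icc (k - L) (k + L)) / ENNReal.ofReal (2 * L)) L hL

/-- All intervals [k - L, k + L] with L ≤ 1 lie in [n - 1, n + 2], where the cutoff is 1. The short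
range of the maximal function makes it local. -/
lemma shortMaximal_div_le_localMeasure (μ : Measure ℝ) {n : ℤ} {k : ℝ} (h1 : n ≤ k)
    (h2 : k < n + 1) :
    shortMaximal μ k / ENNReal.ofReal (intScale n) ≤ shortMaximal (localMeasure μ n) k := by
  rw [ENNReal.div_le_iff (by simpa using intScale_pos n) ENNReal.ofReal_ne_top]
  refine iSup₂_le fun L hL => ?_
  have h3 : localMeasure μ n (Icc (k - L) (k + L)) =
      (ENNReal.ofReal (intScale n))⁻¹ * μ (Icc (k - L) (k + L)) := by
    unfold localMeasure
    rw [withDensity_apply _ measurableSet_Icc, ← setLIntegral_const]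
    refine setLIntegral_congr_fun measurableSet_Icc fun y hy => ?_
    rw [cutoff_eq_one (by linarith [hy.1, hL.2]) (by linarith [hy.2, hL.2]), one_div,
      ENNReal.ofReal_inv_of_pos (intScale_pos n)]
  calc μ (Icc (k - L) (k + L)) / ENNReal.ofReal (2 * L) =
      localMeasure μ n (Icc (k - L) (k + L)) / ENNReal.ofReal (2 * L) *
        ENNReal.ofReal (intScale n) := by
        rw [h3, div_eq_mul_inv, div_eq_mul_inv]
        calc _ = (ENNReal.ofReal (intScale n))⁻¹ * ENNReal.ofReal (intScale n) *
              (μ (Icc (k - L) (k + L)) * (ENNReal.ofReal (2 * L))⁻¹) := by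
              rw [ENNReal.inv_mul_cancel (by simpa using intScale_pos n) ENNReal.ofReal_ne_top,
                one_mul]
          _ = _ := by ring
    _ ≤ _ := by
        gcongr
        exact le_iSup₂ (f := fun L (_ : L ∈ Ioc (0 : ℝ) 1) =>
          localMeasure μ n (Icc (k - L) (k + L)) / ENNReal.ofReal (2 * L)) L hL

lemma sq_div_ofReal_sq (v : ℝ≥0∞) {T : ℝ} (hT : 0 ≤ T) :
    v ^ 2 / ENNReal.ofReal (T ^ 2) = (v / ENNReal.ofReal T) ^ 2 := by
  rw [ENNReal.ofReal_pow hT, div_eq_mul_inv, div_eq_mul_inv, mul_pow, ENNReal.inv_pow]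

lemma ofReal_abs_sq_div (a : ℝ) {T : ℝ} (hT : T ≠ 0) :
    ENNReal.ofReal |a| ^ 2 / ENNReal.ofReal (T ^ 2) = ENNReal.ofReal ((a / T) ^ 2) := by
  rw [← ENNReal.ofReal_pow (abs_nonneg a), sq_abs, ← ENNReal.ofReal_div_of_pos (by positivity),
    div_pow]

lemma logOneAdd_ofReal_sq_le {a b c : ℝ} (hc : 0 ≤ c) (h : |a| ≤ |b| + c) :
    logOneAdd (ENNReal.ofReal (a ^ 2)) ≤
      2 * (logOneAdd (ENNReal.ofReal (b ^ 2)) + ENNReal.ofReal (c ^ 2)) := by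
  have h1 : ENNReal.ofReal (a ^ 2) ≤ (ENNReal.ofReal |b| + ENNReal.ofReal c) ^ 2 := by
    rw [← ENNReal.ofReal_add (abs_nonneg b) hc, ← ENNReal.ofReal_pow (by positivity), ← sq_abs a]
    exact ENNReal.ofReal_le_ofReal (pow_le_pow_left₀ (abs_nonneg a) h 2)
  refine ((logOneAdd_mono h1).trans (logOneAdd_sq_add_le _ _)).trans ?_
  rw [← ENNReal.ofReal_pow (abs_nonneg b), sq_abs, ← ENNReal.ofReal_pow hc]
  gcongr
  exact logOneAdd_le_self _

/-- The logarithmic integral over a neighborhood of `[n, n + 1]`. -/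
noncomputable def ballEnergy (v : ℝ → ℝ≥0∞) (n : ℤ) : ℝ≥0∞ :=
  ENNReal.ofReal (intScale n ^ 2) * ∫⁻ k in Metric.closedBall ((n : ℝ) + 1 / 2) 4,
    logOneAdd (v k ^ 2 / ENNReal.ofReal (intScale n ^ 2))

/-- The sequence of local masses controlling the interactions of distant intervals. -/
noncomputable def convMass (μ : Measure ℝ) (n : ℤ) : ℝ :=
  ∑' m : ℤ, sqWeight (n - m) * unitMass μ m

lemma ofReal_mul_localMeasure_univ_sq_le {μ : Measure ℝ} (hμ : ell2MNormSq μ < ∞) (n : ℤ) :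
    ENNReal.ofReal (intScale n ^ 2) * localMeasure μ n univ ^ 2 ≤
      ENNReal.ofReal (25 * convMass μ n ^ 2) := by
  have h0 : 0 ≤ convMass μ n := convolution_unitMass_nonneg μ n
  have hT := intScale_pos n
  calc _ ≤ ENNReal.ofReal (intScale n ^ 2) *
        ENNReal.ofReal (5 * convMass μ n / intScale n) ^ 2 := by
        gcongr
        exact localMeasure_univ_le hμ n
    _ = _ := by
        rw [← ENNReal.ofReal_pow (by positivity), ← ENNReal.ofReal_mul (by positivity)]
        congr 1
        field_simp
        ring

/-- On [n, n + 1] Hμ/T differs from Hν, for the local measure ν, by at most e/T with e = `commBound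
μ n`. The integral of log(1 + (Hν)²) is bounded through ψ(P) by the maximal function of ν, hence of
μ, and by ν(ℝ)². After multiplication by T² both errors lose their dependence on T. -/
lemma logEnergy_hilbertTransform_le {μ : Measure ℝ} (hμ : ell2MNormSq μ < ∞) (n : ℤ) :
    logEnergy (fun k => ENNReal.ofReal |hilbertTransform μ k|) n ≤
      ENNReal.ofReal (10 ^ 9) * ballEnergy (shortMaximal μ) n +
        ENNReal.ofReal (10 ^ 9 * (commBound μ n ^ 2 + convMass μ n ^ 2)) := by
  have := isFiniteMeasure_localMeasure hμ n
  have hT := intScale_pos n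
  have he := commBound_nonneg μ n
  set T := intScale n with hTd
  set e := commBound μ n with hed
  set ν := localMeasure μ n with hν
  have h1 : ∫⁻ k in Ico (n : ℝ) (n + 1),
      logOneAdd (ENNReal.ofReal |hilbertTransform μ k| ^ 2 / ENNReal.ofReal (T ^ 2)) ≤
      ∫⁻ k in Ico (n : ℝ) (n + 1), 2 * (ENNReal.ofReal (Real.log (1 + hilbertTransform ν k ^ 2)) +
        ENNReal.ofReal ((e / T) ^ 2)) := by
    refine setLIntegral_mono_ae' measurableSet_Ico ?_
    filter_upwards [ae_abs_hilbertTransform_localMeasure_sub_le hμ n] with k hk hkn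
    have h2 := hk (by linarith [hkn.1]) (by linarith [hkn.2])
    rw [cutoff_eq_one (by linarith [hkn.1]) (by linarith [hkn.2]), one_mul, ← hTd, ← hν,
      abs_sub_comm] at h2
    rw [ofReal_abs_sq_div _ hT.ne', ← logOneAdd_ofReal (sq_nonneg _)]
    refine logOneAdd_ofReal_sq_le (by positivity) ?_
    have h3 := (abs_sub_abs_le_abs_sub (hilbertTransform μ k) (T * hilbertTransform ν k)).trans h2
    rw [abs_mul, abs_of_pos hT] at h3
    rw [abs_div, abs_of_pos hT, div_le_iff₀ hT, add_mul, div_mul_cancel₀ _ hT.ne']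
    linarith
  have h2 : ∫⁻ k in Ico (n : ℝ) (n + 1),
      2 * (ENNReal.ofReal (Real.log (1 + hilbertTransform ν k ^ 2)) +
        ENNReal.ofReal ((e / T) ^ 2)) ≤
      2 * ((∫⁻ k, ENNReal.ofReal (Real.log (1 + hilbertTransform ν k ^ 2))) +
        ENNReal.ofReal ((e / T) ^ 2)) := by
    rw [lintegral_const_mul' _ _ (by simp), lintegral_add_right _ measurable_const,
      setLIntegral_const, Real.volume_Ico]
    gcongr
    · exact Measure.restrict_le_self
    · simp
  have h3 := lintegral_log_hilbertTransform_le (ae_abs_le_localMeasure μ n) fun ε hε =>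
    lintegral_psi_poissonInt_le_dyadicMaximal (localMeasure_compl_closedBall μ n) hε
  have h4 : ∫⁻ k in Metric.closedBall ((n : ℝ) + 1 / 2) 4, logOneAdd (dyadicMaximal ν k ^ 2) ≤
      ∫⁻ k in Metric.closedBall ((n : ℝ) + 1 / 2) 4,
        logOneAdd (shortMaximal μ k ^ 2 / ENNReal.ofReal (T ^ 2)) := by
    refine lintegral_mono fun k => logOneAdd_mono ?_
    rw [sq_div_ofReal_sq _ hT.le]
    gcongr
    exact (dyadicMaximal_le_shortMaximal ν k).trans (shortMaximal_localMeasure_le μ n k)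
  have h5 := ofReal_mul_localMeasure_univ_sq_le hμ n
  unfold logEnergy
  calc _ ≤ ENNReal.ofReal (T ^ 2) * (2 * (20 * (100000 *
        ((∫⁻ k in Metric.closedBall ((n : ℝ) + 1 / 2) 4,
          logOneAdd (shortMaximal μ k ^ 2 / ENNReal.ofReal (T ^ 2))) + ν univ ^ 2)) +
        ENNReal.ofReal ((e / T) ^ 2))) := by
        gcongr
        refine (h1.trans h2).trans ?_
        gcongr
        refine h3.trans ?_
        gcongr
    _ = 4000000 * ballEnergy (shortMaximal μ) n +
        (4000000 * (ENNReal.ofReal (T ^ 2) * ν univ ^ 2) +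
          2 * (ENNReal.ofReal (T ^ 2) * ENNReal.ofReal ((e / T) ^ 2))) := by
        unfold ballEnergy
        ring
    _ ≤ 4000000 * ballEnergy (shortMaximal μ) n +
        (4000000 * ENNReal.ofReal (25 * convMass μ n ^ 2) + 2 * ENNReal.ofReal (e ^ 2)) := by
        gcongr
        rw [← ENNReal.ofReal_mul (by positivity)]
        refine ENNReal.ofReal_le_ofReal (le_of_eq ?_)
        field_simp
    _ ≤ _ := by
        gcongr
        · rw [← ENNReal.ofReal_ofNat]
          exact ENNReal.ofReal_le_ofReal (by norm_num)
        · rw [← ENNReal.ofReal_ofNat 4000000, ← ENNReal.ofReal_ofNat 2,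
            ← ENNReal.ofReal_mul (by norm_num), ← ENNReal.ofReal_mul (by norm_num),
            ← ENNReal.ofReal_add (by positivity) (by positivity)]
          refine ENNReal.ofReal_le_ofReal ?_
          nlinarith [sq_nonneg e, sq_nonneg (convMass μ n)]

lemma abs_hilbertTransform_le_of_tendsto {ν : Measure ℝ} [IsFiniteMeasure ν] {c k : ℝ}
    (hc : ν (Metric.closedBall c 2)ᶜ = 0) (hk : 3 < |k - c|)
    (h : Tendsto (fun ε => truncHilbert ν ε k) (𝓝[>] 0) (𝓝 (hilbertTransform ν k))) :
    |hilbertTransform ν k| ≤ 3 * |k - c|⁻¹ * ν.real univ := by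
  refine le_of_tendsto h.abs (Eventually.of_forall fun ε => ?_)
  unfold truncHilbert
  have hb : ∀ᵐ y ∂ν, ‖(k - y)⁻¹‖ ≤ 3 * |k - c|⁻¹ := by
    filter_upwards [compl_mem_ae_iff.2 hc] with y hy
    have h1 : |y - c| ≤ 2 := by simpa [Real.dist_eq] using hy
    have h2 : |k - c| ≤ |k - y| + |y - c| := abs_sub_le k y c
    rw [Real.norm_eq_abs, abs_inv]
    calc |k - y|⁻¹ ≤ (|k - c| / 3)⁻¹ := inv_anti₀ (by linarith) (by linarith)
      _ = _ := by rw [inv_div, div_eq_mul_inv]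
  have h2 : ‖∫ y in {y : ℝ | ε < |k - y|}, (k - y)⁻¹ ∂ν‖ ≤
      3 * |k - c|⁻¹ * ν.real {y : ℝ | ε < |k - y|} :=
    norm_setIntegral_le_of_norm_le_const_ae (measure_lt_top _ _) (ae_restrict_of_ae hb)
  rw [abs_mul, abs_of_pos (inv_pos.2 Real.pi_pos)]
  refine (mul_le_of_le_one_left (abs_nonneg _) (inv_le_one_of_one_le₀ ?_)).trans (h2.trans ?_)
  · linarith [Real.pi_gt_three]
  · exact mul_le_mul_of_nonneg_left (measureReal_mono (subset_univ _)) (by positivity)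

/-- Away from the support |Hν| ≤ 3ν(ℝ)/|k - c|, which is square integrable. The tail must be
estimated because the bound of the maximal function by Hν is over all of ℝ. -/
lemma setLIntegral_log_hilbertTransform_compl_le {ν : Measure ℝ} [IsFiniteMeasure ν] {c : ℝ}
    (hc : ν (Metric.closedBall c 2)ᶜ = 0)
    (h : ∀ᵐ k, Tendsto (fun ε => truncHilbert ν ε k) (𝓝[>] 0) (𝓝 (hilbertTransform ν k))) :
    ∫⁻ k in (Metric.closedBall c 3)ᶜ, ENNReal.ofReal (Real.log (1 + hilbertTransform ν k ^ 2)) ≤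
      60 * ν univ ^ 2 := by
  have hi : Integrable fun k : ℝ => (1 + (k - c) ^ 2)⁻¹ := integrable_inv_one_add_sq.comp_sub_right c
  calc _ ≤ ∫⁻ k in (Metric.closedBall c 3)ᶜ,
        ENNReal.ofReal (18 * ν.real univ ^ 2 * (1 + (k - c) ^ 2)⁻¹) := by
        refine setLIntegral_mono_ae' Metric.isClosed_closedBall.measurableSet.compl ?_
        filter_upwards [h] with k hk hkc
        have hkc : 3 < |k - c| := by simpa [Real.dist_eq] using hkc
        have h1 := abs_hilbertTransform_le_of_tendsto hc hkc hk
        refine ENNReal.ofReal_le_ofReal ?_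
        refine (log_one_add_le_self (sq_nonneg _)).trans ?_
        rw [← sq_abs]
        refine (pow_le_pow_left₀ (abs_nonneg _) h1 2).trans ?_
        rw [mul_pow, mul_pow, inv_pow, sq_abs]
        have h2 : ((k - c) ^ 2)⁻¹ ≤ 2 * (1 + (k - c) ^ 2)⁻¹ := by
          have h3 : 9 < (k - c) ^ 2 := by rw [← sq_abs]; nlinarith
          rw [← div_eq_mul_inv, le_div_iff₀ (by positivity), inv_mul_le_iff₀ (by positivity)]
          linarith
        nlinarith [sq_nonneg (ν.real univ)]
    _ ≤ ∫⁻ k, ENNReal.ofReal (18 * ν.real univ ^ 2 * (1 + (k - c) ^ 2)⁻¹) :=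
        setLIntegral_le_lintegral _ _
    _ = ENNReal.ofReal (18 * ν.real univ ^ 2 * Real.pi) := by
        rw [← ofReal_integral_eq_lintegral_ofReal (hi.const_mul _)
          (Eventually.of_forall fun k => by positivity), integral_const_mul,
          integral_sub_right_eq_self (fun k : ℝ => (1 + k ^ 2)⁻¹), integral_univ_inv_one_add_sq]
    _ ≤ ENNReal.ofReal (60 * ν.real univ ^ 2) := by
        refine ENNReal.ofReal_le_ofReal ?_
        nlinarith [sq_nonneg (ν.real univ), Real.pi_lt_d2]
    _ = 60 * ν univ ^ 2 := by
        rw [ENNReal.ofReal_mul (by norm_num), ENNReal.ofReal_pow measureReal_nonneg,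
          ofReal_measureReal, ENNReal.ofReal_ofNat]

lemma logEnergy_shortMaximal_le {μ : Measure ℝ} (hμ : ell2MNormSq μ < ∞) (n : ℤ) :
    logEnergy (shortMaximal μ) n ≤
      ENNReal.ofReal (10 ^ 9) *
        ballEnergy (fun k => ENNReal.ofReal |hilbertTransform μ k|) n +
        ENNReal.ofReal (10 ^ 9 * (commBound μ n ^ 2 + convMass μ n ^ 2)) := by
  have := isFiniteMeasure_localMeasure hμ n
  have hT := intScale_pos n
  have he := commBound_nonneg μ n
  set T := intScale n with hTd
  set e := commBound μ n with hed
  set ν := localMeasure μ n with hν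
  set F : ℝ → ℝ≥0∞ := fun k => logOneAdd
    (ENNReal.ofReal |hilbertTransform μ k| ^ 2 / ENNReal.ofReal (T ^ 2)) with hF
  have h1 : ∫⁻ k in Ico (n : ℝ) (n + 1),
      logOneAdd (shortMaximal μ k ^ 2 / ENNReal.ofReal (T ^ 2)) ≤
      4 * ∫⁻ k, logOneAdd (dyadicMaximal ν k ^ 2) := by
    calc _ ≤ ∫⁻ k in Ico (n : ℝ) (n + 1), 4 * logOneAdd (dyadicMaximal ν k ^ 2) := by
          refine setLIntegral_mono' measurableSet_Ico fun k hk => ?_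
          have h2 : (shortMaximal μ k / ENNReal.ofReal T) ^ 2 ≤
              ENNReal.ofReal 4 * dyadicMaximal ν k ^ 2 := by
            calc _ ≤ (2 * dyadicMaximal ν k) ^ 2 := by
                  gcongr
                  exact (shortMaximal_div_le_localMeasure μ hk.1 hk.2).trans
                    (shortMaximal_le_dyadicMaximal ν k)
              _ = _ := by rw [mul_pow, ENNReal.ofReal_ofNat]; norm_num
          rw [sq_div_ofReal_sq _ hT.le]
          refine ((logOneAdd_mono h2).trans (logOneAdd_mul_le (by norm_num) _)).trans ?_
          rw [ENNReal.ofReal_ofNat]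
      _ ≤ ∫⁻ k, 4 * logOneAdd (dyadicMaximal ν k ^ 2) := setLIntegral_le_lintegral _ _
      _ = _ := lintegral_const_mul' _ _ (by simp)
  have h2 := lintegral_log_dyadicMaximal_le (by positivity) (ae_abs_le_localMeasure μ n)
  -- This ball lies in [n - 3, n + 4], where the commutator bound holds. The cutoff may be less than
  -- 1 there, but only the upper bound χ|Hμ| ≤ |Hμ| is used.
  have h3 : ∫⁻ k in Metric.closedBall ((n : ℝ) + 1 / 2) 3,
      ENNReal.ofReal (Real.log (1 + hilbertTransform ν k ^ 2)) ≤
      2 * ((∫⁻ k in Metric.closedBall ((n : ℝ) + 1 / 2) 4, F k) +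
        6 * ENNReal.ofReal ((e / T) ^ 2)) := by
    calc _ ≤ ∫⁻ k in Metric.closedBall ((n : ℝ) + 1 / 2) 3,
          2 * (F k + ENNReal.ofReal ((e / T) ^ 2)) := by
          refine setLIntegral_mono_ae' Metric.isClosed_closedBall.measurableSet ?_
          filter_upwards [ae_abs_hilbertTransform_localMeasure_sub_le hμ n] with k hk hkn
          rw [Metric.mem_closedBall, Real.dist_eq, abs_le] at hkn
          have h4 := hk (by linarith [hkn.1]) (by linarith [hkn.2])
          rw [← hTd, ← hν] at h4
          rw [hF, ← logOneAdd_ofReal (sq_nonneg _)]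
          simp only
          rw [ofReal_abs_sq_div _ hT.ne']
          refine logOneAdd_ofReal_sq_le (by positivity) ?_
          have h5 := (abs_sub_abs_le_abs_sub _ _).trans h4
          rw [abs_mul, abs_mul, abs_of_pos hT, abs_of_nonneg (cutoff_nonneg n k)] at h5
          have h6 := mul_le_of_le_one_left (abs_nonneg (hilbertTransform μ k)) (cutoff_le_one n k)
          rw [abs_div, abs_of_pos hT, ← add_div, le_div_iff₀ hT]
          linarith
      _ = 2 * ((∫⁻ k in Metric.closedBall ((n : ℝ) + 1 / 2) 3, F k) +
          6 * ENNReal.ofReal ((e / T) ^ 2)) := by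
          rw [lintegral_const_mul' _ _ (by simp), lintegral_add_right _ measurable_const,
            setLIntegral_const, Real.volume_closedBall, mul_comm (ENNReal.ofReal _)]
          norm_num
      _ ≤ _ := mul_le_mul' le_rfl (add_le_add (lintegral_mono_set
          (Metric.closedBall_subset_closedBall (by norm_num))) le_rfl)
  have h4 := setLIntegral_log_hilbertTransform_compl_le (localMeasure_compl_closedBall μ n)
    (ae_tendsto_localMeasure hμ n)
  have h5 := ofReal_mul_localMeasure_univ_sq_le hμ n
  have h6 : ∫⁻ k, ENNReal.ofReal (Real.log (1 + hilbertTransform ν k ^ 2)) ≤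
      2 * ((∫⁻ k in Metric.closedBall ((n : ℝ) + 1 / 2) 4, F k) +
        6 * ENNReal.ofReal ((e / T) ^ 2)) + 60 * ν univ ^ 2 := by
    rw [← lintegral_add_compl _ (Metric.isClosed_closedBall (x := (n : ℝ) + 1 / 2)
      (ε := 3)).measurableSet]
    exact add_le_add h3 h4
  unfold logEnergy
  calc _ ≤ ENNReal.ofReal (T ^ 2) * (4 * (15360 *
        (2 * ((∫⁻ k in Metric.closedBall ((n : ℝ) + 1 / 2) 4, F k) +
        6 * ENNReal.ofReal ((e / T) ^ 2)) + 60 * ν univ ^ 2))) := by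
        gcongr
        refine h1.trans ?_
        gcongr
        refine h2.trans ?_
        gcongr
    _ = 122880 * ballEnergy (fun k => ENNReal.ofReal |hilbertTransform μ k|) n +
        (3686400 * (ENNReal.ofReal (T ^ 2) * ν univ ^ 2) +
          737280 * (ENNReal.ofReal (T ^ 2) * ENNReal.ofReal ((e / T) ^ 2))) := by
        unfold ballEnergy
        ring
    _ ≤ 122880 * ballEnergy (fun k => ENNReal.ofReal |hilbertTransform μ k|) n +
        (3686400 * ENNReal.ofReal (25 * convMass μ n ^ 2) + 737280 * ENNReal.ofReal (e ^ 2)) := by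
        gcongr
        rw [← ENNReal.ofReal_mul (by positivity)]
        refine ENNReal.ofReal_le_ofReal (le_of_eq ?_)
        field_simp
    _ ≤ _ := by
        gcongr
        · rw [← ENNReal.ofReal_ofNat]
          exact ENNReal.ofReal_le_ofReal (by norm_num)
        · rw [← ENNReal.ofReal_ofNat 3686400, ← ENNReal.ofReal_ofNat 737280,
            ← ENNReal.ofReal_mul (by norm_num), ← ENNReal.ofReal_mul (by norm_num),
            ← ENNReal.ofReal_add (by positivity) (by positivity)]
          refine ENNReal.ofReal_le_ofReal ?_
          nlinarith [sq_nonneg e, sq_nonneg (convMass μ n)]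

lemma tsum_logEnergy_lt_top_of_le {μ : Measure ℝ} (hμ : ell2MNormSq μ < ∞) {v w : ℝ → ℝ≥0∞}
    {C : ℝ} (hC : 0 ≤ C) (h : ∀ n, logEnergy v n ≤ ENNReal.ofReal C * ballEnergy w n +
      ENNReal.ofReal (C * (commBound μ n ^ 2 + convMass μ n ^ 2)))
    (hw : ∑' n, logEnergy w n < ∞) : ∑' n, logEnergy v n < ∞ := by
  refine (ENNReal.tsum_le_tsum h).trans_lt ?_
  have hs : Summable fun n => C * (commBound μ n ^ 2 + convMass μ n ^ 2) :=
    ((summable_commBound_sq hμ).add (summable_sq_convolution (summable_unitMass_sq hμ))).mul_left C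
  rw [ENNReal.tsum_add, ENNReal.tsum_mul_left,
    ← ENNReal.ofReal_tsum_of_nonneg (fun n => by positivity) hs]
  exact ENNReal.add_lt_top.2 ⟨ENNReal.mul_lt_top ENNReal.ofReal_lt_top
    ((tsum_lintegral_closedBall_le w).trans_lt (ENNReal.mul_lt_top (by simp) hw)),
    ENNReal.ofReal_lt_top⟩

theorem theorem11p2 (μ : Measure ℝ) (hμ : ell2MNormSq μ < ∞) :
    (∀ᵐ k : ℝ, HasHilbertTransformAt μ k (hilbertTransform μ k)) ∧
      ((∫⁻ k : ℝ, logOneAdd (ENNReal.ofReal (|hilbertTransform μ k| ^ 2 / k ^ 2)) *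
            ENNReal.ofReal (1 + k ^ 2) < ∞) ↔
        (∫⁻ k : ℝ, logOneAdd (shortMaximal μ k ^ 2 / ENNReal.ofReal (k ^ 2)) *
            ENNReal.ofReal (1 + k ^ 2) < ∞)) := by
  refine ⟨ae_hasHilbertTransformAt hμ, ?_⟩
  -- Real and extended division by k² disagree at k = 0 unless the numerator vanishes; a single
  -- point is negligible.
  have h1 : ∫⁻ k : ℝ, logOneAdd (ENNReal.ofReal (|hilbertTransform μ k| ^ 2 / k ^ 2)) *
      ENNReal.ofReal (1 + k ^ 2) =
      ∫⁻ k : ℝ, logOneAdd (ENNReal.ofReal |hilbertTransform μ k| ^ 2 / ENNReal.ofReal (k ^ 2)) *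
        ENNReal.ofReal (1 + k ^ 2) := by
    refine lintegral_congr_ae ?_
    filter_upwards [compl_mem_ae_iff.2 (measure_singleton (0 : ℝ))] with k hk
    rw [ofReal_abs_sq_div _ hk, sq_abs, div_pow]
  rw [h1]
  constructor
  · intro h
    exact lintegral_lt_top_of_tsum_logEnergy (tsum_logEnergy_lt_top_of_le hμ (by norm_num)
      (logEnergy_shortMaximal_le hμ) (tsum_logEnergy_lt_top h))
  · intro h
    exact lintegral_lt_top_of_tsum_logEnergy (tsum_logEnergy_lt_top_of_le hμ (by norm_num)
      (logEnergy_hilbertTransform_le hμ) (tsum_logEnergy_lt_top h))
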